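/- All graphs are finite and simple. A graph is \emph{hypotraceable} if it contains no Hamiltonian path, but for every vertex $v$ the graph $G-v$ contains a Hamiltonian path. There exists a planar hypotraceable graph on $154$ vertices, and for every integer $n \geq 156$ there exists a planar hypotraceable graph on $n$ vertices. -/

import Mathlib

namespace SimpleGraph

/-- A graph is traceable if it contains a Hamiltonian path. -/
def IsTraceable {V : Type*} [DecidableEq V] (G : SimpleGraph V) : Prop :=
  ∃ (a b : V) (p : G.Walk a b), p.IsHamiltonian

/-- A graph is hypotraceable if it has no Hamiltonian path, but deleting any single vertex
gives a graph with a Hamiltonian path. -/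
def IsHypotraceable {V : Type*} [DecidableEq V] (G : SimpleGraph V) : Prop :=
  ¬ G.IsTraceable ∧ ∀ v : V, (G.induce {w : V | w ≠ v}).IsTraceable

/-- An embedding of a graph in the Euclidean plane. Vertices are distinct points; each edge `uv`
is a simple arc joining the points of `u` and `v`; an arc contains no vertices other than its two
ends, and two distinct arcs meet at most in a common end. (The values of `arc` at pairs that are
not edges of `G` play no role.) -/
structure PlaneEmbedding {V : Type*} (G : SimpleGraph V) where
  /-- the point that represents a vertex -/
  point : V → EuclideanSpace ℝ (Fin 2)
  /-- the arc that represents an edge -/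
  arc : Sym2 V → Set (EuclideanSpace ℝ (Fin 2))
  point_injective : Function.Injective point
  arc_isArc : ∀ u v : V, G.Adj u v →
    ∃ γ : _root_.Path (point u) (point v), Function.Injective γ ∧ Set.range γ = arc s(u, v)
  vertex_of_mem_arc : ∀ e ∈ G.edgeSet, ∀ w : V, point w ∈ arc e → w ∈ e
  arc_inter_arc : ∀ e ∈ G.edgeSet, ∀ f ∈ G.edgeSet, e ≠ f →
    ∀ x ∈ arc e ∩ arc f, ∃ w : V, w ∈ e ∧ w ∈ f ∧ point w = x

/-- A graph is planar if it can be embedded in the plane. -/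
def IsPlanar {V : Type*} (G : SimpleGraph V) : Prop :=
  Nonempty G.PlaneEmbedding

end SimpleGraph

/-! ### Spanning paths as lists -/

/-- `l` lists the vertices of a path of `R` that visits exactly the elements of `S`. -/
structure SpanPath {α : Type*} (R : α → α → Prop) (S : Set α) (l : List α) : Prop where
  chain : l.IsChain R
  nodup : l.Nodup
  mem : ∀ x, x ∈ l ↔ x ∈ S

/-- `l` begins with `s` and ends with `t`. -/
def FromTo {α : Type*} (l : List α) (s t : α) : Prop :=
  l.head? = some s ∧ l.getLast? = some t

theorem FromTo.reverse {α : Type*} {l : List α} {s t : α} (h : FromTo l s t) :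
    FromTo l.reverse t s := by
  simpa [FromTo, and_comm] using h

theorem SpanPath.reverse {α : Type*} {R : α → α → Prop} (hR : ∀ x y, R x y → R y x) {S : Set α}
    {l : List α} (h : SpanPath R S l) : SpanPath R S l.reverse :=
  ⟨List.isChain_reverse.2 (h.chain.imp fun _ _ => hR _ _), List.nodup_reverse.2 h.nodup,
    fun x => by simpa using h.mem x⟩

theorem FromTo.mem_left {α : Type*} {l : List α} {s t : α} (h : FromTo l s t) : s ∈ l :=
  List.mem_of_head? h.1

theorem FromTo.mem_right {α : Type*} {l : List α} {s t : α} (h : FromTo l s t) : t ∈ l :=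
  List.mem_of_getLast? h.2

theorem FromTo.append {α : Type*} {l₁ l₂ : List α} {s t u v : α} (h₁ : FromTo l₁ s t)
    (h₂ : FromTo l₂ u v) : FromTo (l₁ ++ l₂) s v := by
  simp [FromTo, h₁.1, h₂.2]

theorem FromTo.isChain_append {α : Type*} {R : α → α → Prop} {l₁ l₂ : List α} {s t u v : α}
    (h₁ : FromTo l₁ s t) (h₂ : FromTo l₂ u v) (c₁ : l₁.IsChain R) (c₂ : l₂.IsChain R)
    (h : R t u) : (l₁ ++ l₂).IsChain R := by
  refine List.isChain_append.2 ⟨c₁, c₂, ?_⟩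
  simp [h₁.2, h₂.1, h]

theorem fromTo_singleton {α : Type*} (s : α) : FromTo [s] s s := by simp [FromTo]

/-- Splitting a list after its longest prefix inside `S`. -/
theorem exists_prefix_run {α : Type*} (S : Set α) (l : List α) :
    ∃ m q, l = m ++ q ∧ (∀ x ∈ m, x ∈ S) ∧ ∀ x ∈ q.head?, x ∉ S := by
  induction l with
  | nil => exact ⟨[], [], by simp⟩
  | cons y l ih =>
    by_cases hy : y ∈ S
    · obtain ⟨m, q, rfl, hm, hq⟩ := ih
      exact ⟨y :: m, q, rfl, by simpa [hy] using hm, hq⟩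
    · exact ⟨[], y :: l, rfl, by simp, by simpa using hy⟩

theorem exists_suffix_run {α : Type*} (S : Set α) (l : List α) :
    ∃ p m, l = p ++ m ∧ (∀ x ∈ m, x ∈ S) ∧ ∀ x ∈ p.getLast?, x ∉ S := by
  obtain ⟨m, q, h, hm, hq⟩ := exists_prefix_run S l.reverse
  refine ⟨q.reverse, m.reverse, ?_, by simpa using hm, by simpa using hq⟩
  rw [← List.reverse_append, ← h, List.reverse_reverse]

/-- A list that starts and ends outside `S` but meets `S` enters and leaves `S`. -/
theorem exists_crossings {α : Type*} {R : α → α → Prop} {S : Set α} {l : List α}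
    (hc : l.IsChain R) (hn : l.Nodup) (hh : ∀ x ∈ l.head?, x ∉ S) (hl : ∀ x ∈ l.getLast?, x ∉ S)
    {z : α} (hz : z ∈ l) (hzS : z ∈ S) :
    ∃ o y y' o', o ∈ l ∧ y ∈ l ∧ y' ∈ l ∧ o' ∈ l ∧ o ∉ S ∧ o' ∉ S ∧ y ∈ S ∧ y' ∈ S ∧ o ≠ o' ∧
      R o y ∧ R y' o' := by
  obtain ⟨l₁, l₂, rfl⟩ := List.append_of_mem hz
  obtain ⟨p, m, rfl, hm, hp⟩ := exists_suffix_run S l₁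
  obtain ⟨m', q, rfl, hm', hq⟩ := exists_prefix_run S l₂
  rcases List.eq_nil_or_concat p with rfl | ⟨p, o, rfl⟩
  · exfalso
    cases m with
    | nil => exact hh z (by simp) hzS
    | cons y m => exact hh y (by simp) (hm y (by simp))
  cases q with
  | nil =>
    exfalso
    rcases List.eq_nil_or_concat m' with rfl | ⟨m', y, rfl⟩
    · exact hl z (by simp [List.getLast?_cons]) hzS
    · exact hl y (by simp [List.getLast?_cons]) (hm' y (by simp))
  | cons o' q =>
    have ho : o ∉ S := hp o (by simp)
    have ho' : o' ∉ S := hq o' (by simp)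
    have hne : o ≠ o' := by
      rintro rfl
      simp [List.nodup_append] at hn
    obtain ⟨y, r, hy⟩ : ∃ y r, m ++ z :: (m' ++ o' :: q) = y :: r ∧ y ∈ S := by
      cases m with
      | nil => exact ⟨z, _, rfl, hzS⟩
      | cons y m => exact ⟨y, _, rfl, hm y (by simp)⟩
    obtain ⟨y', r', hy'⟩ : ∃ y' r', p ++ [o] ++ m ++ z :: m' = r' ++ [y'] ∧ y' ∈ S := by
      rcases List.eq_nil_or_concat m' with rfl | ⟨m', y', rfl⟩
      · exact ⟨z, _, rfl, hzS⟩
      · exact ⟨y', p ++ [o] ++ m ++ z :: m', by simp, hm' y' (by simp)⟩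
    refine ⟨o, y, y', o', by simp, ?_, ?_, by simp, ho, ho', hy.2, hy'.2, hne, ?_, ?_⟩
    · have : y ∈ y :: r := by simp
      rw [← hy.1] at this
      simp at this ⊢
      tauto
    · have : y' ∈ r' ++ [y'] := by simp
      rw [← hy'.1] at this
      simp at this ⊢
      tauto
    · have h : p.concat o ++ m ++ z :: (m' ++ o' :: q) = p ++ o :: y :: r := by
        rw [← hy.1]; simp
      rw [h] at hc
      exact (List.isChain_append_cons_cons.1 hc).2.1
    · have h : p.concat o ++ m ++ z :: (m' ++ o' :: q) = r' ++ y' :: o' :: q := by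
        have := congrArg (· ++ o' :: q) hy'.1
        simpa using this
      rw [h] at hc
      exact (List.isChain_append_cons_cons.1 hc).2.1

/-! ### Assembling a graph from four pieces -/

/-- A graph `R` built from four pieces with three terminals each. The piece `(i, j)` consists of
`S i j` and the terminal `A i`, which it shares with the piece `(i, !j)`; its other terminals
`B i j`, `C i j` are joined to those of `(!i, j)`. No piece has a Hamiltonian path between two of
its terminals, but each vertex-deleted piece does. -/
structure Assembly {α : Type*} (R : α → α → Prop) (S : Bool → Bool → Set α) (A : Bool → α)
    (B C : Bool → Bool → α) : Prop where
  symm : ∀ x y, R x y → R y x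
  disj : ∀ {i j i' j' x}, x ∈ S i j → x ∈ S i' j' → i = i' ∧ j = j'
  notMem : ∀ i i' j', A i ∉ S i' j'
  A_ne : A false ≠ A true
  B_mem : ∀ i j, B i j ∈ S i j
  C_mem : ∀ i j, C i j ∈ S i j
  adj_B : ∀ i j, R (B i j) (B (!i) j)
  adj_C : ∀ i j, R (C i j) (C (!i) j)
  adj_S : ∀ {i j x y}, R x y → x ∈ S i j →
    y ∈ S i j ∨ y = A i ∨ (x = B i j ∧ y = B (!i) j) ∨ (x = C i j ∧ y = C (!i) j)
  adj_A : ∀ {i y}, R (A i) y → ∃ j, y ∈ S i j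
  not_span : ∀ i j l s t, SpanPath R (insert (A i) (S i j)) l → FromTo l s t →
    (s = A i ∨ s = B i j ∨ s = C i j) → (t = A i ∨ t = B i j ∨ t = C i j) → False
  exists_del : ∀ i j, ∀ v ∈ insert (A i) (S i j), ∃ l, SpanPath R (insert (A i) (S i j) \ {v}) l ∧
    (FromTo l (B i j) (C i j) ∨ FromTo l (A i) (B i j) ∨ FromTo l (A i) (C i j))
  exists_span_B : ∀ i j, ∃ l t, SpanPath R (insert (A i) (S i j)) l ∧ FromTo l (B i j) t
  exists_span_C : ∀ i j, ∃ l t, SpanPath R (insert (A i) (S i j)) l ∧ FromTo l (C i j) t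

namespace Assembly

variable {α : Type*} {R : α → α → Prop} {S : Bool → Bool → Set α} {A : Bool → α}
  {B C : Bool → Bool → α}

/-- The set of all vertices of an assembly. -/
def carrier (S : Bool → Bool → Set α) (A : Bool → α) : Set α :=
  {x | (∃ i, x = A i) ∨ ∃ i j, x ∈ S i j}

theorem swap (h : Assembly R S A B C) : Assembly R S A C B where
  symm := h.symm
  disj := h.disj
  notMem := h.notMem
  A_ne := h.A_ne
  B_mem := h.C_mem
  C_mem := h.B_mem
  adj_B := h.adj_C
  adj_C := h.adj_B
  adj_S := fun hr hx => by
    have := h.adj_S hr hx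
    tauto
  adj_A := h.adj_A
  not_span := fun i j l s t hl hf hs ht => h.not_span i j l s t hl hf (by tauto) (by tauto)
  exists_del := fun i j v hv => by
    obtain ⟨l, hl, h' | h' | h'⟩ := h.exists_del i j v hv
    · exact ⟨l.reverse, hl.reverse h.symm, Or.inl h'.reverse⟩
    · exact ⟨l, hl, by tauto⟩
    · exact ⟨l, hl, by tauto⟩
  exists_span_B := h.exists_span_C
  exists_span_C := h.exists_span_B

/-- A stretch of a path that avoids the shared terminal, begins and ends outside the piece, and
meets it, passes through both other terminals. -/
theorem mem_of_crossing (h : Assembly R S A B C) {i j : Bool} {l : List α} (hc : l.IsChain R)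
    (hn : l.Nodup) (hh : ∀ x ∈ l.head?, x ∉ S i j) (hl : ∀ x ∈ l.getLast?, x ∉ S i j)
    (hA : A i ∉ l) {z : α} (hz : z ∈ l) (hzS : z ∈ S i j) : B i j ∈ l ∧ C i j ∈ l := by
  obtain ⟨o, y, y', o', h1, h2, h3, h4, h5, h6, h7, h8, h9, h10, h11⟩ :=
    exists_crossings hc hn hh hl hz hzS
  have e1 := h.adj_S (h.symm _ _ h10) h7
  have e2 := h.adj_S h11 h8
  have n1 : o ≠ A i := fun e => hA (e ▸ h1)
  have n2 : o' ≠ A i := fun e => hA (e ▸ h4)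
  grind

/-- A path with no end in a piece (apart from the shared terminal) makes no step between the
shared terminal and the rest of the piece. -/
theorem no_step (h : Assembly R S A B C) {i j : Bool} {p r : List α} {s : α}
    (hl : SpanPath R (carrier S A) (p ++ A i :: s :: r))
    (hh : ∀ x ∈ (p ++ A i :: s :: r).head?, x ∉ S i j)
    (ht : ∀ x ∈ (p ++ A i :: s :: r).getLast?, x ∉ S i j) : s ∉ S i j := by
  intro hs
  obtain ⟨p, m, rfl, hm, hp⟩ := exists_suffix_run (S i j) p
  obtain ⟨m', q, rfl, hm', hq⟩ := exists_prefix_run (S i j) r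
  have hpm : p = [] → m = [] := by
    rintro rfl
    cases m with
    | nil => rfl
    | cons y m => exact (hh y (by simp) (hm y (by simp))).elim
  obtain ⟨v, q', hqv⟩ : ∃ v q', q = v :: q' := by
    cases q with
    | cons v q' => exact ⟨v, q', rfl⟩
    | nil =>
      exfalso
      rcases List.eq_nil_or_concat m' with rfl | ⟨m', y, rfl⟩
      · exact ht s (by simp) hs
      · exact ht y (by simp [List.getLast?_cons]) (hm' y (by simp))
  have hvS : v ∉ S i j := hq v (by simp [hqv])
  obtain ⟨y, n, hy, hyS⟩ : ∃ y n, s :: m' = n ++ [y] ∧ y ∈ S i j := by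
    rcases List.eq_nil_or_concat m' with rfl | ⟨m', y, rfl⟩
    · exact ⟨s, [], rfl, hs⟩
    · exact ⟨y, s :: m', by simp, hm' y (by simp)⟩
  have hM : p ++ m ++ A i :: s :: (m' ++ q) = p ++ (m ++ A i :: (n ++ [y])) ++ q := by
    rw [← hy]; simp
  have hnd := hl.nodup
  have hch := hl.chain
  rw [hM] at hnd hch hh ht
  have hAn : A i ∉ p ∧ A i ∉ q := by
    simp only [List.nodup_append, List.mem_append] at hnd
    constructor <;> intro hA <;> grind
  have hyt : y = B i j ∨ y = C i j := by
    have : R y v := by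
      have e : p ++ (m ++ A i :: (n ++ [y])) ++ q = (p ++ m ++ A i :: n) ++ y :: v :: q' := by
        simp [hqv]
      rw [e] at hch
      exact (List.isChain_append_cons_cons.1 hch).2.1
    have hvA : v ≠ A i := by rintro rfl; exact hAn.2 (by simp [hqv])
    have := h.adj_S this hyS
    grind
  have hyp : y ∉ p ∧ y ∉ q := by
    simp only [List.nodup_append, List.mem_append] at hnd
    constructor <;> intro hA <;> grind
  have hpn : ∀ z ∈ p, z ∉ S i j := by
    intro z hz hzS
    have hp0 : p ≠ [] := by rintro rfl; simp at hz
    have := h.mem_of_crossing (i := i) (j := j) (l := p) (hch.left_of_append.left_of_append)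
      (hnd.sublist (by simp)) ?_ hp hAn.1 hz hzS
    · grind
    · intro x hx
      exact hh x (by cases p with
        | nil => simp at hx
        | cons a p => simpa using hx)
  have hqn : ∀ z ∈ q, z ∉ S i j := by
    intro z hz hzS
    have := h.mem_of_crossing (i := i) (j := j) (l := q) (hch.right_of_append)
      (hnd.sublist (List.sublist_append_right _ _)) hq ?_ hAn.2 hz hzS
    · grind
    · intro x hx
      exact ht x (by
        rw [List.getLast?_append, Option.mem_def.1 hx]; simp)
  have hspan : SpanPath R (insert (A i) (S i j)) (m ++ A i :: (n ++ [y])) := by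
    refine ⟨hch.left_of_append.right_of_append, hnd.sublist (by simp), fun x => ?_⟩
    have hn' : ∀ x, x ∈ n ++ [y] ↔ x ∈ s :: m' := by rw [hy]; simp
    constructor
    · intro hx
      rw [List.mem_append, List.mem_cons, hn', List.mem_cons] at hx
      rcases hx with hx | rfl | rfl | hx
      · exact Or.inr (hm x hx)
      · exact Or.inl rfl
      · exact Or.inr hs
      · exact Or.inr (hm' x hx)
    · rintro (rfl | hx)
      · simp
      · have : x ∈ p ++ m ++ A i :: s :: (m' ++ q) := (hl.mem x).2 (Or.inr ⟨i, j, hx⟩)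
        rw [hM, List.mem_append, List.mem_append] at this
        rcases this with (h1 | h1) | h1
        · exact (hpn x h1 hx).elim
        · exact h1
        · exact (hqn x h1 hx).elim
  have hy' : y = A i ∨ y = B i j ∨ y = C i j := Or.inr hyt
  cases m with
  | nil => exact h.not_span i j _ (A i) y hspan (by simp [FromTo, List.getLast?_cons]) (Or.inl rfl) hy'
  | cons x m =>
    rcases List.eq_nil_or_concat p with rfl | ⟨p, u, rfl⟩
    · simpa using hpm rfl
    refine h.not_span i j _ x y hspan (by simp [FromTo, List.getLast?_cons]) ?_ hy'
    have hu : u ∉ S i j := hp u (by simp)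
    have huA : u ≠ A i := by rintro rfl; exact hAn.1 (by simp)
    have hxS := hm x (by simp)
    have hux : R u x := by
      have e : p.concat u ++ (x :: m ++ A i :: (n ++ [y])) ++ q
          = p ++ u :: x :: (m ++ A i :: (n ++ [y]) ++ q) := by simp
      rw [e] at hch
      exact (List.isChain_append_cons_cons.1 hch).2.1
    have := h.adj_S (h.symm _ _ hux) hxS
    grind

end Assembly

namespace Assembly

variable {α : Type*} {R : α → α → Prop} {S : Bool → Bool → Set α} {A : Bool → α}
  {B C : Bool → Bool → α}

theorem _root_.List.IsChain.mem_iff_mem {α : Type*} {R : α → α → Prop} {l : List α}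
    (hl : l.IsChain R) {X : Set α} (hX : ∀ x y, R x y → (x ∈ X ↔ y ∈ X)) {x y : α} (hx : x ∈ l)
    (hy : y ∈ l) : x ∈ X ↔ y ∈ X := by
  have : IsTrans α (fun x y => x ∈ X ↔ y ∈ X) := ⟨fun _ _ _ h₁ h₂ => h₁.trans h₂⟩
  have h := List.isChain_iff_pairwise.1 (hl.imp hX)
  have : Std.Symm (fun x y => x ∈ X ↔ y ∈ X) := ⟨fun _ _ h => h.symm⟩
  exact List.Pairwise.forall_of_forall (R := fun x y => x ∈ X ↔ y ∈ X) (fun _ _ => Iff.rfl) h hx hy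

theorem not_both_free (h : Assembly R S A B C) {l : List α} (hl : SpanPath R (carrier S A) l)
    {i j i' j' : Bool} (hne : ¬ (i = i' ∧ j = j'))
    (h₁ : ∀ x ∈ l.head?, x ∉ S i j) (h₂ : ∀ x ∈ l.getLast?, x ∉ S i j)
    (h₁' : ∀ x ∈ l.head?, x ∉ S i' j') (h₂' : ∀ x ∈ l.getLast?, x ∉ S i' j') : False := by
  have key : ∀ i j, (∀ x ∈ l.head?, x ∉ S i j) → (∀ x ∈ l.getLast?, x ∉ S i j) →
      l.IsChain fun x y => R x y ∧ ¬ (x = A i ∧ y ∈ S i j) ∧ ¬ (y = A i ∧ x ∈ S i j) := by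
    intro i j hh ht
    rw [List.isChain_iff_forall_rel_of_append_cons_cons]
    intro x y p r hpr
    subst hpr
    refine ⟨(List.isChain_append_cons_cons.1 hl.chain).2.1, ?_, ?_⟩
    · rintro ⟨rfl, hy⟩
      exact h.no_step hl hh ht hy
    · rintro ⟨rfl, hx⟩
      have hl' := hl.reverse h.symm
      have e : (p ++ x :: A i :: r).reverse = r.reverse ++ A i :: x :: p.reverse := by simp
      rw [e] at hl'
      refine h.no_step hl' ?_ ?_ hx
      · rw [← e, List.head?_reverse]; exact ht
      · rw [← e, List.getLast?_reverse]; exact hh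
  have k₁ := key i j h₁ h₂
  have k₂ := key i' j' h₁' h₂'
  have hch : l.IsChain fun x y =>
      (R x y ∧ ¬ (x = A i ∧ y ∈ S i j) ∧ ¬ (y = A i ∧ x ∈ S i j)) ∧
      (R x y ∧ ¬ (x = A i' ∧ y ∈ S i' j') ∧ ¬ (y = A i' ∧ x ∈ S i' j')) := by
    rw [List.isChain_iff_forall_rel_of_append_cons_cons] at k₁ k₂ ⊢
    exact fun x y p r hpr => ⟨k₁ hpr, k₂ hpr⟩
  have memA : ∀ i, A i ∈ l := fun i => (hl.mem _).2 (Or.inl ⟨i, rfl⟩)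
  have memS : ∀ {x i j}, x ∈ S i j → x ∈ l := fun {x i j} hx => (hl.mem _).2 (Or.inr ⟨i, j, hx⟩)
  have hA : ∀ i, A (!i) ≠ A i := by
    have := h.A_ne
    rintro (_ | _) <;> simp [this, this.symm]
  by_cases hi : i = i'
  · subst hi
    have hj : j' = !j := by cases j <;> cases j' <;> simp_all
    subst hj
    have aux : ∀ y, R (A i) y → y ∈ S i j ∨ y ∈ S i (!j) := by
      intro y hy
      obtain ⟨k, hk⟩ := h.adj_A hy
      cases j <;> cases k <;> simp [hk]
    have := hch.mem_iff_mem (X := {A i}) (fun x y hxy => by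
      simp only [Set.mem_singleton_iff]
      constructor
      · rintro rfl
        have := aux y hxy.1.1
        tauto
      · rintro rfl
        have := aux x (h.symm _ _ hxy.1.1)
        tauto) (memA i) (memA (!i))
    simp only [Set.mem_singleton_iff, true_iff] at this
    exact hA i this
  · have hi' : i' = !i := by cases i <;> cases i' <;> simp_all
    subst hi'
    by_cases hj : j = j'
    · subst hj
      have aux : ∀ x y, R x y → ¬ (y = A i ∧ x ∈ S i j) → ¬ (y = A (!i) ∧ x ∈ S (!i) j) →
          x ∈ S i j ∪ S (!i) j → y ∈ S i j ∪ S (!i) j := by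
        rintro x y hxy n₁ n₂ (hx | hx)
        · rcases h.adj_S hxy hx with h | rfl | ⟨rfl, rfl⟩ | ⟨rfl, rfl⟩
          · exact Or.inl h
          · exact (n₁ ⟨rfl, hx⟩).elim
          · exact Or.inr (h.B_mem _ _)
          · exact Or.inr (h.C_mem _ _)
        · rcases h.adj_S hxy hx with h | rfl | ⟨rfl, rfl⟩ | ⟨rfl, rfl⟩
          · exact Or.inr h
          · exact (n₂ ⟨rfl, hx⟩).elim
          · exact Or.inl (by simpa using h.B_mem i j)
          · exact Or.inl (by simpa using h.C_mem i j)
      have := (hch.mem_iff_mem (X := S i j ∪ S (!i) j) (fun x y hxy =>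
        ⟨aux x y hxy.1.1 hxy.1.2.2 hxy.2.2.2,
          aux y x (h.symm _ _ hxy.1.1) hxy.1.2.1 hxy.2.2.1⟩) (memS (h.B_mem i j)) (memA i)).1
          (Or.inl (h.B_mem i j))
      rcases this with h' | h' <;> exact h.notMem _ _ _ h'
    · have hj' : j' = !j := by cases j <;> cases j' <;> simp_all
      subst hj'
      have aux : ∀ x y, R x y → ¬ (y = A i ∧ x ∈ S i j) → ¬ (x = A (!i) ∧ y ∈ S (!i) (!j)) →
          x ∈ S i j ∪ insert (A (!i)) (S (!i) j) → y ∈ S i j ∪ insert (A (!i)) (S (!i) j) := by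
        rintro x y hxy n₁ n₂ (hx | rfl | hx)
        · rcases h.adj_S hxy hx with h | rfl | ⟨rfl, rfl⟩ | ⟨rfl, rfl⟩
          · exact Or.inl h
          · exact (n₁ ⟨rfl, hx⟩).elim
          · exact Or.inr (Or.inr (h.B_mem _ _))
          · exact Or.inr (Or.inr (h.C_mem _ _))
        · obtain ⟨k, hk⟩ := h.adj_A hxy
          by_cases hkj : k = j
          · exact Or.inr (Or.inr (hkj ▸ hk))
          · have : k = !j := by cases j <;> cases k <;> simp_all
            exact (n₂ ⟨rfl, this ▸ hk⟩).elim
        · rcases h.adj_S hxy hx with h | rfl | ⟨rfl, rfl⟩ | ⟨rfl, rfl⟩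
          · exact Or.inr (Or.inr h)
          · exact Or.inr (Or.inl rfl)
          · exact Or.inl (by simpa using h.B_mem i j)
          · exact Or.inl (by simpa using h.C_mem i j)
      have := (hch.mem_iff_mem (X := S i j ∪ insert (A (!i)) (S (!i) j)) (fun x y hxy =>
        ⟨aux x y hxy.1.1 hxy.1.2.2 hxy.2.2.1,
          aux y x (h.symm _ _ hxy.1.1) hxy.1.2.1 hxy.2.2.2⟩) (memS (h.B_mem i j)) (memA i)).1
          (Or.inl (h.B_mem i j))
      rcases this with h' | h' | h'
      · exact h.notMem _ _ _ h'
      · exact hA i h'.symm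
      · exact h.notMem _ _ _ h'

theorem not_spanPath (h : Assembly R S A B C) (l : List α) : ¬ SpanPath R (carrier S A) l := by
  intro hl
  have hlne : l ≠ [] := by
    rintro rfl
    exact absurd ((hl.mem (A true)).2 (Or.inl ⟨_, rfl⟩)) (by simp)
  obtain ⟨s, hs⟩ : ∃ s, l.head? = some s := by cases l <;> simp_all
  obtain ⟨t, ht⟩ : ∃ t, l.getLast? = some t := ⟨_, List.getLast?_eq_some_getLast hlne⟩
  have key : ∀ i j i' j', ¬ (i = i' ∧ j = j') → s ∉ S i j → t ∉ S i j → s ∉ S i' j' →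
      t ∉ S i' j' → False := fun i j i' j' hne h₁ h₂ h₃ h₄ =>
    h.not_both_free hl hne (by simpa [hs] using h₁) (by simpa [ht] using h₂)
      (by simpa [hs] using h₃) (by simpa [ht] using h₄)
  have k1 := key true true true false (by simp)
  have k2 := key true true false true (by simp)
  have k3 := key true true false false (by simp)
  have k4 := key true false false true (by simp)
  have k5 := key true false false false (by simp)
  have k6 := key false true false false (by simp)
  have d : ∀ x i j i' j', ¬ (i = i' ∧ j = j') → x ∈ S i j → x ∉ S i' j' :=
    fun x i j i' j' hne h₁ h₂ => hne (h.disj h₁ h₂)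
  have d1 := d s
  have d2 := d t
  simp only [Bool.forall_bool] at d1 d2
  simp at d1 d2
  clear key d h hl hs ht
  grind +splitImp

/-- There is a path of `R` from `s` to `t` through exactly the elements of `S`. -/
def _root_.HasTrail {α : Type*} (R : α → α → Prop) (S : Set α) (s t : α) : Prop :=
  ∃ l, SpanPath R S l ∧ FromTo l s t

theorem _root_.HasTrail.append {α : Type*} {R : α → α → Prop} {S S' : Set α} {s t u v : α}
    (h : HasTrail R S s t) (h' : HasTrail R S' u v) (hr : R t u) (hd : ∀ x ∈ S, x ∉ S') :
    HasTrail R (S ∪ S') s v := by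
  obtain ⟨l, hl, hf⟩ := h
  obtain ⟨l', hl', hf'⟩ := h'
  refine ⟨l ++ l', ⟨hf.isChain_append hf' hl.chain hl'.chain hr, ?_, fun x => ?_⟩, hf.append hf'⟩
  · refine List.nodup_append.2 ⟨hl.nodup, hl'.nodup, ?_⟩
    rintro x hx y hy rfl
    exact hd x ((hl.mem x).1 hx) ((hl'.mem x).1 hy)
  · rw [List.mem_append, hl.mem, hl'.mem, Set.mem_union]

theorem _root_.HasTrail.singleton {α : Type*} (R : α → α → Prop) (s : α) :
    HasTrail R {s} s s :=
  ⟨[s], ⟨by simp, by simp, by simp⟩, fromTo_singleton s⟩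

theorem reverse (h : Assembly R S A B C) {T : Set α} {s t : α} (ht : HasTrail R T s t) :
    HasTrail R T t s := by
  obtain ⟨l, hl, hf⟩ := ht
  exact ⟨l.reverse, hl.reverse h.symm, hf.reverse⟩

theorem trail_del_A (h : Assembly R S A B C) (i j : Bool) :
    HasTrail R (S i j) (B i j) (C i j) := by
  obtain ⟨l, hl, hf⟩ := h.exists_del i j (A i) (Set.mem_insert _ _)
  have hS : insert (A i) (S i j) \ {A i} = S i j := by
    have := h.notMem i i j
    ext x
    simp only [Set.mem_sdiff, Set.mem_insert_iff, Set.mem_singleton_iff]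
    constructor
    · tauto
    · intro hx
      exact ⟨Or.inr hx, fun e => this (e ▸ hx)⟩
  rw [hS] at hl
  have hA : A i ∉ l := fun hA => h.notMem i i j ((hl.mem _).1 hA)
  rcases hf with hf | hf | hf
  · exact ⟨l, hl, hf⟩
  · exact (hA hf.mem_left).elim
  · exact (hA hf.mem_left).elim

theorem trail_del_B (h : Assembly R S A B C) (i j : Bool) :
    ∃ u, R (A i) u ∧ HasTrail R (S i j \ {B i j}) u (C i j) := by
  obtain ⟨l, hl, hf⟩ := h.exists_del i j (B i j) (Set.mem_insert_of_mem _ (h.B_mem i j))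
  have hB : B i j ∉ l := fun hB => ((hl.mem _).1 hB).2 rfl
  have hf : FromTo l (A i) (C i j) := by
    rcases hf with hf | hf | hf
    · exact (hB hf.mem_left).elim
    · exact (hB hf.mem_right).elim
    · exact hf
  obtain _ | ⟨a, l⟩ := l
  · simp [FromTo] at hf
  obtain rfl : a = A i := by simpa using hf.1
  obtain _ | ⟨u, l⟩ := l
  · have : A i = C i j := by simpa [FromTo] using hf
    exact (h.notMem i i j (this ▸ h.C_mem i j)).elim
  refine ⟨u, hl.chain.rel, u :: l, ⟨hl.chain.of_cons, hl.nodup.of_cons, fun x => ?_⟩, ?_⟩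
  · have h1 := hl.mem x
    have h2 := hl.nodup.notMem
    have h3 := h.notMem i i j
    simp only [List.mem_cons, Set.mem_sdiff, Set.mem_insert_iff, Set.mem_singleton_iff] at h1 h2 ⊢
    grind
  · simpa [FromTo, List.getLast?_cons_cons] using hf

theorem mem_carrier (i j : Bool) (x : α) : x ∈ carrier S A ↔
    x = A i ∨ x = A (!i) ∨ x ∈ S i j ∨ x ∈ S i (!j) ∨ x ∈ S (!i) j ∨ x ∈ S (!i) (!j) := by
  cases i <;> cases j <;> simp [carrier] <;> tauto

theorem not_mem_of_ne (h : Assembly R S A B C) (i j i' j' : Bool) (hne : ¬ (i = i' ∧ j = j'))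
    (x : α) : x ∈ S i j → x ∉ S i' j' :=
  fun h₁ h₂ => hne (h.disj h₁ h₂)

theorem hasTrail_of_BC (h : Assembly R S A B C) {i j : Bool} {v : α}
    (hv : v ∈ insert (A i) (S i j))
    (ht : HasTrail R (insert (A i) (S i j) \ {v}) (B i j) (C i j)) :
    ∃ l, SpanPath R (carrier S A \ {v}) l := by
  obtain ⟨u₃, hu₃, t₃⟩ := h.trail_del_B (!i) j
  obtain ⟨u₄, hu₄, t₄⟩ := h.trail_del_B (!i) (!j)
  have t₂ := h.reverse (h.trail_del_A i (!j))
  have a₁ := h.adj_B i j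
  have a₂ := h.adj_C i j
  have a₃ := h.adj_C i (!j)
  have a₄ := h.adj_B i (!j)
  have b₃ := h.B_mem (!i) j
  have b₄ := h.B_mem (!i) (!j)
  have n₁ := fun x => h.not_mem_of_ne i j i (!j) (by simp) x
  have n₂ := fun x => h.not_mem_of_ne i j (!i) j (by simp) x
  have n₃ := fun x => h.not_mem_of_ne i j (!i) (!j) (by simp) x
  have n₄ := fun x => h.not_mem_of_ne i (!j) (!i) j (by simp) x
  have n₅ := fun x => h.not_mem_of_ne i (!j) (!i) (!j) (by simp) x
  have n₆ := fun x => h.not_mem_of_ne (!i) j (!i) (!j) (by simp) x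
  have m := h.notMem
  have hA : A i ≠ A (!i) := by
    have := h.A_ne
    cases i <;> simp [this, this.symm]
  refine Exists.elim (((((((HasTrail.singleton R (B (!i) j)).append ht (h.symm _ _ a₁) ?_).append
    (h.reverse t₃) a₂ ?_).append (HasTrail.singleton R (A (!i))) (h.symm _ _ hu₃) ?_).append
    t₄ hu₄ ?_).append t₂ (h.symm _ _ a₃) ?_).append (HasTrail.singleton R (B (!i) (!j))) a₄ ?_) ?fin
  case fin =>
    rintro l ⟨hl, -⟩
    refine ⟨l, hl.chain, hl.nodup, fun x => ?_⟩
    rw [hl.mem, Set.mem_sdiff, mem_carrier i j]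
    simp only [Set.mem_union, Set.mem_sdiff, Set.mem_insert_iff, Set.mem_singleton_iff] at hv ⊢
    grind
  all_goals
    intro x
    simp only [Set.mem_union, Set.mem_sdiff, Set.mem_insert_iff, Set.mem_singleton_iff] at hv ⊢
    grind

theorem hasTrail_of_AB (h : Assembly R S A B C) {i j : Bool} {v : α}
    (hv : v ∈ insert (A i) (S i j))
    (ht : HasTrail R (insert (A i) (S i j) \ {v}) (A i) (B i j)) :
    ∃ l, SpanPath R (carrier S A \ {v}) l := by
  obtain ⟨l₃, s₃, hl₃, hf₃⟩ := h.exists_span_B (!i) j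
  have t₃ : HasTrail R _ _ _ := ⟨l₃, hl₃, hf₃⟩
  obtain ⟨u₂, hu₂, t₂⟩ := h.swap.trail_del_B i (!j)
  have t₄ := h.trail_del_A (!i) (!j)
  have a₁ := h.adj_B i j
  have a₃ := h.adj_C i (!j)
  have a₄ := h.adj_B i (!j)
  have c₂ := h.C_mem i (!j)
  have n₁ := fun x => h.not_mem_of_ne i j i (!j) (by simp) x
  have n₂ := fun x => h.not_mem_of_ne i j (!i) j (by simp) x
  have n₃ := fun x => h.not_mem_of_ne i j (!i) (!j) (by simp) x
  have n₄ := fun x => h.not_mem_of_ne i (!j) (!i) j (by simp) x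
  have n₅ := fun x => h.not_mem_of_ne i (!j) (!i) (!j) (by simp) x
  have n₆ := fun x => h.not_mem_of_ne (!i) j (!i) (!j) (by simp) x
  have m := h.notMem
  have hA : A i ≠ A (!i) := by
    have := h.A_ne
    cases i <;> simp [this, this.symm]
  refine Exists.elim (((((h.reverse t₃).append (h.reverse ht) (h.symm _ _ a₁) ?_).append
    t₂ hu₂ ?_).append t₄ a₄ ?_).append (HasTrail.singleton R (C i (!j))) (h.symm _ _ a₃) ?_) ?fin
  case fin =>
    rintro l ⟨hl, -⟩
    refine ⟨l, hl.chain, hl.nodup, fun x => ?_⟩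
    rw [hl.mem, Set.mem_sdiff, mem_carrier i j]
    simp only [Set.mem_union, Set.mem_sdiff, Set.mem_insert_iff, Set.mem_singleton_iff] at hv ⊢
    grind
  all_goals
    intro x
    simp only [Set.mem_union, Set.mem_sdiff, Set.mem_insert_iff, Set.mem_singleton_iff] at hv ⊢
    grind

theorem exists_spanPath_del (h : Assembly R S A B C) {v : α} (hv : v ∈ carrier S A) :
    ∃ l, SpanPath R (carrier S A \ {v}) l := by
  obtain ⟨i, j, hv⟩ : ∃ i j, v ∈ insert (A i) (S i j) := by
    rcases hv with ⟨i, rfl⟩ | ⟨i, j, hv⟩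
    · exact ⟨i, true, Set.mem_insert _ _⟩
    · exact ⟨i, j, Set.mem_insert_of_mem _ hv⟩
  obtain ⟨l, hl, hf | hf | hf⟩ := h.exists_del i j v hv
  · exact h.hasTrail_of_BC hv ⟨l, hl, hf⟩
  · exact h.hasTrail_of_AB hv ⟨l, hl, hf⟩
  · exact h.swap.hasTrail_of_AB hv ⟨l, hl, hf⟩

end Assembly

/-! ### Bit masks and an exhaustive path search

The functions below are written with the primitive operations of `Nat` and evaluate their
arguments early, so that the kernel can run them. -/

namespace PathSearch

/-- `f n`, with `n` evaluated first. -/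
def eager (n : ℕ) (f : ℕ → Bool) : Bool := Nat.rec (f 0) (fun k _ => f (Nat.succ k)) n

theorem eager_eq (n : ℕ) (f : ℕ → Bool) : eager n f = f n := by cases n <;> rfl

theorem beq_iff {m n : ℕ} : Nat.beq m n = true ↔ m = n := by
  rw [← Nat.beq_eq]

/-- The `i`-th bit of `m`. -/
def bit (m i : ℕ) : Bool := Nat.beq (Nat.land (Nat.shiftRight m i) 1) 1

theorem bit_eq (m i : ℕ) : bit m i = m.testBit i := by
  rw [Bool.eq_iff_iff, bit, beq_iff]
  change (m >>> i) &&& 1 = 1 ↔ _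
  rw [Nat.testBit, Nat.and_one_is_mod, Nat.one_and_eq_mod_two]
  simp

/-- `m` has at least two bits. -/
def twoBits (m : ℕ) : Bool := Nat.blt 0 (Nat.land m (Nat.pred m))

theorem twoBits_eq_true {m i j : ℕ} (hi : m.testBit i) (hj : m.testBit j) (hij : i ≠ j) :
    twoBits m = true := by
  rw [twoBits, Nat.blt_eq]
  change 0 < m &&& (m - 1)
  rw [Nat.pos_iff_ne_zero]
  intro h0
  have hm : m ≠ 0 := by rintro rfl; simp at hi
  obtain ⟨k, rfl⟩ := (Nat.and_sub_one_eq_zero_iff_isPowerOfTwo hm).1 h0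
  rw [Nat.testBit_two_pow] at hi hj
  simp_all

theorem twoBits_two_pow (q : ℕ) : twoBits (2 ^ q) = false := by
  rw [Bool.eq_false_iff, ne_eq, twoBits, Nat.blt_eq]
  change ¬ 0 < 2 ^ q &&& (2 ^ q - 1)
  have := (Nat.and_sub_one_eq_zero_iff_isPowerOfTwo (n := 2 ^ q) (by positivity)).2 ⟨q, rfl⟩
  omega

theorem eq_two_pow {m i : ℕ} (hm : ∀ j, m.testBit j ↔ j = i) : m = 2 ^ i :=
  Nat.eq_of_testBit_eq fun j => by
    rw [Bool.eq_iff_iff, hm, Nat.testBit_two_pow]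
    simp [eq_comm]

/-- The elements of the mask `c` with fewer than two neighbours in the mask `un`, for the
graph with `D × D` adjacency matrix `M`; at most `f` elements are examined. -/
def deadEnds (M D un : ℕ) : ℕ → ℕ → ℕ
  | 0, _ => 0
  | f + 1, c => bif Nat.beq c 0 then 0 else
      (fun b => bif twoBits (Nat.land (Nat.shiftRight M (Nat.mul D b)) un) then
          deadEnds M D un f (Nat.xor c (Nat.shiftLeft 1 b))
        else Nat.lor (Nat.shiftLeft 1 b) (deadEnds M D un f (Nat.xor c (Nat.shiftLeft 1 b))))
      (Nat.log2 c)

/-- Whether `p` holds at some element of the mask `c` (true if `c` has more than `f` elements). -/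
def anyBit (p : ℕ → Bool) : ℕ → ℕ → Bool
  | 0, c => Nat.blt 0 c
  | f + 1, c => bif Nat.beq c 0 then false else
      or (eager (Nat.log2 c) p) (eager (Nat.xor c (Nat.shiftLeft 1 (Nat.log2 c))) (anyBit p f))

/-- The possible next vertices: candidates `c`, with dead ends `d`. -/
def nextVertices (c d : ℕ) : ℕ := bif Nat.beq d 0 then c else bif twoBits d then 0 else d

/-- Depth-first search for a path from `cur` through all elements of the mask `un` except the one
of `zb`, that ends in the mask `fin`. -/
def search (M D zb fin : ℕ) : ℕ → ℕ → ℕ → Bool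
  | 0, _, _ => true
  | f + 1, cur, un =>
    bif Nat.beq un zb then bit fin cur
    else eager (Nat.land (Nat.shiftRight M (Nat.mul D cur)) (Nat.xor un zb)) fun c =>
      eager (nextVertices c (deadEnds M D un 6 c)) fun c' =>
        anyBit (fun q => eager (Nat.xor un (Nat.shiftLeft 1 q)) fun un' =>
          search M D zb fin f q un') 6 c'

theorem testBit_shiftLeft_one (b j : ℕ) : (Nat.shiftLeft 1 b).testBit j = decide (b = j) := by
  change (1 <<< b).testBit j = _
  rw [Nat.one_shiftLeft, Nat.testBit_two_pow]

theorem testBit_deadEnds {M D un : ℕ} (f c : ℕ) {w : ℕ} (hw : (deadEnds M D un f c).testBit w) :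
    c.testBit w ∧ twoBits ((M >>> (D * w)) &&& un) = false := by
  induction f generalizing c with
  | zero => simp [deadEnds] at hw
  | succ f ih =>
    rw [deadEnds] at hw
    by_cases hc : c = 0
    · subst hc
      simp at hw
    have h0 : Nat.beq c 0 = false := by rw [Bool.eq_false_iff, ne_eq, beq_iff]; exact hc
    rw [h0, cond_false] at hw
    have hlog := Nat.testBit_log2 hc
    have hx : ∀ w, (Nat.xor c (Nat.shiftLeft 1 c.log2)).testBit w → c.testBit w := by
      intro w hw
      change (c ^^^ Nat.shiftLeft 1 c.log2).testBit w at hw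
      rw [Nat.testBit_xor, testBit_shiftLeft_one] at hw
      by_cases e : c.log2 = w
      · exact e ▸ hlog
      · simpa [e] using hw
    dsimp only at hw
    cases ht : twoBits (Nat.land (Nat.shiftRight M (Nat.mul D c.log2)) un) with
    | true =>
      rw [ht, cond_true] at hw
      have := ih _ hw
      exact ⟨hx w this.1, this.2⟩
    | false =>
      rw [ht, cond_false] at hw
      change (Nat.shiftLeft 1 c.log2 ||| deadEnds M D un f _).testBit w = true at hw
      rw [Nat.testBit_or, testBit_shiftLeft_one, Bool.or_eq_true, decide_eq_true_eq] at hw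
      rcases hw with rfl | hw
      · exact ⟨hlog, ht⟩
      · have := ih _ hw
        exact ⟨hx w this.1, this.2⟩

theorem anyBit_eq_true {p : ℕ → Bool} (f c : ℕ) {q : ℕ} (hq : c.testBit q) (hp : p q = true) :
    anyBit p f c = true := by
  have hc : c ≠ 0 := by rintro rfl; simp at hq
  induction f generalizing c with
  | zero =>
    rw [anyBit, Nat.blt_eq]
    omega
  | succ f ih =>
    have h0 : Nat.beq c 0 = false := by rw [Bool.eq_false_iff, ne_eq, beq_iff]; exact hc
    rw [anyBit, h0, cond_false, eager_eq, eager_eq, Bool.or_eq_true]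
    by_cases e : c.log2 = q
    · exact Or.inl (e ▸ hp)
    · have : (Nat.xor c (Nat.shiftLeft 1 c.log2)).testBit q = true := by
        change (c ^^^ Nat.shiftLeft 1 c.log2).testBit q = true
        rw [Nat.testBit_xor, testBit_shiftLeft_one]
        simpa [e] using hq
      exact Or.inr (ih _ this (by intro h; rw [h] at this; simp at this))

/-- The search finds every path of the required kind. -/
theorem search_eq_true {M D z fin : ℕ}
    (hsymm : ∀ x < D, ∀ y < D, M.testBit (D * x + y) → M.testBit (D * y + x))
    (hfin : ∀ x, fin.testBit x → M.testBit (D * x + z)) (f cur un : ℕ) (l : List ℕ)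
    (hch : (cur :: l).IsChain fun x y => M.testBit (D * x + y) = true) (hnd : l.Nodup)
    (hmem : ∀ x, x ∈ l ↔ un.testBit x ∧ x ≠ z) (hz : un.testBit z)
    (hlt : ∀ x, un.testBit x → x < D) (hlast : ∀ t ∈ (cur :: l).getLast?, fin.testBit t) :
    search M D (2 ^ z) fin f cur un = true := by
  induction f generalizing cur un l with
  | zero => rfl
  | succ f ih =>
    rw [search]
    cases hun : Nat.beq un (2 ^ z) with
    | true =>
      rw [beq_iff] at hun
      have : l = [] := by
        rw [List.eq_nil_iff_forall_not_mem]
        intro x hx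
        have := (hmem x).1 hx
        rw [hun, Nat.testBit_two_pow] at this
        exact this.2 (of_decide_eq_true this.1).symm
      subst this
      rw [cond_true, bit_eq]
      exact hlast cur (by simp)
    | false =>
      rw [cond_false, eager_eq, eager_eq]
      obtain _ | ⟨q, l⟩ := l
      · exfalso
        rw [Bool.eq_false_iff, ne_eq, beq_iff] at hun
        exact hun (eq_two_pow fun j => ⟨fun hj => by_contra fun hne => by
          simpa using (hmem j).2 ⟨hj, hne⟩, fun e => e ▸ hz⟩)
      set c := Nat.land (Nat.shiftRight M (Nat.mul D cur)) (Nat.xor un (2 ^ z)) with hc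
      have hcw : ∀ w, c.testBit w = true ↔ M.testBit (D * cur + w) ∧ un.testBit w ∧ w ≠ z := by
        intro w
        change ((M >>> (D * cur)) &&& (un ^^^ 2 ^ z)).testBit w = true ↔ _
        rw [Nat.testBit_and, Nat.testBit_shiftRight, Nat.testBit_xor, Nat.testBit_two_pow]
        by_cases e : w = z
        · subst e; simp [hz]
        · have : z ≠ w := fun h => e h.symm
          simp [e, this]
      have hq := (hmem q).1 (by simp)
      have hqc : c.testBit q = true := (hcw q).2 ⟨hch.rel, hq⟩
      have hdead : ∀ w, (deadEnds M D un 6 c).testBit w → w = q := by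
        intro w hw
        by_contra hne
        obtain ⟨hwc, ht⟩ := testBit_deadEnds 6 c hw
        obtain ⟨-, hwu, hwz⟩ := (hcw w).1 hwc
        have hwl : w ∈ l := by
          have := (hmem w).2 ⟨hwu, hwz⟩
          simpa [hne] using this
        obtain ⟨l₁, l₂, rfl⟩ := List.append_of_mem hwl
        obtain ⟨p, u, hp⟩ : ∃ p u, q :: l₁ = p ++ [u] :=
          (List.eq_nil_or_concat (q :: l₁)).elim (by simp) (by simp)
        have hpl : q :: (l₁ ++ w :: l₂) = p ++ u :: w :: l₂ := by
          rw [← List.cons_append, hp]; simp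
        rw [hpl] at hch hnd hmem hlast
        have huw : M.testBit (D * u + w) = true := by
          have : (cur :: p ++ u :: w :: l₂).IsChain fun x y => M.testBit (D * x + y) = true := hch
          exact (List.isChain_append_cons_cons.1 this).2.1
        have hu := (hmem u).1 (by simp)
        refine absurd ht ?_
        rw [Bool.not_eq_false]
        have bitw : ∀ j, M.testBit (D * w + j) → un.testBit j →
            ((M >>> (D * w)) &&& un).testBit j = true := by
          intro j h1 h2
          rw [Nat.testBit_and, Nat.testBit_shiftRight, h1, h2]; rfl
        cases l₂ with
        | nil =>
          refine twoBits_eq_true (bitw u (hsymm _ (hlt u hu.1) _ (hlt w hwu) huw) hu.1) (bitw z ?_ hz) hu.2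
          exact hfin w (hlast w (by simp [List.getLast?_cons]))
        | cons s l₂ =>
          have hs := (hmem s).1 (by simp)
          have hws : M.testBit (D * w + s) = true := by
            have : (cur :: p ++ [u] ++ w :: s :: l₂).IsChain
              fun x y => M.testBit (D * x + y) = true := by simpa using hch
            exact (List.isChain_append_cons_cons.1 this).2.1
          refine twoBits_eq_true (bitw u (hsymm _ (hlt u hu.1) _ (hlt w hwu) huw) hu.1) (bitw s hws hs.1) ?_
          rintro rfl
          simp [List.nodup_append] at hnd
      have hnext : (nextVertices c (deadEnds M D un 6 c)).testBit q = true := by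
        rw [nextVertices]
        cases h0 : Nat.beq (deadEnds M D un 6 c) 0 with
        | true => exact hqc
        | false =>
          rw [cond_false]
          rw [Bool.eq_false_iff, ne_eq, beq_iff] at h0
          have hd : deadEnds M D un 6 c = 2 ^ q := by
            obtain ⟨w, hw⟩ : ∃ w, (deadEnds M D un 6 c).testBit w = true := by
              by_contra hno
              push Not at hno
              exact h0 (Nat.eq_of_testBit_eq fun i => by simpa using hno i)
            obtain rfl := hdead w hw
            exact eq_two_pow fun j => ⟨hdead j, fun e => e ▸ hw⟩
          rw [hd, twoBits_two_pow, cond_false, Nat.testBit_two_pow_self]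
      refine anyBit_eq_true 6 _ hnext ?_
      rw [eager_eq]
      have hun' : ∀ x, (Nat.xor un (Nat.shiftLeft 1 q)).testBit x = true ↔
          un.testBit x ∧ x ≠ q := by
        intro x
        change (un ^^^ Nat.shiftLeft 1 q).testBit x = true ↔ _
        rw [Nat.testBit_xor, testBit_shiftLeft_one]
        by_cases e : x = q
        · subst e; simp [hq.1]
        · have : q ≠ x := fun h => e h.symm
          simp [e, this]
      refine ih q _ l hch.of_cons hnd.of_cons (fun x => ?_) ((hun' z).2 ⟨hz, hq.2.symm⟩)
        (fun x hx => hlt x ((hun' x).1 hx).1) ?_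
      · have h1 := hmem x
        have h2 := hnd.notMem
        rw [hun']
        rw [List.mem_cons] at h1
        grind
      · intro t ht
        exact hlast t (by simpa [List.getLast?_cons_cons] using ht)

/-- Checks that `l` is a path from `cur` through exactly the elements of the mask `un`. -/
def isPath (M D : ℕ) : List ℕ → ℕ → ℕ → Bool
  | [], _, un => Nat.beq un 0
  | x :: l, cur, un => and (bit un x) (and (bit M (Nat.add (Nat.mul D cur) x))
      (eager (Nat.xor un (Nat.shiftLeft 1 x)) (isPath M D l x)))

theorem isPath_sound {M D : ℕ} (l : List ℕ) (cur un : ℕ) (h : isPath M D l cur un = true) :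
    (cur :: l).IsChain (fun x y => M.testBit (D * x + y) = true) ∧ l.Nodup ∧
      ∀ x, x ∈ l ↔ un.testBit x := by
  induction l generalizing cur un with
  | nil =>
    rw [isPath, beq_iff] at h
    subst h
    simp
  | cons y l ih =>
    rw [isPath, eager_eq, Bool.and_eq_true, Bool.and_eq_true, bit_eq, bit_eq] at h
    obtain ⟨h1, h2, h3⟩ := h
    obtain ⟨h4, h5, h6⟩ := ih _ _ h3
    have hun' : ∀ x, (Nat.xor un (Nat.shiftLeft 1 y)).testBit x = true ↔
        un.testBit x ∧ x ≠ y := by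
      intro x
      change (un ^^^ Nat.shiftLeft 1 y).testBit x = true ↔ _
      rw [Nat.testBit_xor, testBit_shiftLeft_one]
      by_cases e : x = y
      · subst e; simp [h1]
      · have : y ≠ x := fun h => e h.symm
        simp [e, this]
    refine ⟨List.isChain_cons_cons.2 ⟨h2, h4⟩, List.nodup_cons.2 ⟨?_, h5⟩, fun x => ?_⟩
    · rw [h6, hun']; simp
    · rw [List.mem_cons, h6, hun']
      by_cases e : x = y
      · subst e; simp [h1]
      · simp [e]

end PathSearch

/-! ### Consecutive elements of a list -/

/-- `x` and `y` are neighbours, in either order, in the list `l`. -/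
def Consec {α : Type*} (l : List α) (x y : α) : Prop :=
  ¬ l.IsChain fun a b => ¬ (a = x ∧ b = y ∨ a = y ∧ b = x)

theorem consec_iff {α : Type*} {l : List α} {x y : α} :
    Consec l x y ↔ ∃ p q, l = p ++ x :: y :: q ∨ l = p ++ y :: x :: q := by
  rw [Consec, List.isChain_iff_forall_rel_of_append_cons_cons]
  push Not
  constructor
  · rintro ⟨a, b, p, q, h, ⟨rfl, rfl⟩ | ⟨rfl, rfl⟩⟩
    · exact ⟨p, q, Or.inl h⟩
    · exact ⟨p, q, Or.inr h⟩
  · rintro ⟨p, q, h | h⟩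
    · exact ⟨x, y, p, q, h, Or.inl ⟨rfl, rfl⟩⟩
    · exact ⟨y, x, p, q, h, Or.inr ⟨rfl, rfl⟩⟩

theorem Consec.symm {α : Type*} {l : List α} {x y : α} (h : Consec l x y) : Consec l y x := by
  rw [consec_iff] at h ⊢
  obtain ⟨p, q, h⟩ := h
  exact ⟨p, q, h.symm⟩

theorem Consec.mem_left {α : Type*} {l : List α} {x y : α} (h : Consec l x y) : x ∈ l := by
  rw [consec_iff] at h
  obtain ⟨p, q, rfl | rfl⟩ := h <;> simp

theorem Consec.mem_right {α : Type*} {l : List α} {x y : α} (h : Consec l x y) : y ∈ l :=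
  h.symm.mem_left

theorem Consec.rel {α : Type*} {R : α → α → Prop} (hR : ∀ x y, R x y → R y x) {l : List α}
    (hl : l.IsChain R) {x y : α} (h : Consec l x y) : R x y := by
  rw [consec_iff] at h
  obtain ⟨p, q, rfl | rfl⟩ := h
  · exact (List.isChain_append_cons_cons.1 hl).2.1
  · exact hR _ _ (List.isChain_append_cons_cons.1 hl).2.1

theorem isChain_of_consec {α : Type*} {R : α → α → Prop} {l : List α}
    (h : ∀ x y, Consec l x y → R x y) : l.IsChain R := by
  rw [List.isChain_iff_forall_rel_of_append_cons_cons]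
  intro x y p q hl
  exact h x y (consec_iff.2 ⟨p, q, Or.inl hl⟩)

theorem consec_append {α : Type*} {p q : List α} {c x y : α} :
    Consec (p ++ c :: q) x y ↔ Consec (p ++ [c]) x y ∨ Consec (c :: q) x y := by
  rw [Consec, List.isChain_split, not_and_or]
  rfl

theorem consec_cons_cons {α : Type*} {q : List α} {a b x y : α} :
    Consec (a :: b :: q) x y ↔ (a = x ∧ b = y ∨ a = y ∧ b = x) ∨ Consec (b :: q) x y := by
  rw [Consec, List.isChain_cons_cons, not_and_or, not_not]
  rfl

@[simp] theorem not_consec_singleton {α : Type*} {a x y : α} : ¬ Consec [a] x y := by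
  simp [Consec]

theorem Consec.map {α β : Type*} (f : α → β) {l : List α} {x y : α} (h : Consec l x y) :
    Consec (l.map f) (f x) (f y) := by
  rw [consec_iff] at h ⊢
  obtain ⟨p, q, rfl | rfl⟩ := h
  · exact ⟨p.map f, q.map f, Or.inl (by simp)⟩
  · exact ⟨p.map f, q.map f, Or.inr (by simp)⟩

theorem Consec.of_map {α β : Type*} {f : α → β} {l : List α} {x y : β} (h : Consec (l.map f) x y) :
    ∃ a b, x = f a ∧ y = f b ∧ Consec l a b := by
  by_contra hno
  refine h ((List.isChain_map f).2 (isChain_of_consec fun a b hab he => hno ?_))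
  rcases he with ⟨rfl, rfl⟩ | ⟨rfl, rfl⟩
  · exact ⟨a, b, rfl, rfl, hab⟩
  · exact ⟨b, a, rfl, rfl, hab.symm⟩

/-- In a list without repetition, the neighbours of an inner element are the obvious ones. -/
theorem Consec.eq_or_eq {α : Type*} {p q : List α} {u g z y : α}
    (hn : (p ++ u :: g :: z :: q).Nodup) (h : Consec (p ++ u :: g :: z :: q) g y) :
    y = u ∨ y = z := by
  have h1 : g ∉ p ++ [u] := by
    intro hg
    have : p ++ u :: g :: z :: q = (p ++ [u]) ++ g :: z :: q := by simp
    rw [this, List.nodup_append] at hn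
    exact hn.2.2 g hg g (by simp) rfl
  have h2 : g ∉ z :: q := by
    have : p ++ u :: g :: z :: q = (p ++ [u]) ++ g :: z :: q := by simp
    rw [this, List.nodup_append] at hn
    exact hn.2.1.notMem
  rw [consec_append, consec_cons_cons, consec_cons_cons] at h
  rcases h with h | (⟨rfl, rfl⟩ | ⟨rfl, -⟩) | (⟨-, rfl⟩ | ⟨rfl, rfl⟩) | h
  · exact (h1 h.mem_left).elim
  · exact (h1 (by simp)).elim
  · exact Or.inl rfl
  · exact Or.inr rfl
  · exact (h2 (by simp)).elim
  · exact (h2 h.mem_left).elim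

/-- Inserting the list `w` between the neighbours `u` and `v` of `l`. -/
theorem exists_splice {α : Type*} {l w : List α} {u v : α} (hl : l.Nodup) (hc : Consec l u v)
    (hw : w.Nodup) (hd : ∀ x ∈ w, x ∉ l) : ∃ l' : List α, l'.Nodup ∧ (∀ x, x ∈ l' ↔ x ∈ l ∨ x ∈ w) ∧
      l'.head? = l.head? ∧ l'.getLast? = l.getLast? ∧
      ∀ x y, Consec l' x y ↔
        (Consec l x y ∧ ¬ (x = u ∧ y = v) ∧ ¬ (x = v ∧ y = u)) ∨ Consec (u :: w ++ [v]) x y := by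
  have key : ∀ (p q w : List α) (u v : α), (p ++ u :: v :: q).Nodup → w.Nodup →
      (∀ x ∈ w, x ∉ p ++ u :: v :: q) → (p ++ u :: (w ++ v :: q)).Nodup ∧
      (∀ x, x ∈ p ++ u :: (w ++ v :: q) ↔ x ∈ p ++ u :: v :: q ∨ x ∈ w) ∧
      (p ++ u :: (w ++ v :: q)).head? = (p ++ u :: v :: q).head? ∧
      (p ++ u :: (w ++ v :: q)).getLast? = (p ++ u :: v :: q).getLast? ∧
      ∀ x y, Consec (p ++ u :: (w ++ v :: q)) x y ↔
        (Consec (p ++ u :: v :: q) x y ∧ ¬ (x = u ∧ y = v) ∧ ¬ (x = v ∧ y = u)) ∨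
          Consec (u :: w ++ [v]) x y := by
    intro p q w u v hn hw hd
    have hperm : (p ++ u :: (w ++ v :: q)).Perm (w ++ (p ++ u :: v :: q)) := by
      have e : p ++ u :: (w ++ v :: q) = (p ++ [u]) ++ (w ++ v :: q) := by simp
      have e' : w ++ (p ++ u :: v :: q) = w ++ ((p ++ [u]) ++ v :: q) := by simp
      rw [e, e', ← List.append_assoc, ← List.append_assoc]
      exact List.perm_append_comm.append_right _
    refine ⟨?_, fun x => ?_, ?_, ?_, fun x y => ?_⟩
    · rw [hperm.nodup_iff, List.nodup_append]
      refine ⟨hw, hn, ?_⟩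
      rintro x hx y hy rfl
      exact hd x hx hy
    · rw [hperm.mem_iff, List.mem_append, or_comm]
    · cases p <;> simp
    · simp [List.getLast?_append, List.getLast?_cons]
    · have h1 : v ∉ p ++ [u] ∧ u ∉ v :: q := by
        have : p ++ u :: v :: q = (p ++ [u]) ++ v :: q := by simp
        rw [this, List.nodup_append] at hn
        exact ⟨fun h => hn.2.2 v h v (by simp) rfl, fun h => hn.2.2 u (by simp) u h rfl⟩
      have e : u :: (w ++ v :: q) = (u :: w) ++ v :: q := rfl
      rw [consec_append, e, consec_append (p := u :: w), consec_append (p := p) (q := v :: q),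
        consec_cons_cons]
      have k1 : Consec (p ++ [u]) x y → ¬ (x = u ∧ y = v) ∧ ¬ (x = v ∧ y = u) := fun h =>
        ⟨fun e => h1.1 (e.2 ▸ h.mem_right), fun e => h1.1 (e.1 ▸ h.mem_left)⟩
      have k2 : Consec (v :: q) x y → ¬ (x = u ∧ y = v) ∧ ¬ (x = v ∧ y = u) := fun h =>
        ⟨fun e => h1.2 (e.1 ▸ h.mem_left), fun e => h1.2 (e.2 ▸ h.mem_right)⟩
      have k3 : (u = x ∧ v = y ∨ u = y ∧ v = x) ↔ (x = u ∧ y = v) ∨ (x = v ∧ y = u) := by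
        rw [eq_comm (a := u), eq_comm (a := v), eq_comm (a := u), eq_comm (a := v)]
        tauto
      rw [k3]
      clear hd hw hn hperm k3 h1 e
      generalize Consec (p ++ [u]) x y = a at *
      generalize Consec (v :: q) x y = b at *
      generalize (x = u ∧ y = v) = c at *
      generalize (x = v ∧ y = u) = d at *
      generalize Consec (u :: w ++ [v]) x y = f at *
      tauto
  rw [consec_iff] at hc
  obtain ⟨p, q, rfl | rfl⟩ := hc
  · exact ⟨_, key p q w u v hl hw hd⟩
  · obtain ⟨h1, h2, h3, h4, h5⟩ := key p q w.reverse v u hl (by simpa using hw) (by simpa using hd)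
    refine ⟨_, h1, fun x => by simpa using h2 x, h3, h4, fun x y => ?_⟩
    have e : ∀ x y, Consec (v :: w.reverse ++ [u]) x y → Consec (u :: w ++ [v]) x y := by
      intro x y h
      have e : v :: w.reverse ++ [u] = (u :: w ++ [v]).reverse := by simp
      rw [e] at h
      rw [consec_iff] at h ⊢
      obtain ⟨p, q, h⟩ := h
      refine ⟨q.reverse, p.reverse, ?_⟩
      rw [← List.reverse_inj] at h
      rw [← List.reverse_inj (xs := (u :: w ++ [v]).reverse)] at h
      simpa [or_comm] using h
    have e' : ∀ x y, Consec (u :: w ++ [v]) x y → Consec (v :: w.reverse ++ [u]) x y := by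
      intro x y h
      have e : u :: w ++ [v] = (v :: w.reverse ++ [u]).reverse := by simp
      rw [e] at h
      rw [consec_iff] at h ⊢
      obtain ⟨p, q, h⟩ := h
      refine ⟨q.reverse, p.reverse, ?_⟩
      rw [← List.reverse_inj] at h
      rw [← List.reverse_inj (xs := (v :: w.reverse ++ [u]).reverse)] at h
      simpa [or_comm] using h
    rw [h5]
    have := e x y
    have := e' x y
    tauto

/-- A condition for a sublist of a list to be a chain. -/
theorem isChain_filter {α : Type*} {R : α → α → Prop} (P : α → Bool) {l : List α}
    (h : ∀ u w v, (u :: (w ++ [v])) <:+: l → P u → P v → (∀ z ∈ w, ¬ P z) → R u v) :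
    (l.filter P).IsChain R := by
  induction l with
  | nil => simp
  | cons x l ih =>
    have ih₂ := ih fun u w v hi => h u w v (hi.trans (List.suffix_cons x l).isInfix)
    by_cases hx : P x
    · rw [List.filter_cons_of_pos hx, List.isChain_cons]
      refine ⟨fun y hy => ?_, ih₂⟩
      obtain ⟨w, q, rfl, hw, hq⟩ := exists_prefix_run {z | ¬ P z} l
      have hw0 : w.filter P = [] := List.filter_eq_nil_iff.2 hw
      rw [List.filter_append, hw0, List.nil_append] at hy
      obtain _ | ⟨v, q⟩ := q
      · simp at hy
      have hv : P v := by simpa using hq v (by simp)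
      rw [List.filter_cons_of_pos hv] at hy
      obtain rfl : v = y := by simpa using hy
      exact h x w v ⟨[], q, by simp⟩ hx hv hw
    · rw [List.filter_cons_of_neg hx]
      exact ih₂

/-! ### Ladders -/

namespace Ladder

variable {adj : ℕ → ℕ → Prop} {m n r : ℕ}

/-- The edges `x y`, in one orientation, of the graph that arises from a graph `adj` on
`{0, …, m + 3}`, in which `m, m + 1, m + 3, m + 2` is a 4-cycle, by replacing this cycle by a ladder
with `n` rungs `{m + 2 c, m + 2 c + 1}`. The first and the last rung take over the other neighbours
of `m, m + 1` and of `m + 2, m + 3`. -/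
def Edge (adj : ℕ → ℕ → Prop) (m n x y : ℕ) : Prop :=
  (x < m ∧ y < m + 2 ∧ adj x y) ∨
  (x < m ∧ m + 2 * n ≤ y + 2 ∧ y < m + 2 * n ∧ adj x (y + 4 - 2 * n)) ∨
  (m ≤ x ∧ y = x + 2 ∧ y < m + 2 * n) ∨
  (m ≤ x ∧ x % 2 = m % 2 ∧ y = x + 1 ∧ y < m + 2 * n)

/-- Adjacency in the graph with a ladder. -/
def Adj (adj : ℕ → ℕ → Prop) (m n x y : ℕ) : Prop := Edge adj m n x y ∨ Edge adj m n y x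

theorem Adj.symm (x y : ℕ) (h : Adj adj m n x y) : Adj adj m n y x := Or.symm h

theorem Adj.lt (hn : 1 ≤ n) (x y : ℕ) (h : Adj adj m n x y) : x < m + 2 * n := by
  rcases h with (h | h | h | h) | (h | h | h | h) <;> omega

theorem Adj.irrefl (hn : 1 ≤ n) (h : ∀ x, ¬ adj x x) (x : ℕ) : ¬ Adj adj m n x x := by
  rintro ((⟨-, -, h1⟩ | h1 | h1 | h1) | (⟨-, -, h1⟩ | h1 | h1 | h1)) <;>
    first | exact h x h1 | omega

/-- Renumbering after the insertion of two rungs behind the rung `r`. -/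
def shift (m r x : ℕ) : ℕ := if x < m + 2 * r + 2 then x else x + 4

theorem shift_injective : Function.Injective (shift m r) := by
  intro x y h
  unfold shift at h
  split_ifs at h <;> omega

/-- The path `l` uses one of the edges of the 4-cycle between the rungs `r` and `r + 1`. -/
def Hits (m : ℕ) (l : List ℕ) (r : ℕ) : Prop :=
  Consec l (m + 2 * r) (m + 2 * r + 2) ∨ Consec l (m + 2 * r + 1) (m + 2 * r + 3) ∨
  Consec l (m + 2 * r) (m + 2 * r + 1) ∨ Consec l (m + 2 * r + 2) (m + 2 * r + 3)

theorem Edge.shift (hr : r + 2 ≤ n) {x y : ℕ} (h : Edge adj m n x y) :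
    Adj adj m (n + 2) (shift m r x) (shift m r y) ∨ (x = m + 2 * r ∧ y = m + 2 * r + 2) ∨
      (x = m + 2 * r + 1 ∧ y = m + 2 * r + 3) := by
  unfold Ladder.shift
  rcases h with ⟨h1, h2, h3⟩ | ⟨h1, h2, h3, h4⟩ | h | h
  · left; left; left
    rw [if_pos (by omega), if_pos (by omega)]
    exact ⟨h1, h2, h3⟩
  · left; left; right; left
    rw [if_pos (by omega), if_neg (by omega)]
    refine ⟨h1, by omega, by omega, ?_⟩
    have : y + 4 + 4 - 2 * (n + 2) = y + 4 - 2 * n := by omega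
    rwa [this]
  · by_cases hc : x < m + 2 * r + 2 ∧ m + 2 * r ≤ x
    · right; omega
    · left; left; right; right; left
      split_ifs <;> omega
  · left; left; right; right; right
    split_ifs <;> omega

theorem Adj.shift (hr : r + 2 ≤ n) {x y : ℕ} (h : Adj adj m n x y) :
    Adj adj m (n + 2) (shift m r x) (shift m r y) ∨ (x = m + 2 * r ∧ y = m + 2 * r + 2) ∨
      (y = m + 2 * r ∧ x = m + 2 * r + 2) ∨ (x = m + 2 * r + 1 ∧ y = m + 2 * r + 3) ∨
      (y = m + 2 * r + 1 ∧ x = m + 2 * r + 3) := by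
  rcases h with h | h
  · have := h.shift hr
    tauto
  · have := h.shift hr
    have := Adj.symm (adj := adj) (m := m) (n := n + 2) (Ladder.shift m r y) (Ladder.shift m r x)
    tauto

theorem consec_shift {l : List ℕ} {x y : ℕ} :
    Consec (l.map (shift m r)) (shift m r x) (shift m r y) ↔ Consec l x y := by
  constructor
  · intro h
    obtain ⟨a, b, ha, hb, h⟩ := h.of_map
    rwa [shift_injective ha, shift_injective hb]
  · exact fun h => h.map _

/-- The list `l'` arises from `k` by inserting `t + 2, …, t + 5` next to `t, t + 1, t + 6, t + 7`. -/
structure IsInsertion (R : ℕ → ℕ → Prop) (t : ℕ) (k l' : List ℕ) : Prop where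
  nodup : l'.Nodup
  mem : ∀ y, y ∈ l' ↔ y ∈ k ∨ (t + 2 ≤ y ∧ y < t + 6)
  head : l'.head? = k.head?
  last : l'.getLast? = k.getLast?
  rel : ∀ x y, Consec l' x y → R x y
  hit_left : Consec l' t (t + 2) ∨ Consec l' (t + 1) (t + 3) ∨ Consec l' (t + 2) (t + 3)
  hit_right : Consec l' (t + 4) (t + 6) ∨ Consec l' (t + 5) (t + 7) ∨ Consec l' (t + 4) (t + 5)
  keep : ∀ x y, Consec k x y → (x < t ∧ y < t) ∨ (t + 8 ≤ x ∧ t + 8 ≤ y) → Consec l' x y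

theorem exists_insertion_of_consec {R : ℕ → ℕ → Prop} {t u v : ℕ} {k w : List ℕ} (kn : k.Nodup)
    (knot : ∀ y, t + 2 ≤ y → y < t + 6 → y ∉ k) (hc : Consec k u v) (hwn : w.Nodup)
    (hw : ∀ y, y ∈ w ↔ t + 2 ≤ y ∧ y < t + 6)
    (hu : t ≤ u ∧ u < t + 8)
    (hk : ∀ x y, Consec k x y → ¬ (x = u ∧ y = v) → ¬ (x = v ∧ y = u) → R x y)
    (hR : ∀ x y, Consec (u :: w ++ [v]) x y → R x y)
    (h₁ : Consec (u :: w ++ [v]) t (t + 2) ∨ Consec (u :: w ++ [v]) (t + 1) (t + 3) ∨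
      Consec (u :: w ++ [v]) (t + 2) (t + 3))
    (h₂ : Consec (u :: w ++ [v]) (t + 4) (t + 6) ∨ Consec (u :: w ++ [v]) (t + 5) (t + 7) ∨
      Consec (u :: w ++ [v]) (t + 4) (t + 5)) : ∃ l', IsInsertion R t k l' := by
  obtain ⟨l', a1, a2, a3, a4, a5⟩ := exists_splice kn hc hwn fun x hx =>
    knot x ((hw x).1 hx).1 ((hw x).1 hx).2
  have mid : ∀ x y, Consec (u :: w ++ [v]) x y → Consec l' x y := fun x y h =>
    (a5 x y).2 (Or.inr h)
  refine ⟨l', a1, fun y => by rw [a2, hw], a3, a4, fun x y h => ?_,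
    h₁.imp (mid _ _) (Or.imp (mid _ _) (mid _ _)), h₂.imp (mid _ _) (Or.imp (mid _ _) (mid _ _)),
    fun x y h hxy => (a5 x y).2 (Or.inl ⟨h, by omega, by omega⟩)⟩
  rcases (a5 x y).1 h with ⟨h, n1, n2⟩ | h
  · exact hk x y h n1 n2
  · exact hR x y h

theorem exists_insertion {R : ℕ → ℕ → Prop} {t : ℕ} {k : List ℕ} (hR : ∀ x y, R x y → R y x)
    (e1 : R t (t + 2)) (e2 : R (t + 1) (t + 3)) (e3 : R (t + 2) (t + 4)) (e4 : R (t + 3) (t + 5))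
    (e5 : R (t + 4) (t + 6)) (e6 : R (t + 5) (t + 7)) (e7 : R (t + 2) (t + 3))
    (e8 : R (t + 4) (t + 5)) (kn : k.Nodup) (knot : ∀ y, t + 2 ≤ y → y < t + 6 → y ∉ k)
    (kadj : ∀ x y, Consec k x y → R x y ∨ (x = t ∧ y = t + 6) ∨
      (y = t ∧ x = t + 6) ∨ (x = t + 1 ∧ y = t + 7) ∨ (y = t + 1 ∧ x = t + 7))
    (hit : Consec k t (t + 6) ∨ Consec k (t + 1) (t + 7) ∨ Consec k t (t + 1) ∨
      Consec k (t + 6) (t + 7)) : ∃ l', IsInsertion R t k l' := by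
  have e1' := hR _ _ e1
  have e2' := hR _ _ e2
  have e3' := hR _ _ e3
  have e4' := hR _ _ e4
  have e5' := hR _ _ e5
  have e6' := hR _ _ e6
  have e7' := hR _ _ e7
  have e8' := hR _ _ e8
  by_cases c1 : Consec k t (t + 6) <;> by_cases c2 : Consec k (t + 1) (t + 7)
  · obtain ⟨l₁, a1, a2, a3, a4, a5⟩ := exists_splice (w := [t + 2, t + 4]) kn c1 (by simp) (by
      simp only [List.mem_cons, List.not_mem_nil, or_false, forall_eq_or_imp, forall_eq]
      exact ⟨knot _ (by omega) (by omega), knot _ (by omega) (by omega)⟩)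
    obtain ⟨l₂, b1, b2, b3, b4, b5⟩ := exists_splice (w := [t + 3, t + 5]) (u := t + 1)
      (v := t + 7) a1 ((a5 _ _).2 (Or.inl ⟨c2, by omega, by omega⟩)) (by simp) (by
      simp only [List.mem_cons, List.not_mem_nil, or_false, forall_eq_or_imp, forall_eq, a2]
      have h3 := knot (t + 3) (by omega) (by omega)
      have h5 := knot (t + 5) (by omega) (by omega)
      constructor <;> simp [h3, h5])
    have mid : ∀ x y, Consec [t, t + 2, t + 4, t + 6] x y → Consec l₂ x y := by
      intro x y h
      refine (b5 _ _).2 (Or.inl ⟨(a5 _ _).2 (Or.inr h), ?_, ?_⟩) <;>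
      · rintro ⟨rfl, rfl⟩
        simp [consec_cons_cons] at h
    refine ⟨l₂, b1, fun y => ?_, b3.trans a3, b4.trans a4, fun x y h => ?_,
      Or.inl (mid _ _ (by simp [consec_cons_cons])), Or.inl (mid _ _ (by simp [consec_cons_cons])),
      fun x y h hxy => (b5 _ _).2 (Or.inl ⟨(a5 _ _).2 (Or.inl ⟨h, by omega, by omega⟩), by omega,
        by omega⟩)⟩
    · rw [b2, a2]
      simp only [List.mem_cons, List.not_mem_nil, or_false, or_assoc]
      refine or_congr Iff.rfl ?_
      omega
    · rcases (b5 _ _).1 h with ⟨h, n1, n2⟩ | h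
      · rcases (a5 _ _).1 h with ⟨h, n3, n4⟩ | h
        · rcases kadj x y h with h | h | h | h | h
          · exact h
          all_goals omega
        · simp only [List.cons_append, List.nil_append, consec_cons_cons, not_consec_singleton,
            or_false] at h
          rcases h with (⟨rfl, rfl⟩ | ⟨rfl, rfl⟩) | (⟨rfl, rfl⟩ | ⟨rfl, rfl⟩) |
            (⟨rfl, rfl⟩ | ⟨rfl, rfl⟩) <;> assumption
      · simp only [List.cons_append, List.nil_append, consec_cons_cons, not_consec_singleton,
          or_false] at h
        rcases h with (⟨rfl, rfl⟩ | ⟨rfl, rfl⟩) | (⟨rfl, rfl⟩ | ⟨rfl, rfl⟩) |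
            (⟨rfl, rfl⟩ | ⟨rfl, rfl⟩) <;> assumption
  · refine exists_insertion_of_consec (w := [t + 2, t + 3, t + 5, t + 4]) kn knot c1 (by simp)
      (fun y => ?_) (by omega) (fun x y h n1 n2 => ?_) (fun x y h => ?_) ?_ ?_
    · simp only [List.mem_cons, List.not_mem_nil, or_false]
      omega
    · rcases kadj x y h with h | h | h | ⟨rfl, rfl⟩ | ⟨rfl, rfl⟩
      · exact h
      · omega
      · omega
      · exact (c2 h).elim
      · exact (c2 h.symm).elim
    · simp only [List.cons_append, List.nil_append, consec_cons_cons, not_consec_singleton,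
        or_false] at h
      rcases h with (⟨rfl, rfl⟩ | ⟨rfl, rfl⟩) | (⟨rfl, rfl⟩ | ⟨rfl, rfl⟩) |
        (⟨rfl, rfl⟩ | ⟨rfl, rfl⟩) | (⟨rfl, rfl⟩ | ⟨rfl, rfl⟩) | (⟨rfl, rfl⟩ | ⟨rfl, rfl⟩) <;>
        assumption
    · simp [consec_cons_cons]
    · simp [consec_cons_cons]
  · refine exists_insertion_of_consec (w := [t + 3, t + 2, t + 4, t + 5]) kn knot c2 (by simp)
      (fun y => ?_) (by omega) (fun x y h n1 n2 => ?_) (fun x y h => ?_) ?_ ?_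
    · simp only [List.mem_cons, List.not_mem_nil, or_false]
      omega
    · rcases kadj x y h with h | ⟨rfl, rfl⟩ | ⟨rfl, rfl⟩ | h | h
      · exact h
      · exact (c1 h).elim
      · exact (c1 h.symm).elim
      · omega
      · omega
    · simp only [List.cons_append, List.nil_append, consec_cons_cons, not_consec_singleton,
        or_false] at h
      rcases h with (⟨rfl, rfl⟩ | ⟨rfl, rfl⟩) | (⟨rfl, rfl⟩ | ⟨rfl, rfl⟩) |
        (⟨rfl, rfl⟩ | ⟨rfl, rfl⟩) | (⟨rfl, rfl⟩ | ⟨rfl, rfl⟩) | (⟨rfl, rfl⟩ | ⟨rfl, rfl⟩) <;>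
        assumption
    · simp [consec_cons_cons]
    · simp [consec_cons_cons]
  · have hk : ∀ x y, Consec k x y → R x y := by
      intro x y h
      rcases kadj x y h with h | ⟨rfl, rfl⟩ | ⟨rfl, rfl⟩ | ⟨rfl, rfl⟩ | ⟨rfl, rfl⟩
      · exact h
      · exact (c1 h).elim
      · exact (c1 h.symm).elim
      · exact (c2 h).elim
      · exact (c2 h.symm).elim
    rcases hit with h | h | h | h
    · exact (c1 h).elim
    · exact (c2 h).elim
    · refine exists_insertion_of_consec (w := [t + 2, t + 4, t + 5, t + 3]) kn knot h (by simp)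
        (fun y => ?_) (by omega) (fun x y h _ _ => hk x y h) (fun x y h => ?_) ?_ ?_
      · simp only [List.mem_cons, List.not_mem_nil, or_false]
        omega
      · simp only [List.cons_append, List.nil_append, consec_cons_cons, not_consec_singleton,
          or_false] at h
        rcases h with (⟨rfl, rfl⟩ | ⟨rfl, rfl⟩) | (⟨rfl, rfl⟩ | ⟨rfl, rfl⟩) |
          (⟨rfl, rfl⟩ | ⟨rfl, rfl⟩) | (⟨rfl, rfl⟩ | ⟨rfl, rfl⟩) | (⟨rfl, rfl⟩ | ⟨rfl, rfl⟩) <;>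
          assumption
      · simp [consec_cons_cons]
      · simp [consec_cons_cons]
    · refine exists_insertion_of_consec (w := [t + 4, t + 2, t + 3, t + 5]) kn knot h (by simp)
        (fun y => ?_) (by omega) (fun x y h _ _ => hk x y h) (fun x y h => ?_) ?_ ?_
      · simp only [List.mem_cons, List.not_mem_nil, or_false]
        omega
      · simp only [List.cons_append, List.nil_append, consec_cons_cons, not_consec_singleton,
          or_false] at h
        rcases h with (⟨rfl, rfl⟩ | ⟨rfl, rfl⟩) | (⟨rfl, rfl⟩ | ⟨rfl, rfl⟩) |
          (⟨rfl, rfl⟩ | ⟨rfl, rfl⟩) | (⟨rfl, rfl⟩ | ⟨rfl, rfl⟩) | (⟨rfl, rfl⟩ | ⟨rfl, rfl⟩) <;>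
          assumption
      · simp [consec_cons_cons]
      · simp [consec_cons_cons]

theorem shift_of_lt {x : ℕ} (h : x < m + 2 * r + 2) : shift m r x = x := if_pos h

theorem shift_of_le {x : ℕ} (h : m + 2 * r + 2 ≤ x) : shift m r x = x + 4 := if_neg (by omega)

/-- Two rungs can be inserted behind the rung `r` into a path that hits the 4-cycle there. -/
theorem exists_insert (hr : r + 2 ≤ n) {l : List ℕ} (hc : l.IsChain (Adj adj m n))
    (hn : l.Nodup) (hh : Hits m l r) :
    ∃ l' : List ℕ, l'.IsChain (Adj adj m (n + 2)) ∧ l'.Nodup ∧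
      (∀ y, y ∈ l' ↔ (∃ x ∈ l, shift m r x = y) ∨ (m + 2 * r + 2 ≤ y ∧ y < m + 2 * r + 6)) ∧
      l'.head? = l.head?.map (shift m r) ∧ l'.getLast? = l.getLast?.map (shift m r) ∧
      Hits m l' r ∧ Hits m l' (r + 2) ∧ (∀ s, s + 2 ≤ r → Hits m l s → Hits m l' s) ∧
      (∀ s, r + 2 ≤ s → Hits m l s → Hits m l' (s + 2)) := by
  have rail : ∀ x, m ≤ x → x + 2 < m + 2 * (n + 2) → Adj adj m (n + 2) x (x + 2) :=
    fun x h1 h2 => Or.inl (Or.inr (Or.inr (Or.inl ⟨h1, rfl, h2⟩)))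
  have rung : ∀ x, m ≤ x → x % 2 = m % 2 → x + 1 < m + 2 * (n + 2) →
      Adj adj m (n + 2) x (x + 1) :=
    fun x h1 h2 h3 => Or.inl (Or.inr (Or.inr (Or.inr ⟨h1, h2, rfl, h3⟩)))
  have kmem : ∀ y, y ∈ l.map (shift m r) ↔ ∃ x ∈ l, shift m r x = y := fun y => by simp
  have knot : ∀ y, m + 2 * r + 2 ≤ y → y < m + 2 * r + 6 → y ∉ l.map (shift m r) := by
    intro y h1 h2 h3
    obtain ⟨x, -, rfl⟩ := (kmem y).1 h3
    by_cases hx : x < m + 2 * r + 2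
    · rw [shift_of_lt hx] at h1; omega
    · rw [shift_of_le (by omega)] at h2; omega
  have kadj : ∀ x y, Consec (l.map (shift m r)) x y → Adj adj m (n + 2) x y ∨
      (x = m + 2 * r ∧ y = m + 2 * r + 6) ∨ (y = m + 2 * r ∧ x = m + 2 * r + 6) ∨
      (x = m + 2 * r + 1 ∧ y = m + 2 * r + 7) ∨ (y = m + 2 * r + 1 ∧ x = m + 2 * r + 7) := by
    intro x y h
    obtain ⟨a, b, rfl, rfl, h'⟩ := h.of_map
    rcases (h'.rel Adj.symm hc).shift hr with h | ⟨rfl, rfl⟩ | ⟨rfl, rfl⟩ | ⟨rfl, rfl⟩ | ⟨rfl, rfl⟩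
    · exact Or.inl h
    · rw [shift_of_lt (by omega), shift_of_le (by omega)]; omega
    · rw [shift_of_le (by omega), shift_of_lt (by omega)]; omega
    · rw [shift_of_lt (by omega), shift_of_le (by omega)]; omega
    · rw [shift_of_le (by omega), shift_of_lt (by omega)]; omega
  have hit : Consec (l.map (shift m r)) (m + 2 * r) (m + 2 * r + 6) ∨
      Consec (l.map (shift m r)) (m + 2 * r + 1) (m + 2 * r + 7) ∨
      Consec (l.map (shift m r)) (m + 2 * r) (m + 2 * r + 1) ∨
      Consec (l.map (shift m r)) (m + 2 * r + 6) (m + 2 * r + 7) := by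
    have tr : ∀ x y x' y', shift m r x = x' → shift m r y = y' → Consec l x y →
        Consec (l.map (shift m r)) x' y' := by
      rintro x y _ _ rfl rfl h
      exact consec_shift.2 h
    exact hh.imp (tr _ _ _ _ (shift_of_lt (by omega)) (shift_of_le (by omega)))
      (Or.imp (tr _ _ _ _ (shift_of_lt (by omega)) (shift_of_le (by omega)))
      (Or.imp (tr _ _ _ _ (shift_of_lt (by omega)) (shift_of_lt (by omega)))
      (tr _ _ _ _ (shift_of_le (by omega)) (shift_of_le (by omega)))))
  obtain ⟨l', h⟩ := exists_insertion (R := Adj adj m (n + 2)) (t := m + 2 * r)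
    (k := l.map (shift m r)) Adj.symm (rail _ (by omega) (by omega)) (rail _ (by omega) (by omega))
    (rail _ (by omega) (by omega)) (rail _ (by omega) (by omega)) (rail _ (by omega) (by omega))
    (rail _ (by omega) (by omega)) (rung _ (by omega) (by omega) (by omega))
    (rung _ (by omega) (by omega) (by omega)) (hn.map shift_injective) knot kadj hit
  refine ⟨l', isChain_of_consec h.rel, h.nodup, fun y => by rw [h.mem, kmem],
    by rw [h.head, List.head?_map], by rw [h.last, List.getLast?_map], ?_, ?_, ?_, ?_⟩
  · rcases h.hit_left with h | h | h
    · exact Or.inl h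
    · exact Or.inr (Or.inl h)
    · exact Or.inr (Or.inr (Or.inr h))
  · rcases h.hit_right with h | h | h
    · exact Or.inl h
    · exact Or.inr (Or.inl h)
    · exact Or.inr (Or.inr (Or.inl h))
  · intro s hs hits
    have tr : ∀ x y, x < m + 2 * r → y < m + 2 * r → Consec l x y → Consec l' x y := by
      intro x y hx hy h'
      have := (consec_shift (m := m) (r := r)).2 h'
      rw [shift_of_lt (by omega), shift_of_lt (by omega)] at this
      exact h.keep _ _ this (Or.inl ⟨hx, hy⟩)
    exact hits.imp (tr _ _ (by omega) (by omega)) (Or.imp (tr _ _ (by omega) (by omega))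
      (Or.imp (tr _ _ (by omega) (by omega)) (tr _ _ (by omega) (by omega))))
  · intro s hs hits
    have tr : ∀ x y x' y', m + 2 * r + 4 ≤ x → m + 2 * r + 4 ≤ y → x + 4 = x' → y + 4 = y' →
        Consec l x y → Consec l' x' y' := by
      rintro x y _ _ hx hy rfl rfl h'
      have := (consec_shift (m := m) (r := r)).2 h'
      rw [shift_of_le (by omega), shift_of_le (by omega)] at this
      exact h.keep _ _ this (Or.inr ⟨by omega, by omega⟩)
    exact hits.imp (tr _ _ _ _ (by omega) (by omega) (by omega) (by omega))
      (Or.imp (tr _ _ _ _ (by omega) (by omega) (by omega) (by omega))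
      (Or.imp (tr _ _ _ _ (by omega) (by omega) (by omega) (by omega))
        (tr _ _ _ _ (by omega) (by omega) (by omega) (by omega))))

end Ladder

/-- An element of a list other than the first and the last has two neighbours. -/
theorem exists_consec_consec {α : Type*} {l : List α} {s t z : α} (hn : l.Nodup)
    (hf : FromTo l s t) (hz : z ∈ l) (hs : z ≠ s) (ht : z ≠ t) :
    ∃ y y', y ≠ y' ∧ Consec l z y ∧ Consec l z y' := by
  obtain ⟨p, q, rfl⟩ := List.append_of_mem hz
  rcases List.eq_nil_or_concat p with rfl | ⟨p, y, rfl⟩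
  · exact absurd hf.1 (by simp [hs])
  cases q with
  | nil => exact absurd hf.2 (by simp [ht])
  | cons y' q =>
    have e : p.concat y ++ z :: y' :: q = p ++ y :: z :: y' :: q := by simp
    rw [e] at hn ⊢
    refine ⟨y, y', ?_, consec_iff.2 ⟨p, y' :: q, Or.inr rfl⟩,
      consec_iff.2 ⟨p ++ [y], q, Or.inl (by simp)⟩⟩
    rintro rfl
    simp [List.nodup_append] at hn

namespace Ladder

variable {adj : ℕ → ℕ → Prop} {m n : ℕ}

theorem Adj.inner (hn : 2 ≤ n) {g y : ℕ} (h : Adj adj m (n + 2) g y) (h1 : m + 2 ≤ g)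
    (h2 : g < m + 6) :
    (g = m + 2 ∧ (y = m ∨ y = m + 3 ∨ y = m + 4)) ∨
    (g = m + 3 ∧ (y = m + 1 ∨ y = m + 2 ∨ y = m + 5)) ∨
    (g = m + 4 ∧ (y = m + 2 ∨ y = m + 5 ∨ y = m + 6)) ∨
    (g = m + 5 ∧ (y = m + 3 ∨ y = m + 4 ∨ y = m + 7)) := by
  rcases h with (h | h | h | h) | (h | h | h | h) <;> omega

theorem Adj.inner_inner (hn : 2 ≤ n) {g y : ℕ} (h : Adj adj m (n + 2) g y)
    (hg : m + 2 ≤ g ∧ g < m + 6) : g + y ≠ 2 * m + 7 := by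
  rcases h.inner hn hg.1 hg.2 with h | h | h | h <;> omega

theorem Adj.inner_outer (hn : 2 ≤ n) {g y : ℕ} (h : Adj adj m (n + 2) g y)
    (hg : m + 2 ≤ g ∧ g < m + 6) (hy : y < m + 2 ∨ m + 6 ≤ y) :
    (g = m + 2 ∧ y = m) ∨ (g = m + 3 ∧ y = m + 1) ∨ (g = m + 4 ∧ y = m + 6) ∨
      (g = m + 5 ∧ y = m + 7) := by
  rcases h.inner hn hg.1 hg.2 with h | h | h | h <;> omega

theorem outer_ends_of_four {a b c d : ℕ} (ha : m + 2 ≤ a ∧ a < m + 6) (hb : m + 2 ≤ b ∧ b < m + 6)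
    (hc : m + 2 ≤ c ∧ c < m + 6) (hd : m + 2 ≤ d ∧ d < m + 6) (hab : a + b ≠ 2 * m + 7)
    (hbc : b + c ≠ 2 * m + 7) (h : a ≠ b ∧ a ≠ c ∧ b ≠ c) :
    2 * m + 7 - b ≠ a ∧ 2 * m + 7 - b ≠ b ∧ 2 * m + 7 - b ≠ c ∧
      (d = a ∨ d = b ∨ d = c ∨ d + b = 2 * m + 7) ∧
      (d ≠ a → d ≠ b → d ≠ c → a + d ≠ 2 * m + 7) := by
  have key : ∀ i j k l : Fin 4, i.1 + j.1 ≠ 3 ∧ j.1 + k.1 ≠ 3 ∧ i.1 ≠ j.1 ∧ i.1 ≠ k.1 ∧ j.1 ≠ k.1 →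
      (l.1 = i.1 ∨ l.1 = j.1 ∨ l.1 = k.1 ∨ l.1 + j.1 = 3) ∧
      (l.1 ≠ i.1 ∧ l.1 ≠ j.1 ∧ l.1 ≠ k.1 → i.1 + l.1 ≠ 3) := by decide
  have := key ⟨a - (m + 2), by omega⟩ ⟨b - (m + 2), by omega⟩ ⟨c - (m + 2), by omega⟩
    ⟨d - (m + 2), by omega⟩ (by dsimp only; omega)
  dsimp only at this
  omega

/-- Renumbering after the deletion of the rungs `1` and `2`. -/
def unshift (m x : ℕ) : ℕ := if x < m + 2 then x else x - 4

theorem unshift_of_lt {x : ℕ} (h : x < m + 2) : unshift m x = x := if_pos h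

theorem unshift_of_le {x : ℕ} (h : m + 2 ≤ x) : unshift m x = x - 4 := if_neg (by omega)

theorem Edge.unshift (hn : 2 ≤ n) {x y : ℕ} (hx : x < m + 2 ∨ m + 6 ≤ x)
    (hy : y < m + 2 ∨ m + 6 ≤ y) (h : Edge adj m (n + 2) x y) :
    Edge adj m n (unshift m x) (unshift m y) := by
  rcases h with ⟨h1, h2, h3⟩ | ⟨h1, h2, h3, h4⟩ | h | h
  · left
    rw [unshift_of_lt (by omega), unshift_of_lt (by omega)]
    exact ⟨h1, h2, h3⟩
  · right; left
    rw [unshift_of_lt (by omega), unshift_of_le (by omega)]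
    refine ⟨h1, by omega, by omega, ?_⟩
    have : y - 4 + 4 - 2 * n = y + 4 - 2 * (n + 2) := by omega
    rwa [this]
  · right; right; left
    rcases hx with hx | hx
    · omega
    · rw [unshift_of_le (by omega), unshift_of_le (by omega)]; omega
  · right; right; right
    rcases hx with hx | hx
    · rw [unshift_of_lt (by omega), unshift_of_lt (by omega)]; omega
    · rw [unshift_of_le (by omega), unshift_of_le (by omega)]; omega

theorem adj_unshift_of_cycle (hn : 2 ≤ n) {u v : ℕ}
    (h : (u = m ∧ v = m + 1) ∨ (u = m ∧ v = m + 6) ∨ (u = m + 1 ∧ v = m + 7) ∨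
      (u = m + 6 ∧ v = m + 7)) : Edge adj m n (unshift m u) (unshift m v) := by
  rcases h with ⟨rfl, rfl⟩ | ⟨rfl, rfl⟩ | ⟨rfl, rfl⟩ | ⟨rfl, rfl⟩
  · rw [unshift_of_lt (by omega), unshift_of_lt (by omega)]
    right; right; right; omega
  · rw [unshift_of_lt (by omega), unshift_of_le (by omega)]
    right; right; left; omega
  · rw [unshift_of_lt (by omega), unshift_of_le (by omega)]
    right; right; left; omega
  · rw [unshift_of_le (by omega), unshift_of_le (by omega)]
    right; right; right; omega

theorem adj_unshift_of_inner (hn : 2 ≤ n) {u v a d : ℕ} (hu : u < m + 2 ∨ m + 6 ≤ u)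
    (hv : v < m + 2 ∨ m + 6 ≤ v) (ha : m + 2 ≤ a ∧ a < m + 6) (hd : m + 2 ≤ d ∧ d < m + 6)
    (hau : Adj adj m (n + 2) a u) (hdv : Adj adj m (n + 2) d v) (hne : a ≠ d)
    (had : a + d ≠ 2 * m + 7) : Adj adj m n (unshift m u) (unshift m v) := by
  have h1 := hau.inner_outer hn ha hu
  have h2 := hdv.inner_outer hn hd hv
  rcases h1 with ⟨rfl, rfl⟩ | ⟨rfl, rfl⟩ | ⟨rfl, rfl⟩ | ⟨rfl, rfl⟩ <;>
    rcases h2 with ⟨rfl, rfl⟩ | ⟨rfl, rfl⟩ | ⟨rfl, rfl⟩ | ⟨rfl, rfl⟩ <;>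
    first
    | omega
    | exact Or.inl (adj_unshift_of_cycle hn (by omega))
    | exact Or.inr (adj_unshift_of_cycle hn (by omega))

/-- The rungs `1` and `2` can be deleted from a path that does not end on them. -/
theorem adj_unshift_of_isInfix (hn : 2 ≤ n) {l : List ℕ} {s t : ℕ}
    (hl : SpanPath (Adj adj m (n + 2)) {x | x < m + 2 * (n + 2)} l) (hf : FromTo l s t)
    (hs : s < m + 2) (ht : t < m + 2) {u v : ℕ} {w : List ℕ} (hi : (u :: (w ++ [v])) <:+: l)
    (hu : u < m + 2 ∨ m + 6 ≤ u) (hv : v < m + 2 ∨ m + 6 ≤ v)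
    (hw : ∀ z ∈ w, m + 2 ≤ z ∧ z < m + 6) : Adj adj m n (unshift m u) (unshift m v) := by
  obtain ⟨p, q, rfl⟩ := hi
  have hc : (u :: (w ++ [v])).IsChain (Adj adj m (n + 2)) :=
    hl.chain.left_of_append.right_of_append
  have hnd : (u :: (w ++ [v])).Nodup := hl.nodup.sublist (List.IsInfix.sublist ⟨p, q, rfl⟩)
  match w, hw, hc, hnd with
  | [], _, hc, _ =>
    have h : Adj adj m (n + 2) u v := by simpa using hc
    exact h.imp (Edge.unshift hn hu hv) (Edge.unshift hn hv hu)
  | [a], hw, hc, hnd =>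
    simp only [List.cons_append, List.nil_append, List.isChain_cons_cons] at hc
    simp only [List.cons_append, List.nil_append, List.nodup_cons, List.mem_cons,
      List.not_mem_nil, or_false, not_or] at hnd
    have ha := hw a (by simp)
    have h1 := (Adj.symm _ _ hc.1).inner_outer hn ha hu
    have h2 := hc.2.1.inner_outer hn ha hv
    omega
  | [a, b], hw, hc, hnd =>
    simp only [List.cons_append, List.nil_append, List.isChain_cons_cons] at hc
    simp only [List.cons_append, List.nil_append, List.nodup_cons, List.mem_cons,
      List.not_mem_nil, or_false, not_or] at hnd
    exact adj_unshift_of_inner hn hu hv (hw a (by simp)) (hw b (by simp)) (Adj.symm _ _ hc.1)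
      hc.2.2.1 hnd.2.1.1 (hc.2.1.inner_inner hn (hw a (by simp)))
  | [a, b, c], hw, hc, hnd =>
    exfalso
    simp only [List.cons_append, List.nil_append, List.isChain_cons_cons] at hc
    simp only [List.cons_append, List.nil_append, List.nodup_cons, List.mem_cons,
      List.not_mem_nil, or_false, not_or] at hnd
    have ha := hw a (by simp)
    have hb := hw b (by simp)
    have hd := hw c (by simp)
    have hab := hc.2.1.inner_inner hn ha
    have hbc := hc.2.2.1.inner_inner hn hb
    have out := fun d hd' => outer_ends_of_four (d := d) ha hb hd hd' hab hbc
      ⟨hnd.2.1.1, hnd.2.1.2.1, hnd.2.2.1.1⟩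
    have hz : m + 2 ≤ 2 * m + 7 - b ∧ 2 * m + 7 - b < m + 6 := by omega
    obtain ⟨z1, z2, z3, -, -⟩ := out _ hz
    generalize hzb : 2 * m + 7 - b = z at *
    obtain ⟨y, y', hyy, hy, hy'⟩ := exists_consec_consec hl.nodup hf (z := z)
      ((hl.mem z).2 (show z < m + 2 * (n + 2) by omega)) (by omega) (by omega)
    have inner : ∀ y, Consec (p ++ u :: ([a, b, c] ++ [v]) ++ q) z y → ¬ (m + 2 ≤ y ∧ y < m + 6) := by
      intro y hy hy2
      have hza := hy.rel Adj.symm hl.chain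
      have hzy := hza.inner_inner hn hz
      have e : p ++ u :: ([a, b, c] ++ [v]) ++ q = p ++ u :: a :: b :: (c :: v :: q) := by simp
      have e' : p ++ u :: ([a, b, c] ++ [v]) ++ q = (p ++ [u, a]) ++ b :: c :: v :: q := by simp
      have hnl := hl.nodup
      rcases (out y hy2).2.2.2.1 with rfl | rfl | rfl | h
      · have := hy.symm
        rw [e] at this hnl
        rcases this.eq_or_eq hnl with h | h <;> omega
      · omega
      · have := hy.symm
        rw [e'] at this hnl
        rcases this.eq_or_eq hnl with h | h <;> omega
      · have : y = z := by omega
        subst this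
        rcases hza.inner hn hz.1 hz.2 with h | h | h | h <;> omega
    have o1 := (hy.rel Adj.symm hl.chain).inner_outer hn hz (by have := inner y hy; omega)
    have o2 := (hy'.rel Adj.symm hl.chain).inner_outer hn hz (by have := inner y' hy'; omega)
    omega
  | [a, b, c, d], hw, hc, hnd =>
    simp only [List.cons_append, List.nil_append, List.isChain_cons_cons] at hc
    simp only [List.cons_append, List.nil_append, List.nodup_cons, List.mem_cons,
      List.not_mem_nil, or_false, not_or] at hnd
    have ha := hw a (by simp)
    have hb := hw b (by simp)
    have hd := hw c (by simp)
    have he := hw d (by simp)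
    refine adj_unshift_of_inner hn hu hv ha he (Adj.symm _ _ hc.1) hc.2.2.2.2.1 hnd.2.1.2.2.1 ?_
    exact (outer_ends_of_four ha hb hd he (hc.2.1.inner_inner hn ha) (hc.2.2.1.inner_inner hn hb)
      ⟨hnd.2.1.1, hnd.2.1.2.1, hnd.2.2.1.1⟩).2.2.2.2 (Ne.symm hnd.2.1.2.2.1)
      (Ne.symm hnd.2.2.1.2.1) (Ne.symm hnd.2.2.2.1.1)
  | a :: b :: c :: d :: e :: w, hw, _, hnd =>
    exfalso
    have h1 : (a :: b :: c :: d :: e :: w).Nodup :=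
      hnd.sublist ((List.sublist_append_left _ _).trans (List.sublist_cons_self _ _))
    have h2 : (a :: b :: c :: d :: e :: w).toFinset ⊆ Finset.Ico (m + 2) (m + 6) := fun z hz => by
      simpa using hw z (List.mem_toFinset.1 hz)
    have h3 := Finset.card_le_card h2
    rw [List.toFinset_card_of_nodup h1, Nat.card_Ico] at h3
    simp only [List.length_cons] at h3
    omega

theorem unshift_injOn {x y : ℕ} (hx : x < m + 2 ∨ m + 6 ≤ x) (hy : y < m + 2 ∨ m + 6 ≤ y)
    (h : unshift m x = unshift m y) : x = y := by
  unfold unshift at h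
  split_ifs at h <;> omega

/-- A spanning path between the first terminals survives the deletion of two rungs. -/
theorem exists_remove (hn : 2 ≤ n) {l : List ℕ} {s t : ℕ}
    (hl : SpanPath (Adj adj m (n + 2)) {x | x < m + 2 * (n + 2)} l) (hf : FromTo l s t)
    (hs : s < m + 2) (ht : t < m + 2) :
    ∃ l', SpanPath (Adj adj m n) {x | x < m + 2 * n} l' ∧ FromTo l' s t := by
  set P : ℕ → Bool := fun x => decide (x < m + 2 ∨ m + 6 ≤ x) with hP
  have hPx : ∀ x, P x = true ↔ x < m + 2 ∨ m + 6 ≤ x := fun x => by simp [hP]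
  refine ⟨(l.filter P).map (unshift m), ⟨?_, ?_, ?_⟩, ?_, ?_⟩
  · rw [List.isChain_map]
    refine isChain_filter P fun u w v hi hu hv hw => ?_
    refine adj_unshift_of_isInfix hn hl hf hs ht hi ((hPx _).1 hu) ((hPx _).1 hv) fun z hz => ?_
    have := hw z hz
    rw [hPx] at this
    omega
  · refine List.Nodup.map_on ?_ (hl.nodup.filter _)
    intro x hx y hy h
    simp only [List.mem_filter, hPx] at hx hy
    exact unshift_injOn hx.2 hy.2 h
  · intro x
    simp only [List.mem_map, List.mem_filter, hPx, hl.mem, Set.mem_ofPred_eq]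
    constructor
    · rintro ⟨y, ⟨h1, h2⟩, rfl⟩
      unfold unshift
      split_ifs <;> omega
    · intro hx
      by_cases h : x < m + 2
      · exact ⟨x, ⟨by omega, by omega⟩, unshift_of_lt h⟩
      · exact ⟨x + 4, ⟨by omega, by omega⟩, by rw [unshift_of_le (by omega)]; omega⟩
  · have := hf.1
    cases l with
    | nil => simp at this
    | cons x l =>
      simp only [List.head?_cons, Option.some.injEq] at this
      subst this
      rw [List.filter_cons_of_pos ((hPx _).2 (Or.inl hs))]
      simp [unshift_of_lt hs]
  · have := hf.2
    rcases List.eq_nil_or_concat l with rfl | ⟨l, x, rfl⟩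
    · simp at this
    · simp only [List.concat_eq_append, List.getLast?_append, List.getLast?_singleton,
        Option.some_or, Option.some.injEq] at this
      subst this
      rw [List.concat_eq_append, List.filter_append,
        List.filter_cons_of_pos ((hPx _).2 (Or.inl ht))]
      simp [unshift_of_lt ht]

end Ladder

/-! ### Pieces -/

/-- A graph on `{0, …, N - 1}` with terminals `0`, `b`, `c` and without Hamiltonian paths between
terminals, such that each vertex-deleted subgraph has one, and such that some Hamiltonian paths
begin at `b` and at `c`. -/
structure IsPiece (R : ℕ → ℕ → Prop) (N b c : ℕ) : Prop where
  symm : ∀ x y, R x y → R y x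
  lt : ∀ x y, R x y → x < N
  irrefl : ∀ x, ¬ R x x
  b_pos : 0 < b
  b_lt : b < N
  c_pos : 0 < c
  c_lt : c < N
  not_span : ∀ l s t, SpanPath R {x | x < N} l → FromTo l s t → (s = 0 ∨ s = b ∨ s = c) →
    (t = 0 ∨ t = b ∨ t = c) → False
  exists_del : ∀ v < N, ∃ l, SpanPath R ({x | x < N} \ {v}) l ∧
    (FromTo l b c ∨ FromTo l 0 b ∨ FromTo l 0 c)
  exists_span_b : ∃ l t, SpanPath R {x | x < N} l ∧ FromTo l b t
  exists_span_c : ∃ l t, SpanPath R {x | x < N} l ∧ FromTo l c t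

namespace PathSearch

/-- The graph on `{0, …, N - 1}` given by the bits of a `D × D` matrix. -/
def MatAdj (M D N x y : ℕ) : Prop := x < N ∧ y < N ∧ M.testBit (D * x + y) = true

/-- The matrix `M` is symmetric. -/
def isSymm (M D : ℕ) : Bool :=
  (List.range D).all fun x => (List.range D).all fun y =>
    or (not (bit M (Nat.add (Nat.mul D x) y))) (bit M (Nat.add (Nat.mul D y) x))

theorem isSymm_sound {M D : ℕ} (h : isSymm M D = true) (x : ℕ) (hx : x < D) (y : ℕ) (hy : y < D)
    (hxy : M.testBit (D * x + y)) : M.testBit (D * y + x) := by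
  simp only [isSymm, List.all_eq_true, List.mem_range, bit_eq] at h
  have := h x hx y hy
  change (!M.testBit (D * x + y) || M.testBit (D * y + x)) = true at this
  simpa [hxy] using this

/-- The matrix `M` has zero diagonal. -/
def isLoopless (M D : ℕ) : Bool :=
  (List.range D).all fun x => not (bit M (Nat.add (Nat.mul D x) x))

theorem isLoopless_sound {M D : ℕ} (h : isLoopless M D = true) (x : ℕ) (hx : x < D) :
    ¬ M.testBit (D * x + x) := by
  simp only [isLoopless, List.all_eq_true, List.mem_range, bit_eq] at h
  have := h x hx
  change (!M.testBit (D * x + x)) = true at this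
  simpa using this

/-- No path from `s` to the mask `fin` is found; `M'` is the matrix `M` with an additional
vertex `z` joined to `fin`. -/
def noPath (M M' D z fin s : ℕ) : Bool :=
  and (isSymm M' D) (and (Nat.beq (Nat.land M M') M) (and
    ((List.range z).all fun x => or (not (bit fin x)) (bit M' (Nat.add (Nat.mul D x) z)))
    (eager M' fun m => eager (2 ^ z) fun zb => eager fin fun e =>
      eager (Nat.xor (2 ^ (z + 1) - 1) (2 ^ s)) fun un => not (search m D zb e D s un))))

theorem noPath_sound {M M' D z fin s : ℕ} {R : ℕ → ℕ → Prop} (h : noPath M M' D z fin s = true)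
    (hzD : z < D) (hfz : fin < 2 ^ z) (hR : ∀ x y, R x y → M.testBit (D * x + y) = true)
    {l : List ℕ} {t : ℕ} (hl : SpanPath R {x | x < z} l) (hf : FromTo l s t)
    (ht : fin.testBit t = true) : False := by
  simp only [noPath, eager_eq, Bool.and_eq_true, beq_iff, List.all_eq_true, List.mem_range, bit_eq,
    Bool.not_eq_true'] at h
  obtain ⟨h1, h2, h3, h4⟩ := h
  have hfin : ∀ x, fin.testBit x → M'.testBit (D * x + z) := by
    intro x hx
    have hxz : x < z := by
      by_contra hxz
      rw [Nat.testBit_lt_two_pow (hfz.trans_le (Nat.pow_le_pow_right (by omega) (by omega)))] at hx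
      simp at hx
    have := h3 x hxz
    rw [hx] at this
    simpa using this
  have hs : s < z := (hl.mem s).1 hf.mem_left
  have hMM : ∀ i, M.testBit i = true → M'.testBit i = true := by
    intro i hi
    have e : (M &&& M').testBit i = true := by
      change (Nat.land M M').testBit i = true
      rw [h2, hi]
    rw [Nat.testBit_and] at e
    simp_all
  obtain ⟨l, rfl⟩ : ∃ l', l = s :: l' := by
    have := hf.1
    cases l with
    | nil => simp at this
    | cons x l => exact ⟨l, by simpa using this⟩
  have hun : ∀ x, (Nat.xor (2 ^ (z + 1) - 1) (2 ^ s)).testBit x = true ↔ x < z + 1 ∧ x ≠ s := by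
    intro x
    change ((2 ^ (z + 1) - 1) ^^^ (2 ^ s)).testBit x = true ↔ _
    rw [Nat.testBit_xor, Nat.testBit_two_pow_sub_one, Nat.testBit_two_pow]
    by_cases e : x = s
    · subst e; simp; omega
    · have : s ≠ x := fun h => e h.symm
      simp [e, this]
  have := search_eq_true (M := M') (D := D) (z := z) (fin := fin) (isSymm_sound h1) hfin D s
    (Nat.xor (2 ^ (z + 1) - 1) (2 ^ s)) l
    (hl.chain.imp fun x y hxy => hMM _ (hR x y hxy)) hl.nodup.of_cons (fun x => ?_)
    ((hun z).2 ⟨by omega, by omega⟩) (fun x hx => by have := (hun x).1 hx; omega)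
    (fun t' ht' => by rw [hf.2] at ht'; simp at ht'; exact ht' ▸ ht)
  · rw [h4] at this
    exact Bool.false_ne_true this
  · have hx := hl.mem x
    have hn := hl.nodup.notMem
    simp only [List.mem_cons, Set.mem_ofPred_eq] at hx
    rw [hun]
    constructor
    · intro h
      exact ⟨⟨by have := hx.1 (Or.inr h); omega, fun e => hn (e ▸ h)⟩,
        by have := hx.1 (Or.inr h); omega⟩
    · rintro ⟨⟨h5, h6⟩, h7⟩
      exact (hx.2 (by omega)).resolve_left h6

/-- Two searches rule out all Hamiltonian paths between the vertices `s`, `t`, `u`. -/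
theorem not_span_of_noPath {M M₁ M₂ D z s t u : ℕ} {R : ℕ → ℕ → Prop} (hsy : ∀ x y, R x y → R y x)
    (hR : ∀ x y, R x y → M.testBit (D * x + y) = true) (hzD : z < D)
    (hstu : s < z ∧ t < z ∧ u < z ∧ 2 < z)
    (h₁ : noPath M M₁ D z (Nat.lor (2 ^ t) (2 ^ u)) s = true)
    (h₂ : noPath M M₂ D z (2 ^ u) t = true) (l : List ℕ) (p q : ℕ)
    (hl : SpanPath R {x | x < z} l) (hf : FromTo l p q) (hp : p = s ∨ p = t ∨ p = u)
    (hq : q = s ∨ q = t ∨ q = u) : False := by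
  have pw : ∀ x, x < z → 2 ^ x < 2 ^ z := fun x hx => Nat.pow_lt_pow_right (by omega) hx
  have key : ∀ l p q, SpanPath R {x | x < z} l → FromTo l p q →
      (p = s ∧ (q = t ∨ q = u)) ∨ (p = t ∧ q = u) → False := by
    clear hp hq
    rintro l p q hl hf (⟨rfl, hq⟩ | ⟨rfl, rfl⟩)
    · refine noPath_sound h₁ hzD (Nat.or_lt_two_pow (pw t hstu.2.1) (pw u hstu.2.2.1)) hR hl hf ?_
      change (2 ^ t ||| 2 ^ u).testBit q = true
      rw [Nat.testBit_or, Nat.testBit_two_pow, Nat.testBit_two_pow]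
      rw [Bool.or_eq_true, decide_eq_true_iff, decide_eq_true_iff]
      exact hq.imp Eq.symm Eq.symm
    · exact noPath_sound h₂ hzD (pw _ hstu.2.2.1) hR hl hf (Nat.testBit_two_pow_self)
  have hne : p ≠ q := by
    rintro rfl
    obtain ⟨h1, h2⟩ := hf
    cases l with
    | nil => simp at h1
    | cons x l =>
      simp only [List.head?_cons, Option.some.injEq] at h1
      subst h1
      rcases List.eq_nil_or_concat l with rfl | ⟨l, y, rfl⟩
      · have e0 := (hl.mem 0).2 (show 0 < z by omega)
        have e1 := (hl.mem 1).2 (show 1 < z by omega)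
        simp only [List.mem_cons, List.not_mem_nil, or_false] at e0 e1
        omega
      · have hn := hl.nodup
        simp only [List.concat_eq_append, List.nodup_cons, List.mem_append, List.mem_singleton,
          not_or] at hn
        simp only [List.concat_eq_append, ← List.cons_append, List.getLast?_concat,
          Option.some.injEq] at h2
        exact hn.1.2 h2.symm
  by_cases h : (p = s ∧ (q = t ∨ q = u)) ∨ (p = t ∧ q = u)
  · exact key l p q hl hf h
  · refine key l.reverse q p (hl.reverse hsy) hf.reverse ?_
    rcases hp with rfl | rfl | rfl <;> rcases hq with rfl | rfl | rfl <;> simp_all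

/-- `l` is a path through exactly the elements of the mask `un`. -/
def isSpan (M D un : ℕ) : List ℕ → Bool
  | [] => false
  | x :: l => and (bit un x) (isPath M D l x (Nat.xor un (Nat.shiftLeft 1 x)))

theorem isSpan_sound {M D un : ℕ} {l : List ℕ} (h : isSpan M D un l = true) :
    SpanPath (fun x y => M.testBit (D * x + y) = true) {x | un.testBit x = true} l := by
  cases l with
  | nil => simp [isSpan] at h
  | cons y l =>
    rw [isSpan, Bool.and_eq_true, bit_eq] at h
    obtain ⟨h1, h2, h3⟩ := And.imp_right (isPath_sound l y _) h
    have hun : ∀ x, (Nat.xor un (Nat.shiftLeft 1 y)).testBit x = true ↔ un.testBit x ∧ x ≠ y := by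
      intro x
      change (un ^^^ Nat.shiftLeft 1 y).testBit x = true ↔ _
      rw [Nat.testBit_xor, testBit_shiftLeft_one]
      by_cases e : x = y
      · subst e; simp [h1]
      · have : y ≠ x := fun h => e h.symm
        simp [e, this]
    refine ⟨h2, List.nodup_cons.2 ⟨fun hy => ?_, h3.1⟩, fun x => ?_⟩
    · rw [h3.2, hun] at hy
      exact hy.2 rfl
    · rw [List.mem_cons, h3.2, hun, Set.mem_ofPred_eq]
      by_cases e : x = y
      · subst e; simp [h1]
      · simp [e]

/-- The list `l` is not empty, and its ends are two of `0, b, c`, in this order up to rotation. -/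
def endsOK (b c : ℕ) (l : List ℕ) : Bool :=
  (fun s t => or (and (Nat.beq s b) (Nat.beq t c)) (and (Nat.beq s 0)
    (or (Nat.beq t b) (Nat.beq t c)))) (l.headD 0) (l.getLastD 0)

theorem endsOK_sound {b c : ℕ} {l : List ℕ} (hl : l ≠ []) (h : endsOK b c l = true) :
    FromTo l b c ∨ FromTo l 0 b ∨ FromTo l 0 c := by
  cases l with
  | nil => exact (hl rfl).elim
  | cons x l =>
    simp only [endsOK, Bool.or_eq_true, Bool.and_eq_true, beq_iff, List.headD_cons] at h
    have e : (x :: l).getLast? = some ((x :: l).getLastD 0) := by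
      rw [List.getLastD_cons, List.getLast?_cons, List.getLastD_eq_getLast?]
    simp only [FromTo, e, List.head?_cons, Option.some.injEq]
    tauto

/-- The `v`-th list is a path through the vertices other than `v`, with the property `p`. -/
def deletions (M D N : ℕ) (p : List ℕ → Bool) : ℕ → List (List ℕ) → Bool
  | v, [] => Nat.beq v N
  | v, l :: ls => and (and (isSpan M D (Nat.xor (2 ^ N - 1) (Nat.shiftLeft 1 v)) l) (p l))
      (eager (Nat.succ v) fun w => deletions M D N p w ls)

theorem deletions_sound {M D N : ℕ} {p : List ℕ → Bool} (v : ℕ) (ls : List (List ℕ))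
    (h : deletions M D N p v ls = true) (w : ℕ) (hw : v ≤ w) (hwN : w < N) :
    ∃ l, SpanPath (fun x y => M.testBit (D * x + y) = true) ({x | x < N} \ {w}) l ∧
      p l = true ∧ l ≠ [] := by
  induction ls generalizing v with
  | nil => rw [deletions, beq_iff] at h; omega
  | cons l ls ih =>
    rw [deletions, eager_eq, Bool.and_eq_true, Bool.and_eq_true] at h
    rcases Nat.eq_or_lt_of_le hw with rfl | hlt
    · refine ⟨l, ?_, h.1.2, ?_⟩
      · have := isSpan_sound h.1.1
        refine ⟨this.chain, this.nodup, fun x => (this.mem x).trans ?_⟩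
        change ((2 ^ N - 1) ^^^ Nat.shiftLeft 1 v).testBit x = true ↔ x < N ∧ x ≠ v
        rw [Nat.testBit_xor, testBit_shiftLeft_one, Nat.testBit_two_pow_sub_one]
        by_cases e : x = v
        · subst e; simp [hwN]
        · have : v ≠ x := fun h => e h.symm
          simp [e, this]
      · rintro rfl
        simp [isSpan] at h
    · exact ih _ h.2 hlt

theorem spanPath_of_bits {M D N : ℕ} {R : ℕ → ℕ → Prop} {S : Set ℕ} {l : List ℕ}
    (hS : ∀ x ∈ S, x < N) (hR : ∀ x < N, ∀ y < N, M.testBit (D * x + y) = true → R x y)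
    (h : SpanPath (fun x y => M.testBit (D * x + y) = true) S l) : SpanPath R S l := by
  refine ⟨?_, h.nodup, h.mem⟩
  have hc := h.chain
  rw [List.isChain_iff_forall_rel_of_append_cons_cons] at hc ⊢
  intro x y p q e
  exact hR x (hS x ((h.mem x).1 (by simp [e]))) y (hS y ((h.mem y).1 (by simp [e]))) (hc e)

theorem isSpan_sound_full {M D N : ℕ} {l : List ℕ} (h : isSpan M D (2 ^ N - 1) l = true) :
    SpanPath (fun x y => M.testBit (D * x + y) = true) {x | x < N} l := by
  have := isSpan_sound h
  refine ⟨this.chain, this.nodup, fun x => (this.mem x).trans ?_⟩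
  rw [Set.mem_ofPred_eq, Nat.testBit_two_pow_sub_one]
  simp

theorem exists_fromTo {l : List ℕ} {s : ℕ} (h : l.head? = some s) : ∃ t, FromTo l s t := by
  cases l with
  | nil => simp at h
  | cons x l => exact ⟨_, h, List.getLast?_cons⟩

/-- A piece from a bit matrix, two searches and lists of paths. -/
theorem isPiece_of_checks {M D N b c : ℕ} {ls : List (List ℕ)} {lb lc : List ℕ} (hND : N < D)
    (hb : 0 < b ∧ b < N) (hc : 0 < c ∧ c < N) (hsymm : isSymm M D = true)
    (hloop : isLoopless M D = true)
    (hno : ∀ l s t, SpanPath (MatAdj M D N) {x | x < N} l → FromTo l s t →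
      (s = 0 ∨ s = b ∨ s = c) → (t = 0 ∨ t = b ∨ t = c) → False)
    (hdel : deletions M D N (endsOK b c) 0 ls = true)
    (hlb : isSpan M D (2 ^ N - 1) lb = true) (hlb' : lb.head? = some b)
    (hlc : isSpan M D (2 ^ N - 1) lc = true) (hlc' : lc.head? = some c) :
    IsPiece (MatAdj M D N) N b c where
  symm := fun x y ⟨h1, h2, h3⟩ => ⟨h2, h1, isSymm_sound hsymm x (by omega) y (by omega) h3⟩
  lt := fun x y h => h.1
  irrefl := fun x h => isLoopless_sound hloop x (h.1.trans hND) h.2.2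
  b_pos := hb.1
  b_lt := hb.2
  c_pos := hc.1
  c_lt := hc.2
  not_span := hno
  exists_del := fun v hv => by
    obtain ⟨l, h1, h2, h3⟩ := deletions_sound 0 ls hdel v (Nat.zero_le _) hv
    exact ⟨l, spanPath_of_bits (N := N) (fun x hx => hx.1) (fun x hx y hy h => ⟨hx, hy, h⟩) h1,
      endsOK_sound h3 h2⟩
  exists_span_b := by
    obtain ⟨t, ht⟩ := exists_fromTo hlb'
    exact ⟨lb, t, spanPath_of_bits (N := N) (fun x hx => hx) (fun x hx y hy h => ⟨hx, hy, h⟩)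
      (isSpan_sound_full hlb), ht⟩
  exists_span_c := by
    obtain ⟨t, ht⟩ := exists_fromTo hlc'
    exact ⟨lc, t, spanPath_of_bits (N := N) (fun x hx => hx) (fun x hx y hy h => ⟨hx, hy, h⟩)
      (isSpan_sound_full hlc), ht⟩

end PathSearch

/-! ### The pieces -/

namespace PathSearch

/-- A planar graph with 35 vertices. -/
def smallMat : ℕ :=
  3722168382805662732808697281615575298251145991130240185247887847780070647000276789803601538597980288438175128346542169980088773895688529576669066669355280891563063085824535618310848060868998479607039805690205860400174217633571838260665584215849768687278541433688721821054705782200787563164930996271513193375731064385991485163969878951408268772934140283555291629635651114559865216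

/-- Paths in the vertex-deleted subgraphs of the graph `smallMat`. -/
def smallDeletions : List (List ℕ) :=
  [[1, 15, 16, 17, 18, 8, 5, 4, 7, 32, 13, 3, 2, 6, 20, 19, 21, 22, 25, 28, 30, 23, 24, 26, 29,
  27, 14, 12, 9, 10, 11, 34, 33, 31], [0, 7, 4, 3, 2, 6, 5, 8, 18, 20, 19, 21, 17, 16, 15, 33, 28,
  25, 22, 23, 30, 11, 34, 12, 9, 10, 24, 26, 29, 27, 14, 13, 32, 31], [1, 15, 16, 17, 18, 8, 0, 7,
  32, 13, 3, 4, 5, 6, 20, 19, 21, 22, 25, 28, 30, 23, 24, 26, 29, 27, 14, 12, 9, 10, 11, 34, 33,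
  31], [1, 15, 16, 17, 21, 19, 20, 18, 8, 0, 7, 4, 5, 6, 2, 27, 14, 13, 32, 34, 12, 9, 29, 26, 24,
  10, 11, 30, 23, 22, 25, 28, 33, 31], [1, 15, 16, 17, 18, 20, 19, 21, 22, 25, 28, 33, 34, 11, 30,
  23, 24, 10, 9, 12, 14, 13, 3, 2, 27, 29, 26, 6, 5, 8, 0, 7, 32, 31], [1, 15, 16, 17, 18, 8, 0,
  7, 4, 3, 2, 6, 20, 19, 21, 22, 25, 28, 33, 34, 12, 9, 10, 11, 30, 23, 24, 26, 29, 27, 14, 13,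
  32, 31], [1, 15, 16, 17, 18, 20, 19, 21, 22, 25, 28, 30, 23, 24, 26, 29, 27, 2, 3, 4, 5, 8, 0,
  7, 32, 13, 14, 12, 9, 10, 11, 34, 33, 31], [0, 8, 5, 4, 3, 2, 6, 20, 18, 1, 15, 16, 17, 21, 19,
  24, 26, 29, 27, 14, 13, 32, 34, 12, 9, 10, 11, 30, 23, 22, 25, 28, 33, 31], [0, 7, 4, 5, 6, 2,
  3, 13, 14, 27, 29, 26, 24, 19, 20, 18, 17, 21, 22, 23, 30, 11, 10, 9, 12, 34, 32, 31, 33, 28,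
  25, 16, 15, 1], [1, 15, 16, 17, 21, 19, 20, 18, 8, 0, 7, 4, 5, 6, 2, 3, 13, 32, 34, 12, 14, 27,
  29, 26, 24, 10, 11, 30, 23, 22, 25, 28, 33, 31], [1, 15, 16, 17, 18, 8, 0, 7, 4, 5, 6, 20, 19,
  21, 22, 25, 28, 33, 34, 11, 30, 23, 24, 26, 29, 9, 12, 14, 27, 2, 3, 13, 32, 31], [1, 15, 33,
  28, 30, 23, 22, 25, 16, 17, 21, 19, 20, 18, 8, 0, 7, 4, 5, 6, 2, 3, 13, 14, 27, 29, 26, 24, 10,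
  9, 12, 34, 32, 31], [1, 15, 16, 17, 18, 8, 0, 7, 32, 13, 14, 27, 2, 3, 4, 5, 6, 20, 19, 21, 22,
  25, 28, 30, 23, 24, 26, 29, 9, 10, 11, 34, 33, 31], [1, 15, 16, 17, 18, 20, 6, 26, 29, 9, 10,
  11, 30, 23, 24, 19, 21, 22, 25, 28, 33, 34, 12, 14, 27, 2, 3, 4, 5, 8, 0, 7, 32, 31], [1, 15,
  16, 17, 18, 8, 0, 7, 4, 5, 6, 20, 19, 21, 22, 25, 28, 33, 34, 12, 9, 10, 11, 30, 23, 24, 26, 29,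
  27, 2, 3, 13, 32, 31], [1, 18, 8, 0, 7, 4, 5, 6, 20, 19, 21, 17, 16, 25, 22, 23, 24, 26, 29, 9,
  10, 11, 30, 28, 33, 34, 12, 14, 27, 2, 3, 13, 32, 31], [0, 7, 4, 5, 8, 18, 17, 21, 19, 20, 6, 2,
  3, 13, 14, 27, 29, 26, 24, 23, 22, 25, 28, 30, 11, 10, 9, 12, 34, 32, 31, 33, 15, 1], [1, 15,
  16, 25, 22, 21, 19, 20, 18, 8, 0, 7, 4, 5, 6, 2, 3, 13, 32, 34, 11, 10, 9, 12, 14, 27, 29, 26,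
  24, 23, 30, 28, 33, 31], [1, 15, 16, 17, 21, 19, 20, 6, 2, 3, 4, 5, 8, 0, 7, 32, 13, 14, 27, 29,
  26, 24, 10, 9, 12, 34, 11, 30, 23, 22, 25, 28, 33, 31], [1, 15, 16, 17, 21, 22, 25, 28, 30, 23,
  24, 26, 29, 27, 2, 3, 4, 5, 6, 20, 18, 8, 0, 7, 32, 13, 14, 12, 9, 10, 11, 34, 33, 31], [1, 15,
  16, 17, 18, 8, 0, 7, 4, 5, 6, 26, 29, 9, 10, 11, 30, 23, 24, 19, 21, 22, 25, 28, 33, 34, 12, 14,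
  27, 2, 3, 13, 32, 31], [1, 15, 16, 17, 18, 8, 0, 7, 4, 5, 6, 20, 19, 24, 26, 29, 9, 10, 11, 30,
  23, 22, 25, 28, 33, 34, 12, 14, 27, 2, 3, 13, 32, 31], [1, 15, 16, 25, 28, 30, 23, 24, 19, 21,
  17, 18, 20, 6, 26, 29, 27, 2, 3, 4, 5, 8, 0, 7, 32, 13, 14, 12, 9, 10, 11, 34, 33, 31], [1, 15,
  16, 17, 18, 8, 0, 7, 4, 5, 6, 20, 19, 21, 22, 25, 28, 30, 11, 10, 24, 26, 29, 9, 12, 14, 27, 2,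
  3, 13, 32, 34, 33, 31], [1, 15, 16, 17, 21, 19, 20, 18, 8, 0, 7, 4, 5, 6, 26, 29, 9, 10, 11, 30,
  23, 22, 25, 28, 33, 34, 12, 14, 27, 2, 3, 13, 32, 31], [1, 15, 16, 17, 18, 8, 0, 7, 4, 5, 6, 20,
  19, 21, 22, 23, 24, 26, 29, 9, 10, 11, 30, 28, 33, 34, 12, 14, 27, 2, 3, 13, 32, 31], [1, 15,
  16, 17, 18, 8, 0, 7, 32, 13, 14, 12, 9, 29, 27, 2, 3, 4, 5, 6, 20, 19, 21, 22, 25, 28, 30, 23,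
  24, 10, 11, 34, 33, 31], [1, 15, 16, 17, 21, 19, 20, 18, 8, 0, 7, 4, 5, 6, 2, 3, 13, 14, 12, 9,
  29, 26, 24, 10, 11, 30, 23, 22, 25, 28, 33, 34, 32, 31], [1, 18, 17, 21, 19, 20, 6, 2, 3, 4, 5,
  8, 0, 7, 32, 13, 14, 27, 29, 26, 24, 10, 9, 12, 34, 11, 30, 23, 22, 25, 16, 15, 33, 31], [1, 15,
  16, 17, 18, 20, 19, 21, 22, 25, 28, 33, 34, 12, 9, 10, 11, 30, 23, 24, 26, 6, 2, 27, 14, 13, 3,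
  4, 5, 8, 0, 7, 32, 31], [1, 15, 16, 17, 21, 19, 20, 18, 8, 0, 7, 4, 5, 6, 2, 3, 13, 32, 34, 11,
  10, 9, 12, 14, 27, 29, 26, 24, 23, 22, 25, 28, 33, 31], [0, 7, 4, 3, 2, 6, 5, 8, 18, 20, 19, 21,
  17, 16, 25, 22, 23, 24, 26, 29, 27, 14, 13, 32, 34, 12, 9, 10, 11, 30, 28, 33, 15, 1], [1, 15,
  16, 17, 18, 8, 0, 7, 4, 5, 6, 20, 19, 21, 22, 25, 28, 30, 23, 24, 26, 29, 27, 2, 3, 13, 14, 12,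
  9, 10, 11, 34, 33, 31], [1, 15, 16, 17, 18, 8, 0, 7, 4, 5, 6, 20, 19, 21, 22, 25, 28, 30, 23,
  24, 26, 29, 9, 10, 11, 34, 12, 14, 27, 2, 3, 13, 32, 31], [1, 15, 16, 17, 18, 8, 0, 7, 32, 13,
  14, 12, 9, 10, 11, 30, 23, 24, 26, 29, 27, 2, 3, 4, 5, 6, 20, 19, 21, 22, 25, 28, 33, 31]]

theorem not_span_small (l : List ℕ) (p q : ℕ) (hl : SpanPath (MatAdj smallMat 36 35) {x | x < 35} l)
    (hf : FromTo l p q) (hp : p = 0 ∨ p = 1 ∨ p = 31) (hq : q = 0 ∨ q = 1 ∨ q = 31) : False :=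
  not_span_of_noPath (M := smallMat) (D := 36) (z := 35) (s := 31) (t := 0) (u := 1)
    (M₁ := 63276834108500695321339659237815710750227515356441127361680186605735286442555545829027688920336590660079839331728734826257079089800249371565079481969785506814667136664025183043618217386477730038252056021287491004510054724993353936269560512486790131379533650564421224730934866600462443015890674281780158070888099584377716573436246388171910882005802625942598721843724475262855807360)
    (M₂ := 43425278866602351125162671919082332266235392234670831636202753686416881177370456149286326459757053869532617930601337274164748984498729090902276010202975431506965778804624967235182427611274819518703717282755062623140094555873426570266595536396476677148781947520843723760974812994375224531648759853277276445050643411047141544012154218431743344261513130722917579226089281002124870016)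
    (fun x y h => ⟨h.2.1, h.1, isSymm_sound (D := 36) (by decide +kernel) x (by have := h.1; omega) y
      (by have := h.2.1; omega) h.2.2⟩)
    (fun x y h => h.2.2) (by norm_num) (by norm_num) (by decide +kernel) (by decide +kernel)
    l p q hl hf (by omega) (by omega)

theorem isPiece_small : IsPiece (MatAdj smallMat 36 35) 35 1 31 :=
  isPiece_of_checks (ls := smallDeletions)
    (lb :=
      [1, 15, 16, 17, 18, 8, 0, 7, 4, 5, 6, 2, 3, 13, 14, 27, 29, 26, 24, 23, 30, 11, 10, 9,
      12, 34, 32, 31, 33, 28, 25, 22, 21, 19, 20])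
    (lc :=
      [31, 32, 7, 0, 8, 5, 4, 3, 13, 14, 12, 9, 10, 11, 34, 33, 15, 1, 18, 17, 16, 25, 22, 21,
      19, 20, 6, 2, 27, 29, 26, 24, 23, 30, 28])
    (by norm_num) (by norm_num) (by norm_num) (by decide +kernel) (by decide +kernel)
    not_span_small (by decide +kernel) (by decide +kernel) rfl (by decide +kernel) rfl

/-- A planar graph with 38 vertices. -/
def largeMat : ℕ :=
  524695804866965965577307484160437535257670138001442765029060640461679238138991483232337675596864333210369085110752778045046219438000289105642830856642499120561799333677461150623842269638857787993220688730303559924402992574131418098916904834890072507402982116592740024853787182304476663511049443953857245980723487551529352901782092276318959856390276463011652685356964898559424449880062462298039022686924314089995231131321335346366614912661192960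

/-- Paths in the vertex-deleted subgraphs of the graph `largeMat`. -/
def largeDeletions : List (List ℕ) :=
  [[1, 24, 23, 22, 25, 20, 21, 7, 8, 9, 4, 16, 15, 5, 6, 30, 29, 28, 27, 26, 34, 35, 36, 33, 32,
  11, 17, 19, 18, 10, 14, 13, 12, 37, 31, 3, 2], [0, 8, 7, 6, 5, 15, 16, 35, 34, 19, 18, 10, 11,
  17, 36, 33, 32, 31, 37, 12, 13, 14, 28, 27, 26, 30, 29, 21, 20, 25, 22, 23, 24, 3, 4, 9, 2], [0,
  8, 7, 6, 5, 9, 4, 3, 24, 23, 22, 13, 12, 37, 31, 32, 33, 36, 17, 11, 10, 14, 28, 27, 18, 19, 34,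
  35, 16, 15, 26, 30, 29, 21, 20, 25, 1], [1, 24, 23, 22, 25, 20, 0, 8, 7, 21, 29, 28, 14, 13, 12,
  37, 31, 32, 11, 10, 18, 27, 26, 30, 6, 5, 15, 16, 35, 34, 19, 17, 36, 33, 4, 9, 2], [1, 24, 3,
  31, 32, 33, 36, 17, 11, 10, 14, 13, 12, 37, 23, 22, 25, 20, 0, 8, 7, 21, 29, 28, 27, 18, 19, 34,
  35, 16, 15, 26, 30, 6, 5, 9, 2], [1, 24, 3, 4, 16, 15, 26, 30, 6, 7, 21, 29, 28, 27, 18, 10, 14,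
  13, 12, 11, 17, 19, 34, 35, 36, 33, 32, 31, 37, 23, 22, 25, 20, 0, 8, 9, 2], [1, 24, 23, 22, 25,
  20, 0, 8, 7, 21, 29, 30, 26, 15, 5, 9, 4, 16, 35, 34, 19, 17, 36, 33, 32, 11, 10, 18, 27, 28,
  14, 13, 12, 37, 31, 3, 2], [1, 25, 22, 13, 12, 11, 10, 14, 28, 27, 18, 19, 17, 36, 33, 32, 31,
  37, 23, 24, 3, 4, 16, 35, 34, 26, 15, 5, 6, 30, 29, 21, 20, 0, 8, 9, 2], [0, 20, 21, 7, 6, 5, 9,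
  4, 16, 15, 26, 30, 29, 22, 25, 1, 24, 23, 37, 12, 13, 14, 28, 27, 18, 10, 11, 17, 19, 34, 35,
  36, 33, 32, 31, 3, 2], [1, 24, 23, 22, 25, 20, 0, 8, 7, 21, 29, 28, 14, 13, 12, 37, 31, 32, 11,
  10, 18, 27, 26, 30, 6, 5, 15, 16, 35, 34, 19, 17, 36, 33, 4, 3, 2], [1, 24, 23, 22, 25, 20, 0,
  8, 7, 21, 29, 30, 6, 5, 9, 4, 16, 15, 26, 34, 35, 36, 33, 32, 11, 17, 19, 18, 27, 28, 14, 13,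
  12, 37, 31, 3, 2], [1, 24, 23, 22, 25, 20, 0, 8, 7, 21, 29, 28, 27, 18, 10, 14, 13, 12, 37, 31,
  32, 33, 36, 17, 19, 34, 35, 16, 15, 26, 30, 6, 5, 9, 4, 3, 2], [1, 24, 23, 37, 31, 32, 11, 10,
  14, 13, 22, 25, 20, 0, 8, 9, 5, 15, 16, 35, 34, 26, 30, 6, 7, 21, 29, 28, 27, 18, 19, 17, 36,
  33, 4, 3, 2], [1, 24, 3, 31, 32, 11, 12, 37, 23, 22, 25, 20, 0, 8, 7, 21, 29, 28, 14, 10, 18,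
  27, 26, 30, 6, 5, 15, 16, 35, 34, 19, 17, 36, 33, 4, 9, 2], [1, 24, 23, 37, 12, 13, 22, 25, 20,
  0, 8, 7, 21, 29, 28, 27, 18, 10, 11, 17, 19, 34, 26, 30, 6, 5, 15, 16, 35, 36, 33, 32, 31, 3, 4,
  9, 2], [1, 24, 3, 4, 16, 35, 34, 19, 17, 36, 33, 32, 31, 37, 23, 22, 25, 20, 0, 8, 7, 21, 29,
  28, 14, 13, 12, 11, 10, 18, 27, 26, 30, 6, 5, 9, 2], [1, 24, 23, 22, 25, 20, 0, 8, 9, 5, 15, 26,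
  30, 6, 7, 21, 29, 28, 27, 18, 10, 14, 13, 12, 37, 31, 32, 11, 17, 19, 34, 35, 36, 33, 4, 3, 2],
  [1, 24, 3, 4, 16, 15, 5, 6, 7, 21, 29, 30, 26, 27, 28, 14, 13, 12, 11, 10, 18, 19, 34, 35, 36,
  33, 32, 31, 37, 23, 22, 25, 20, 0, 8, 9, 2], [1, 24, 3, 31, 32, 11, 10, 14, 13, 12, 37, 23, 22,
  25, 20, 0, 8, 7, 21, 29, 28, 27, 26, 30, 6, 5, 15, 16, 35, 34, 19, 17, 36, 33, 4, 9, 2], [1, 24,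
  3, 31, 32, 33, 4, 16, 15, 5, 6, 7, 21, 29, 30, 26, 34, 35, 36, 17, 11, 10, 18, 27, 28, 14, 13,
  12, 37, 23, 22, 25, 20, 0, 8, 9, 2], [0, 8, 7, 21, 29, 28, 14, 10, 18, 27, 26, 30, 6, 5, 15, 16,
  4, 9, 2, 3, 24, 23, 37, 31, 32, 33, 36, 35, 34, 19, 17, 11, 12, 13, 22, 25, 1], [1, 24, 3, 4,
  16, 15, 26, 30, 29, 28, 27, 18, 10, 14, 13, 12, 11, 17, 19, 34, 35, 36, 33, 32, 31, 37, 23, 22,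
  25, 20, 0, 8, 7, 6, 5, 9, 2], [1, 25, 20, 0, 8, 7, 21, 29, 28, 14, 13, 12, 11, 10, 18, 27, 26,
  30, 6, 5, 15, 16, 35, 34, 19, 17, 36, 33, 32, 31, 37, 23, 24, 3, 4, 9, 2], [0, 8, 7, 6, 5, 15,
  16, 35, 34, 19, 18, 10, 14, 28, 27, 26, 30, 29, 21, 20, 25, 22, 13, 12, 37, 31, 32, 11, 17, 36,
  33, 4, 9, 2, 3, 24, 1], [1, 25, 20, 0, 8, 7, 21, 29, 22, 23, 37, 12, 13, 14, 28, 27, 18, 10, 11,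
  17, 19, 34, 26, 30, 6, 5, 15, 16, 35, 36, 33, 32, 31, 3, 4, 9, 2], [1, 24, 23, 22, 13, 12, 37,
  31, 32, 11, 10, 14, 28, 29, 30, 6, 7, 21, 20, 0, 8, 9, 5, 15, 16, 35, 34, 26, 27, 18, 19, 17,
  36, 33, 4, 3, 2], [1, 24, 3, 31, 32, 11, 10, 18, 27, 28, 14, 13, 12, 37, 23, 22, 25, 20, 0, 8,
  7, 21, 29, 30, 6, 5, 15, 16, 35, 34, 19, 17, 36, 33, 4, 9, 2], [1, 24, 23, 22, 25, 20, 0, 8, 7,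
  21, 29, 28, 14, 13, 12, 37, 31, 32, 33, 36, 17, 11, 10, 18, 19, 34, 35, 16, 15, 26, 30, 6, 5, 9,
  4, 3, 2], [1, 24, 3, 4, 16, 15, 5, 6, 7, 21, 29, 30, 26, 27, 18, 10, 14, 13, 12, 11, 17, 19, 34,
  35, 36, 33, 32, 31, 37, 23, 22, 25, 20, 0, 8, 9, 2], [1, 25, 22, 13, 12, 11, 10, 14, 28, 27, 18,
  19, 17, 36, 35, 34, 26, 30, 6, 7, 21, 20, 0, 8, 9, 5, 15, 16, 4, 33, 32, 31, 37, 23, 24, 3, 2],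
  [1, 24, 23, 22, 25, 20, 0, 8, 9, 4, 16, 15, 5, 6, 7, 21, 29, 28, 27, 26, 34, 35, 36, 33, 32, 11,
  17, 19, 18, 10, 14, 13, 12, 37, 31, 3, 2], [1, 25, 20, 0, 8, 9, 5, 15, 16, 4, 33, 32, 11, 10,
  14, 28, 27, 18, 19, 17, 36, 35, 34, 26, 30, 6, 7, 21, 29, 22, 13, 12, 37, 23, 24, 3, 2], [1, 24,
  3, 31, 37, 23, 22, 25, 20, 0, 8, 7, 21, 29, 28, 14, 13, 12, 11, 10, 18, 27, 26, 30, 6, 5, 15,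
  16, 35, 34, 19, 17, 36, 33, 4, 9, 2], [1, 24, 3, 31, 32, 11, 10, 14, 13, 12, 37, 23, 22, 25, 20,
  0, 8, 7, 21, 29, 28, 27, 18, 19, 17, 36, 35, 34, 26, 30, 6, 5, 15, 16, 4, 9, 2], [1, 24, 3, 31,
  32, 11, 17, 19, 18, 10, 14, 13, 12, 37, 23, 22, 25, 20, 0, 8, 7, 21, 29, 28, 27, 26, 30, 6, 5,
  15, 16, 35, 36, 33, 4, 9, 2], [1, 24, 3, 31, 32, 33, 36, 17, 11, 10, 14, 13, 12, 37, 23, 22, 25,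
  20, 0, 8, 7, 21, 29, 28, 27, 18, 19, 34, 26, 30, 6, 5, 15, 16, 4, 9, 2], [1, 24, 3, 4, 33, 32,
  31, 37, 23, 22, 25, 20, 0, 8, 7, 21, 29, 28, 27, 18, 10, 14, 13, 12, 11, 17, 19, 34, 35, 16, 15,
  26, 30, 6, 5, 9, 2], [1, 24, 23, 22, 25, 20, 0, 8, 7, 21, 29, 28, 14, 13, 12, 11, 10, 18, 27,
  26, 30, 6, 5, 15, 16, 35, 34, 19, 17, 36, 33, 32, 31, 3, 4, 9, 2]]

theorem not_span_large (l : List ℕ) (p q : ℕ) (hl : SpanPath (MatAdj largeMat 39 38) {x | x < 38} l)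
    (hf : FromTo l p q) (hp : p = 0 ∨ p = 1 ∨ p = 2) (hq : q = 0 ∨ q = 1 ∨ q = 2) : False :=
  not_span_of_noPath (M := largeMat) (D := 39) (z := 38) (s := 0) (t := 1) (u := 2)
    (M₁ := 803320001677228082320578862971545798104807594156803982378580345997920873815851749440471432674947662253128057228927224276136809882343959450959533186951110444552613415666588317729148684606296487484725143242902177708133527556133389135812470205066403148786052561395571675316355767163409450016998667925832077025505432278544064313060170475752685077913271810284301559683940566973190006734105450043211810507065930967430129399199589443355946106524701556992)
    (M₂ := 535721566386441043535578344475750677914957619483869802507396584212101142289947496788058401008497396279822161180988400443439555328041973063674903068252954462741929543555618032202973737160743944252481169058178219658730486034946969896574619104989232123359836034969245363552521773836374458899169461765206003765663862681546552659674041014593896371894311299010538257351079366281646479306030320849573886678939595416316779035426745492356286804082012717312)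
    (fun x y h => ⟨h.2.1, h.1, isSymm_sound (D := 39) (by decide +kernel) x (by have := h.1; omega) y
      (by have := h.2.1; omega) h.2.2⟩)
    (fun x y h => h.2.2) (by norm_num) (by norm_num) (by decide +kernel) (by decide +kernel)
    l p q hl hf (by omega) (by omega)

theorem isPiece_large : IsPiece (MatAdj largeMat 39 38) 38 1 2 :=
  isPiece_of_checks (ls := largeDeletions)
    (lb :=
      [1, 24, 3, 2, 9, 4, 16, 15, 5, 6, 30, 26, 27, 18, 10, 11, 12, 13, 14, 28, 29, 21, 7, 8,
      0, 20, 25, 22, 23, 37, 31, 32, 33, 36, 17, 19, 34, 35])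
    (lc :=
      [2, 3, 4, 9, 5, 6, 7, 8, 0, 20, 21, 29, 30, 26, 15, 16, 35, 34, 19, 17, 36, 33, 32, 31,
      37, 12, 11, 10, 18, 27, 28, 14, 13, 22, 23, 24, 1, 25])
    (by norm_num) (by norm_num) (by norm_num) (by decide +kernel) (by decide +kernel)
    not_span_large (by decide +kernel) (by decide +kernel) rfl (by decide +kernel) rfl

end PathSearch

theorem SpanPath.congr {R : ℕ → ℕ → Prop} {S S' : Set ℕ} {l : List ℕ} (h : SpanPath R S l)
    (hS : ∀ x, x ∈ S ↔ x ∈ S') : SpanPath R S' l :=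
  ⟨h.chain, h.nodup, fun x => (h.mem x).trans (hS x)⟩

namespace Ladder

open PathSearch

variable {m n : ℕ} {adj : ℕ → ℕ → Prop}

theorem exists_insert_of_span {r : ℕ} (hr : r + 2 ≤ n) {S : Set ℕ} {l : List ℕ} {s t : ℕ}
    (hl : SpanPath (Adj adj m n) S l) (hf : FromTo l s t) (hh : Hits m l r) :
    ∃ l', SpanPath (Adj adj m (n + 2))
      {y | (∃ x ∈ S, shift m r x = y) ∨ (m + 2 * r + 2 ≤ y ∧ y < m + 2 * r + 6)} l' ∧
      FromTo l' (shift m r s) (shift m r t) ∧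
      Hits m l' r ∧ Hits m l' (r + 2) ∧ (∀ s, s + 2 ≤ r → Hits m l s → Hits m l' s) ∧
      (∀ s, r + 2 ≤ s → Hits m l s → Hits m l' (s + 2)) := by
  obtain ⟨l', h1, h2, h3, h4, h5, h6⟩ := exists_insert hr hl.chain hl.nodup hh
  refine ⟨l', ⟨h1, h2, fun y => ?_⟩, ⟨by rw [h4, hf.1]; rfl, by rw [h5, hf.2]; rfl⟩, h6⟩
  rw [h3]
  simp only [hl.mem, Set.mem_ofPred_eq]

/-- Paths in all vertex-deleted subgraphs of a ladder with four rungs yield such paths in the graphs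
with longer ladders. -/
theorem exists_del_of_four (F : ℕ → ℕ → Prop) (hF : ∀ s t, F s t → s < m + 2 ∧ t < m + 2)
    (h4 : ∀ v < m + 8, ∃ l s t, SpanPath (Adj adj m 4) ({x | x < m + 8} \ {v}) l ∧ FromTo l s t ∧
      F s t ∧ Hits m l 0 ∧ Hits m l 2) (k : ℕ) :
    ∀ v < m + 2 * (4 + 2 * k), ∃ l s t,
      SpanPath (Adj adj m (4 + 2 * k)) ({x | x < m + 2 * (4 + 2 * k)} \ {v}) l ∧ FromTo l s t ∧
      F s t ∧ Hits m l 0 ∧ Hits m l (2 + 2 * k) := by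
  induction k with
  | zero => exact h4
  | succ k ih =>
    intro v hv
    by_cases hvm : m + 2 ≤ v ∧ v < m + 6
    · obtain ⟨l, s, t, h1, h2, h3, h5, h6⟩ := ih v (by omega)
      obtain ⟨l', h7, h8, -, h9, h10, -⟩ := exists_insert_of_span (by omega) h1 h2 h6
      rw [shift_of_lt (by have := hF s t h3; omega), shift_of_lt (by have := hF s t h3; omega)] at h8
      refine ⟨l', s, t, h7.congr fun x => ?_, h8, h3, h10 0 (by omega) h5, h9⟩
      simp only [Set.mem_ofPred_eq, Set.mem_sdiff, Set.mem_singleton_iff]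
      constructor
      · rintro (⟨y, hy, rfl⟩ | h)
        · unfold shift; split_ifs <;> omega
        · omega
      · intro hx
        by_cases h : x < m + 2 * (2 + 2 * k) + 2
        · exact Or.inl ⟨x, by omega, shift_of_lt h⟩
        · by_cases h' : x < m + 2 * (2 + 2 * k) + 6
          · exact Or.inr (by omega)
          · exact Or.inl ⟨x - 4, by omega, by rw [shift_of_le (by omega)]; omega⟩
    · obtain ⟨v', hv', hvv⟩ : ∃ v' < m + 2 * (4 + 2 * k), shift m 0 v' = v := by
        by_cases h : v < m + 2
        · exact ⟨v, by omega, shift_of_lt (by omega)⟩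
        · exact ⟨v - 4, by omega, by rw [shift_of_le (by omega)]; omega⟩
      obtain ⟨l, s, t, h1, h2, h3, h5, h6⟩ := ih v' hv'
      obtain ⟨l', h7, h8, h9, -, -, h10⟩ := exists_insert_of_span (by omega) h1 h2 h5
      rw [shift_of_lt (by have := hF s t h3; omega), shift_of_lt (by have := hF s t h3; omega)] at h8
      refine ⟨l', s, t, h7.congr fun x => ?_, h8, h3, h9, h10 (2 + 2 * k) (by omega) h6⟩
      simp only [Set.mem_ofPred_eq, Set.mem_sdiff, Set.mem_singleton_iff]
      constructor
      · rintro (⟨y, hy, rfl⟩ | h)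
        · refine ⟨by unfold shift; split_ifs <;> omega, fun e => hy.2 ?_⟩
          exact shift_injective (e.trans hvv.symm)
        · omega
      · intro hx
        by_cases h : x < m + 2
        · exact Or.inl ⟨x, ⟨by omega, fun e => hx.2 (by rw [← hvv, ← e, shift_of_lt (by omega)])⟩,
            shift_of_lt (by omega)⟩
        · by_cases h' : x < m + 6
          · exact Or.inr (by omega)
          · have e4 : shift m 0 (x - 4) = x := by rw [shift_of_le (by omega)]; omega
            exact Or.inl ⟨x - 4, ⟨by omega, fun e => hx.2 (by rw [← hvv, ← e, e4])⟩, e4⟩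

theorem exists_span_of_four {s : ℕ} (hs : s < m + 2)
    (h4 : ∃ l t, SpanPath (Adj adj m 4) {x | x < m + 8} l ∧ FromTo l s t ∧ Hits m l 0) (k : ℕ) :
    ∃ l t, SpanPath (Adj adj m (4 + 2 * k)) {x | x < m + 2 * (4 + 2 * k)} l ∧ FromTo l s t ∧
      Hits m l 0 := by
  induction k with
  | zero => exact h4
  | succ k ih =>
    obtain ⟨l, t, h1, h2, h3⟩ := ih
    obtain ⟨l', h7, h8, h9, -⟩ := exists_insert_of_span (by omega) h1 h2 h3
    rw [shift_of_lt (by omega)] at h8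
    refine ⟨l', _, h7.congr fun x => ?_, h8, h9⟩
    simp only [Set.mem_ofPred_eq]
    constructor
    · rintro (⟨y, hy, rfl⟩ | h)
      · unfold shift; split_ifs <;> omega
      · omega
    · intro hx
      by_cases h : x < m + 2
      · exact Or.inl ⟨x, by omega, shift_of_lt (by omega)⟩
      · by_cases h' : x < m + 6
        · exact Or.inr (by omega)
        · exact Or.inl ⟨x - 4, by omega, by rw [shift_of_le (by omega)]; omega⟩

theorem not_span_of_two {F : ℕ → Prop} (hF : ∀ s, F s → s < m + 2)
    (h2 : ∀ l s t, SpanPath (Adj adj m 2) {x | x < m + 4} l → FromTo l s t → F s → F t → False)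
    (k : ℕ) : ∀ l s t, SpanPath (Adj adj m (2 + 2 * k)) {x | x < m + 2 * (2 + 2 * k)} l →
      FromTo l s t → F s → F t → False := by
  induction k with
  | zero => exact h2
  | succ k ih =>
    intro l s t hl hf hs ht
    obtain ⟨l', h1, h2⟩ := exists_remove (n := 2 + 2 * k) (by omega) hl hf (hF s hs) (hF t ht)
    exact ih l' s t h1 h2 hs ht

instance {M D N : ℕ} : DecidableRel (MatAdj M D N) := fun _ _ =>
  inferInstanceAs (Decidable (_ ∧ _ ∧ _))

instance {M D N : ℕ} : DecidableRel (Adj (MatAdj M D N) m n) := fun _ _ =>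
  inferInstanceAs (Decidable ((_ ∨ _ ∨ _ ∨ _) ∨ (_ ∨ _ ∨ _ ∨ _)))

instance {l : List ℕ} {r : ℕ} : Decidable (Hits m l r) :=
  inferInstanceAs (Decidable (¬ _ ∨ ¬ _ ∨ ¬ _ ∨ ¬ _))

/-- The graph `smallMat` with a ladder of four rungs. -/
def fourMat : ℕ :=
  27583837494970582573222016517237184373393126170381106312321044608650157213179444535336954329345488316536483641027585852519428948946161923566252700147433943926434077996138508547832126059769898770651985617135343245353710821486902603043522083152450587653945424451319475125198943350619100136279888698020232379064866870670291629296267830911860963855146162269100470235009247847445385570437620166354373229014012593356527889641552510935601442011318872201433341493632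

theorem adj_of_fourMat : ∀ x < 39, ∀ y < 39, fourMat.testBit (39 * x + y) = true →
    Adj (MatAdj smallMat 36 35) 31 4 x y := by
  decide +kernel

/-- Paths in the vertex-deleted subgraphs of the graph `fourMat`. -/
def fourDeletions : List (List ℕ) :=
  [[1, 15, 16, 17, 18, 8, 5, 4, 7, 32, 13, 3, 2, 6, 20, 19, 21, 22, 25, 28, 30, 23, 24, 26, 29,
  27, 14, 12, 9, 10, 11, 38, 37, 35, 36, 34, 33, 31], [0, 7, 4, 3, 2, 6, 5, 8, 18, 20, 19, 21, 17,
  16, 15, 37, 28, 25, 22, 23, 30, 11, 38, 12, 9, 10, 24, 26, 29, 27, 14, 13, 32, 34, 36, 35, 33,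
  31], [1, 15, 16, 17, 18, 8, 0, 7, 32, 13, 3, 4, 5, 6, 20, 19, 21, 22, 25, 28, 30, 23, 24, 26,
  29, 27, 14, 12, 9, 10, 11, 38, 37, 35, 36, 34, 33, 31], [1, 15, 16, 17, 21, 19, 20, 18, 8, 0, 7,
  4, 5, 6, 2, 27, 14, 13, 32, 34, 36, 38, 12, 9, 29, 26, 24, 10, 11, 30, 23, 22, 25, 28, 37, 35,
  33, 31], [1, 15, 16, 17, 18, 20, 19, 21, 22, 25, 28, 37, 35, 33, 34, 36, 38, 11, 30, 23, 24, 10,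
  9, 12, 14, 13, 3, 2, 27, 29, 26, 6, 5, 8, 0, 7, 32, 31], [1, 15, 16, 17, 18, 8, 0, 7, 4, 3, 2,
  6, 20, 19, 21, 22, 25, 28, 37, 35, 33, 34, 36, 38, 12, 9, 10, 11, 30, 23, 24, 26, 29, 27, 14,
  13, 32, 31], [1, 15, 16, 17, 18, 20, 19, 21, 22, 25, 28, 30, 23, 24, 26, 29, 27, 2, 3, 4, 5, 8,
  0, 7, 32, 13, 14, 12, 9, 10, 11, 38, 37, 35, 36, 34, 33, 31], [0, 8, 5, 4, 3, 2, 6, 20, 18, 1,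
  15, 16, 17, 21, 19, 24, 26, 29, 27, 14, 13, 32, 34, 36, 38, 12, 9, 10, 11, 30, 23, 22, 25, 28,
  37, 35, 33, 31], [0, 7, 4, 5, 6, 2, 3, 13, 14, 27, 29, 26, 24, 19, 20, 18, 17, 21, 22, 23, 30,
  11, 10, 9, 12, 38, 36, 34, 32, 31, 33, 35, 37, 28, 25, 16, 15, 1], [1, 15, 16, 17, 21, 19, 20,
  18, 8, 0, 7, 4, 5, 6, 2, 3, 13, 32, 34, 36, 38, 12, 14, 27, 29, 26, 24, 10, 11, 30, 23, 22, 25,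
  28, 37, 35, 33, 31], [1, 15, 16, 17, 18, 8, 0, 7, 4, 5, 6, 20, 19, 21, 22, 25, 28, 37, 35, 33,
  34, 36, 38, 11, 30, 23, 24, 26, 29, 9, 12, 14, 27, 2, 3, 13, 32, 31], [1, 15, 37, 28, 30, 23,
  22, 25, 16, 17, 21, 19, 20, 18, 8, 0, 7, 4, 5, 6, 2, 3, 13, 14, 27, 29, 26, 24, 10, 9, 12, 38,
  36, 35, 33, 34, 32, 31], [1, 15, 16, 17, 18, 8, 0, 7, 32, 13, 14, 27, 2, 3, 4, 5, 6, 20, 19, 21,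
  22, 25, 28, 30, 23, 24, 26, 29, 9, 10, 11, 38, 37, 35, 36, 34, 33, 31], [1, 15, 16, 17, 18, 20,
  6, 26, 29, 9, 10, 11, 30, 23, 24, 19, 21, 22, 25, 28, 37, 35, 33, 34, 36, 38, 12, 14, 27, 2, 3,
  4, 5, 8, 0, 7, 32, 31], [1, 15, 16, 17, 18, 8, 0, 7, 4, 5, 6, 20, 19, 21, 22, 25, 28, 37, 35,
  33, 34, 36, 38, 12, 9, 10, 11, 30, 23, 24, 26, 29, 27, 2, 3, 13, 32, 31], [1, 18, 8, 0, 7, 4, 5,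
  6, 20, 19, 21, 17, 16, 25, 22, 23, 24, 26, 29, 9, 10, 11, 30, 28, 37, 35, 33, 34, 36, 38, 12,
  14, 27, 2, 3, 13, 32, 31], [0, 7, 4, 5, 8, 18, 17, 21, 19, 20, 6, 2, 3, 13, 14, 27, 29, 26, 24,
  23, 22, 25, 28, 30, 11, 10, 9, 12, 38, 36, 34, 32, 31, 33, 35, 37, 15, 1], [1, 15, 16, 25, 22,
  21, 19, 20, 18, 8, 0, 7, 4, 5, 6, 2, 3, 13, 32, 34, 36, 38, 11, 10, 9, 12, 14, 27, 29, 26, 24,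
  23, 30, 28, 37, 35, 33, 31], [1, 15, 16, 17, 21, 19, 20, 6, 2, 3, 4, 5, 8, 0, 7, 32, 13, 14, 27,
  29, 26, 24, 10, 9, 12, 38, 11, 30, 23, 22, 25, 28, 37, 35, 36, 34, 33, 31], [1, 15, 16, 17, 21,
  22, 25, 28, 30, 23, 24, 26, 29, 27, 2, 3, 4, 5, 6, 20, 18, 8, 0, 7, 32, 13, 14, 12, 9, 10, 11,
  38, 37, 35, 36, 34, 33, 31], [1, 15, 16, 17, 18, 8, 0, 7, 4, 5, 6, 26, 29, 9, 10, 11, 30, 23,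
  24, 19, 21, 22, 25, 28, 37, 35, 33, 34, 36, 38, 12, 14, 27, 2, 3, 13, 32, 31], [1, 15, 16, 17,
  18, 8, 0, 7, 4, 5, 6, 20, 19, 24, 26, 29, 9, 10, 11, 30, 23, 22, 25, 28, 37, 35, 33, 34, 36, 38,
  12, 14, 27, 2, 3, 13, 32, 31], [1, 15, 16, 25, 28, 30, 23, 24, 19, 21, 17, 18, 20, 6, 26, 29,
  27, 2, 3, 4, 5, 8, 0, 7, 32, 13, 14, 12, 9, 10, 11, 38, 37, 35, 36, 34, 33, 31], [1, 15, 16, 17,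
  18, 8, 0, 7, 4, 5, 6, 20, 19, 21, 22, 25, 28, 30, 11, 10, 24, 26, 29, 9, 12, 14, 27, 2, 3, 13,
  32, 34, 36, 38, 37, 35, 33, 31], [1, 15, 16, 17, 21, 19, 20, 18, 8, 0, 7, 4, 5, 6, 26, 29, 9,
  10, 11, 30, 23, 22, 25, 28, 37, 35, 33, 34, 36, 38, 12, 14, 27, 2, 3, 13, 32, 31], [1, 15, 16,
  17, 18, 8, 0, 7, 4, 5, 6, 20, 19, 21, 22, 23, 24, 26, 29, 9, 10, 11, 30, 28, 37, 35, 33, 34, 36,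
  38, 12, 14, 27, 2, 3, 13, 32, 31], [1, 15, 16, 17, 18, 8, 0, 7, 32, 13, 14, 12, 9, 29, 27, 2, 3,
  4, 5, 6, 20, 19, 21, 22, 25, 28, 30, 23, 24, 10, 11, 38, 37, 35, 36, 34, 33, 31], [1, 15, 16,
  17, 21, 19, 20, 18, 8, 0, 7, 4, 5, 6, 2, 3, 13, 14, 12, 9, 29, 26, 24, 10, 11, 30, 23, 22, 25,
  28, 37, 38, 36, 35, 33, 34, 32, 31], [1, 18, 17, 21, 19, 20, 6, 2, 3, 4, 5, 8, 0, 7, 32, 13, 14,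
  27, 29, 26, 24, 10, 9, 12, 38, 11, 30, 23, 22, 25, 16, 15, 37, 35, 36, 34, 33, 31], [1, 15, 16,
  17, 18, 20, 19, 21, 22, 25, 28, 37, 35, 33, 34, 36, 38, 12, 9, 10, 11, 30, 23, 24, 26, 6, 2, 27,
  14, 13, 3, 4, 5, 8, 0, 7, 32, 31], [1, 15, 16, 17, 21, 19, 20, 18, 8, 0, 7, 4, 5, 6, 2, 3, 13,
  32, 34, 36, 38, 11, 10, 9, 12, 14, 27, 29, 26, 24, 23, 22, 25, 28, 37, 35, 33, 31], [0, 7, 4, 3,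
  2, 6, 5, 8, 18, 20, 19, 21, 17, 16, 25, 22, 23, 24, 26, 29, 27, 14, 13, 32, 34, 33, 35, 36, 38,
  12, 9, 10, 11, 30, 28, 37, 15, 1], [1, 15, 16, 17, 18, 8, 0, 7, 4, 5, 6, 20, 19, 21, 22, 25, 28,
  30, 23, 24, 26, 29, 27, 2, 3, 13, 14, 12, 9, 10, 11, 38, 37, 35, 36, 34, 33, 31], [1, 15, 16,
  17, 18, 8, 0, 7, 4, 5, 6, 20, 19, 21, 22, 25, 28, 30, 23, 24, 26, 29, 27, 2, 3, 13, 14, 12, 9,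
  10, 11, 38, 37, 35, 36, 34, 32, 31], [1, 15, 16, 17, 18, 8, 0, 7, 32, 13, 14, 12, 9, 10, 11, 30,
  23, 24, 26, 29, 27, 2, 3, 4, 5, 6, 20, 19, 21, 22, 25, 28, 37, 38, 36, 35, 33, 31], [1, 15, 16,
  17, 18, 8, 0, 7, 32, 13, 14, 12, 9, 10, 11, 30, 23, 24, 26, 29, 27, 2, 3, 4, 5, 6, 20, 19, 21,
  22, 25, 28, 37, 38, 36, 34, 33, 31], [1, 15, 16, 17, 18, 8, 0, 7, 4, 5, 6, 20, 19, 21, 22, 25,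
  28, 30, 23, 24, 26, 29, 27, 2, 3, 13, 14, 12, 9, 10, 11, 38, 37, 35, 33, 34, 32, 31], [1, 15,
  16, 17, 18, 8, 0, 7, 4, 5, 6, 20, 19, 21, 22, 25, 28, 30, 23, 24, 26, 29, 9, 10, 11, 38, 12, 14,
  27, 2, 3, 13, 32, 34, 36, 35, 33, 31], [1, 15, 16, 17, 18, 8, 0, 7, 32, 13, 14, 12, 9, 10, 11,
  30, 23, 24, 26, 29, 27, 2, 3, 4, 5, 6, 20, 19, 21, 22, 25, 28, 37, 35, 36, 34, 33, 31]]

theorem deletions_four : deletions fourMat 39 39 (fun l => endsOK 1 31 l &&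
    decide (Hits 31 l 0 ∧ Hits 31 l 2)) 0 fourDeletions = true := by
  decide +kernel

theorem exists_del_four (v : ℕ) (hv : v < 31 + 8) : ∃ l s t,
    SpanPath (Adj (MatAdj smallMat 36 35) 31 4) ({x | x < 31 + 8} \ {v}) l ∧ FromTo l s t ∧
      (s = 1 ∧ t = 31 ∨ s = 0 ∧ t = 1 ∨ s = 0 ∧ t = 31) ∧ Hits 31 l 0 ∧ Hits 31 l 2 := by
  obtain ⟨l, h1, h2, h3⟩ := deletions_sound 0 fourDeletions deletions_four v (Nat.zero_le _) hv
  rw [Bool.and_eq_true, decide_eq_true_iff] at h2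
  have h4 := spanPath_of_bits (N := 39) (fun x hx => hx.1) adj_of_fourMat h1
  rcases endsOK_sound h3 h2.1 with h | h | h
  · exact ⟨l, _, _, h4, h, by simp, h2.2⟩
  · exact ⟨l, _, _, h4, h, by simp, h2.2⟩
  · exact ⟨l, _, _, h4, h, by simp, h2.2⟩

theorem exists_span_four_one : ∃ l t, SpanPath (Adj (MatAdj smallMat 36 35) 31 4)
    {x | x < 31 + 8} l ∧ FromTo l 1 t ∧ Hits 31 l 0 := by
  obtain ⟨t, ht⟩ := exists_fromTo (s := 1) (l :=
    [1, 15, 16, 17, 18, 8, 0, 7, 4, 5, 6, 2, 3, 13, 14, 27, 29, 26, 24, 23, 30, 11, 10, 9, 12,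
    38, 36, 34, 32, 31, 33, 35, 37, 28, 25, 22, 21, 19, 20]) rfl
  exact ⟨_, t, spanPath_of_bits (N := 39) (fun x hx => hx) adj_of_fourMat
    (isSpan_sound_full (by decide +kernel)), ht, by decide +kernel⟩

theorem exists_span_four_last : ∃ l t, SpanPath (Adj (MatAdj smallMat 36 35) 31 4)
    {x | x < 31 + 8} l ∧ FromTo l 31 t ∧ Hits 31 l 0 := by
  obtain ⟨t, ht⟩ := exists_fromTo (s := 31) (l :=
    [31, 32, 7, 0, 8, 5, 4, 3, 13, 14, 12, 9, 10, 11, 38, 36, 34, 33, 35, 37, 15, 1, 18, 17, 16,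
    25, 22, 21, 19, 20, 6, 2, 27, 29, 26, 24, 23, 30, 28]) rfl
  exact ⟨_, t, spanPath_of_bits (N := 39) (fun x hx => hx) adj_of_fourMat
    (isSpan_sound_full (by decide +kernel)), ht, by decide +kernel⟩

theorem matAdj_of_adj_two : ∀ x < 35, ∀ y < 35, Adj (MatAdj smallMat 36 35) 31 2 x y →
    MatAdj smallMat 36 35 x y := by
  decide +kernel

theorem not_span_two (l : List ℕ) (s t : ℕ)
    (hl : SpanPath (Adj (MatAdj smallMat 36 35) 31 2) {x | x < 31 + 4} l) (hf : FromTo l s t)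
    (hs : s = 0 ∨ s = 1 ∨ s = 31) (ht : t = 0 ∨ t = 1 ∨ t = 31) : False :=
  not_span_small l s t ⟨hl.chain.imp fun x y h => matAdj_of_adj_two x (h.lt (by omega)) y
    (Adj.lt (by omega) y x h.symm) h, hl.nodup, hl.mem⟩ hf hs ht

/-- The piece with a ladder of `4 + 2 k` rungs. -/
theorem isPiece (k : ℕ) :
    IsPiece (Adj (MatAdj smallMat 36 35) 31 (4 + 2 * k)) (31 + 2 * (4 + 2 * k)) 1 31 where
  symm := Adj.symm
  lt := Adj.lt (by omega)
  irrefl := Adj.irrefl (by omega) isPiece_small.irrefl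
  b_pos := by omega
  b_lt := by omega
  c_pos := by omega
  c_lt := by omega
  not_span := fun l s t hl hf hs ht => by
    refine not_span_of_two (F := fun s => s = 0 ∨ s = 1 ∨ s = 31) (by omega) not_span_two (k + 1)
      l s t ?_ hf hs ht
    have e : 2 + 2 * (k + 1) = 4 + 2 * k := by omega
    rwa [e]
  exists_del := fun v hv => by
    obtain ⟨l, s, t, h1, h2, h3, -⟩ := exists_del_of_four (adj := MatAdj smallMat 36 35) (m := 31)
      (fun s t => s = 1 ∧ t = 31 ∨ s = 0 ∧ t = 1 ∨ s = 0 ∧ t = 31) (by omega) exists_del_four k v hv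
    refine ⟨l, h1, ?_⟩
    rcases h3 with ⟨rfl, rfl⟩ | ⟨rfl, rfl⟩ | ⟨rfl, rfl⟩
    · exact Or.inl h2
    · exact Or.inr (Or.inl h2)
    · exact Or.inr (Or.inr h2)
  exists_span_b := by
    obtain ⟨l, t, h1, h2, -⟩ := exists_span_of_four (by omega) exists_span_four_one k
    exact ⟨l, t, h1, h2⟩
  exists_span_c := by
    obtain ⟨l, t, h1, h2, -⟩ := exists_span_of_four (by omega) exists_span_four_last k
    exact ⟨l, t, h1, h2⟩

end Ladder

/-! ### From lists to Hamiltonian paths -/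

theorem isTraceable_of_spanPath {V : Type*} [DecidableEq V] {G : SimpleGraph V}
    {R : ℕ → ℕ → Prop} {f : V → ℕ} (hf : Function.Injective f)
    (hR : ∀ u v, R (f u) (f v) → G.Adj u v) [Nonempty V] {l : List ℕ} (hl : SpanPath R (Set.range f) l) : G.IsTraceable := by
  have hmem : l ∈ Set.range (List.map f) := by
    rw [Set.range_list_map]
    exact fun x hx => (hl.mem x).1 hx
  obtain ⟨l', rfl⟩ := hmem
  have hn := hl.nodup.of_map f
  have hc : l'.IsChain G.Adj := (List.isChain_of_isChain_map f hR hl.chain)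
  have hm : ∀ v, v ∈ l' := fun v => (List.mem_map_of_injective hf).1 ((hl.mem _).2 ⟨v, rfl⟩)
  have hne : l' ≠ [] := List.ne_nil_of_mem (hm (Classical.arbitrary V))
  refine ⟨_, _, SimpleGraph.Walk.ofSupport l' hne hc,
    SimpleGraph.Walk.IsPath.isHamiltonian_of_mem ?_ fun v => ?_⟩
  · rw [SimpleGraph.Walk.isPath_def, SimpleGraph.Walk.support_ofSupport]
    exact hn
  · rw [SimpleGraph.Walk.support_ofSupport]
    exact hm v

theorem exists_spanPath_of_isTraceable {V : Type*} [DecidableEq V] {G : SimpleGraph V}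
    {R : ℕ → ℕ → Prop} {f : V → ℕ} (hf : Function.Injective f)
    (hR : ∀ u v, G.Adj u v → R (f u) (f v)) (h : G.IsTraceable) :
    ∃ l, SpanPath R (Set.range f) l := by
  obtain ⟨a, b, p, hp⟩ := h
  refine ⟨p.support.map f, (List.isChain_map f).2 (p.isChain_adj_support.imp hR),
    hp.isPath.support_nodup.map hf, fun x => ?_⟩
  simp [hp.mem_support]

/-- The graph on `{0, …, T - 1}` with adjacency `R`. -/
def natGraph (R : ℕ → ℕ → Prop) (hsymm : ∀ x y, R x y → R y x) (hirr : ∀ x, ¬ R x x) (T : ℕ) :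
    SimpleGraph (Fin T) where
  Adj u v := R u v
  symm := ⟨fun u v => hsymm u v⟩
  loopless := ⟨fun u => hirr u⟩

theorem isHypotraceable_natGraph {R : ℕ → ℕ → Prop} (hsymm : ∀ x y, R x y → R y x)
    (hirr : ∀ x, ¬ R x x) {T : ℕ} (hT : 2 ≤ T) (hno : ∀ l, ¬ SpanPath R {x | x < T} l)
    (hdel : ∀ v < T, ∃ l, SpanPath R ({x | x < T} \ {v}) l) :
    (natGraph R hsymm hirr T).IsHypotraceable := by
  refine ⟨fun h => ?_, fun v => ?_⟩
  · obtain ⟨l, hl⟩ := exists_spanPath_of_isTraceable (R := R) Fin.val_injective (fun _ _ h => h) h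
    refine hno l (hl.congr fun x => ?_)
    simp [Fin.range_val]
  · obtain ⟨l, hl⟩ := hdel v v.2
    have : Nonempty ↑{w : Fin T | w ≠ v} := by
      by_cases h : v.1 = 0
      · exact ⟨⟨⟨1, by omega⟩, fun e => by rw [← e] at h; simp at h⟩⟩
      · exact ⟨⟨⟨0, by omega⟩, fun e => by rw [← e] at h; simp at h⟩⟩
    refine isTraceable_of_spanPath (R := R) (f := fun w => w.1.1)
      (fun _ _ h => Subtype.ext (Fin.ext h)) (fun _ _ h => h)
      (hl.congr fun x => ?_)
    simp only [Set.mem_sdiff, Set.mem_ofPred_eq, Set.mem_singleton_iff, Set.mem_range]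
    constructor
    · rintro ⟨h1, h2⟩
      exact ⟨⟨⟨x, h1⟩, fun e => h2 (congrArg Fin.val e)⟩, rfl⟩
    · rintro ⟨⟨w, hw⟩, rfl⟩
      exact ⟨w.2, fun e => hw (Fin.ext e)⟩

/-! ### Gluing four pieces -/

section Glue

variable (R : Bool → Bool → ℕ → ℕ → Prop) (N b c off : Bool → Bool → ℕ)

/-- The label of the vertex `x` of the piece `(i, j)` in the glued graph. -/
def glueLabel (i j : Bool) (x : ℕ) : ℕ := if x = 0 then i.toNat else off i j + x

/-- The graph glued from four pieces. -/
def Glue (x y : ℕ) : Prop :=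
  (∃ i j u v, R i j u v ∧ x = glueLabel off i j u ∧ y = glueLabel off i j v) ∨
  (∃ i j, x = glueLabel off i j (b i j) ∧ y = glueLabel off (!i) j (b (!i) j)) ∨
  ∃ i j, x = glueLabel off i j (c i j) ∧ y = glueLabel off (!i) j (c (!i) j)

/-- The non-shared labels of the piece `(i, j)`. -/
def glueSet (i j : Bool) : Set ℕ := {y | off i j < y ∧ y < off i j + N i j}

variable {R N b c off}

theorem glueLabel_zero (i j : Bool) : glueLabel off i j 0 = i.toNat := rfl

theorem glueLabel_pos {i j : Bool} {x : ℕ} (hx : 0 < x) : glueLabel off i j x = off i j + x :=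
  if_neg (by omega)

/-- The labels of different pieces do not overlap. -/
structure IsLayout (N off : Bool → Bool → ℕ) : Prop where
  pos : ∀ i j, 1 ≤ off i j
  disj : ∀ {i j i' j' x}, x ∈ glueSet N off i j → x ∈ glueSet N off i' j' → i = i' ∧ j = j'

theorem IsLayout.notMem (h : IsLayout N off) (i i' j' : Bool) : i.toNat ∉ glueSet N off i' j' := by
  rintro ⟨h1, -⟩
  have := h.pos i' j'
  have := i.toNat_le
  omega

theorem glueLabel_mem {i j : Bool} {x : ℕ} (hx : 0 < x) (hxN : x < N i j) :
    glueLabel off i j x ∈ glueSet N off i j := by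
  rw [glueLabel_pos hx]
  exact ⟨by omega, by omega⟩

theorem mem_insert_glueSet {i j : Bool} {y : ℕ} (hN : 0 < N i j) :
    y ∈ insert i.toNat (glueSet N off i j) ↔ ∃ x < N i j, glueLabel off i j x = y := by
  constructor
  · rintro (rfl | ⟨h1, h2⟩)
    · exact ⟨0, hN, rfl⟩
    · exact ⟨y - off i j, by omega, by rw [glueLabel_pos (by omega)]; omega⟩
  · rintro ⟨x, hx, rfl⟩
    rcases Nat.eq_zero_or_pos x with rfl | h
    · exact Or.inl rfl
    · exact Or.inr (glueLabel_mem h hx)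

theorem IsLayout.glueLabel_injOn (h : IsLayout N off) {i j : Bool} {x y : ℕ}
    (e : glueLabel off i j x = glueLabel off i j y) : x = y := by
  have := h.pos i j
  unfold glueLabel at e
  have := i.toNat_le
  split_ifs at e <;> omega

/-- A positive label determines its piece. -/
theorem IsLayout.eq_of_glueLabel (h : IsLayout N off) {i j i' j' : Bool} {x x' : ℕ}
    (hx : 0 < x) (hxN : x < N i j) (hx' : x' < N i' j')
    (e : glueLabel off i j x = glueLabel off i' j' x') : i = i' ∧ j = j' := by
  have h1 := glueLabel_mem (off := off) hx hxN
  rcases Nat.eq_zero_or_pos x' with rfl | hp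
  · rw [e] at h1
    exact (h.notMem i' i j h1).elim
  · exact h.disj h1 (e ▸ glueLabel_mem hp hx')

theorem glue_symm (hp : ∀ i j, IsPiece (R i j) (N i j) (b i j) (c i j)) (x y : ℕ)
    (h : Glue R b c off x y) : Glue R b c off y x := by
  rcases h with ⟨i, j, u, v, h, rfl, rfl⟩ | ⟨i, j, rfl, rfl⟩ | ⟨i, j, rfl, rfl⟩
  · exact Or.inl ⟨i, j, v, u, (hp i j).symm _ _ h, rfl, rfl⟩
  · exact Or.inr (Or.inl ⟨!i, j, rfl, by rw [Bool.not_not]⟩)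
  · exact Or.inr (Or.inr ⟨!i, j, rfl, by rw [Bool.not_not]⟩)

/-- Inside a piece, the glued graph coincides with the piece. -/
theorem glue_glueLabel (hp : ∀ i j, IsPiece (R i j) (N i j) (b i j) (c i j)) (hl : IsLayout N off)
    {i j : Bool} {u v : ℕ} (hu : u < N i j) (hv : v < N i j)
    (h : Glue R b c off (glueLabel off i j u) (glueLabel off i j v)) : R i j u v := by
  have link : ∀ d : Bool → Bool → ℕ, (∀ i j, 0 < d i j) → (∀ i j, d i j < N i j) → ∀ i' j',
      glueLabel off i j u = glueLabel off i' j' (d i' j') →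
      glueLabel off i j v = glueLabel off (!i') j' (d (!i') j') → False := by
    intro d h0 hN i' j' e1 e2
    have a1 := hl.eq_of_glueLabel (h0 i' j') (hN i' j') hu e1.symm
    have a2 := hl.eq_of_glueLabel (h0 (!i') j') (hN (!i') j') hv e2.symm
    have := a1.1.trans a2.1.symm
    simp at this
  rcases h with ⟨i', j', u', v', h, e1, e2⟩ | ⟨i', j', e1, e2⟩ | ⟨i', j', e1, e2⟩
  · have hu' := (hp i' j').lt _ _ h
    have hv' := (hp i' j').lt _ _ ((hp i' j').symm _ _ h)
    have : i' = i ∧ j' = j := by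
      rcases Nat.eq_zero_or_pos u' with rfl | h0
      · rcases Nat.eq_zero_or_pos v' with rfl | h1
        · exact ((hp i' j').irrefl _ h).elim
        · exact hl.eq_of_glueLabel h1 hv' hv e2.symm
      · exact hl.eq_of_glueLabel h0 hu' hu e1.symm
    obtain ⟨rfl, rfl⟩ := this
    rwa [hl.glueLabel_injOn e1, hl.glueLabel_injOn e2]
  · exact (link b (fun i j => (hp i j).b_pos) (fun i j => (hp i j).b_lt) i' j' e1 e2).elim
  · exact (link c (fun i j => (hp i j).c_pos) (fun i j => (hp i j).c_lt) i' j' e1 e2).elim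

theorem glue_irrefl (hp : ∀ i j, IsPiece (R i j) (N i j) (b i j) (c i j)) (hl : IsLayout N off)
    (x : ℕ) : ¬ Glue R b c off x x := by
  rintro (⟨i, j, u, v, h, rfl, e⟩ | ⟨i, j, rfl, e⟩ | ⟨i, j, rfl, e⟩)
  · exact (hp i j).irrefl u (by rwa [← hl.glueLabel_injOn e] at h)
  · have := hl.eq_of_glueLabel (hp i j).b_pos (hp i j).b_lt (hp (!i) j).b_lt e
    simp at this
  · have := hl.eq_of_glueLabel (hp i j).c_pos (hp i j).c_lt (hp (!i) j).c_lt e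
    simp at this

theorem FromTo.map {α β : Type*} (f : α → β) {l : List α} {s t : α} (h : FromTo l s t) :
    FromTo (l.map f) (f s) (f t) := by
  simp [FromTo, h.1, h.2]

theorem SpanPath.map {α β : Type*} {R : α → α → Prop} {R' : β → β → Prop} (f : α → β)
    (hf : Function.Injective f) (hR : ∀ x y, R x y → R' (f x) (f y)) {S : Set α} {S' : Set β}
    (hS : ∀ y, y ∈ S' ↔ ∃ x ∈ S, f x = y) {l : List α} (h : SpanPath R S l) :
    SpanPath R' S' (l.map f) :=
  ⟨(List.isChain_map f).2 (h.chain.imp hR), h.nodup.map hf, fun y => by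
    simp only [List.mem_map, h.mem, hS]⟩

theorem glue_assembly (hp : ∀ i j, IsPiece (R i j) (N i j) (b i j) (c i j))
    (hl : IsLayout N off) :
    Assembly (Glue R b c off) (glueSet N off) Bool.toNat
      (fun i j => glueLabel off i j (b i j)) (fun i j => glueLabel off i j (c i j)) where
  symm := glue_symm hp
  disj := hl.disj
  notMem := hl.notMem
  A_ne := by simp
  B_mem := fun i j => glueLabel_mem (hp i j).b_pos (hp i j).b_lt
  C_mem := fun i j => glueLabel_mem (hp i j).c_pos (hp i j).c_lt
  adj_B := fun i j => Or.inr (Or.inl ⟨i, j, rfl, rfl⟩)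
  adj_C := fun i j => Or.inr (Or.inr ⟨i, j, rfl, rfl⟩)
  adj_S := by
    rintro i j x y (⟨i', j', u, v, h, rfl, rfl⟩ | ⟨i', j', rfl, rfl⟩ | ⟨i', j', rfl, rfl⟩) hx
    · have hu := (hp i' j').lt _ _ h
      have hv := (hp i' j').lt _ _ ((hp i' j').symm _ _ h)
      rcases Nat.eq_zero_or_pos u with rfl | h0
      · exact (hl.notMem i' i j hx).elim
      · obtain ⟨rfl, rfl⟩ := hl.disj hx (glueLabel_mem h0 hu)
        rcases Nat.eq_zero_or_pos v with rfl | h1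
        · exact Or.inr (Or.inl rfl)
        · exact Or.inl (glueLabel_mem h1 hv)
    · obtain ⟨rfl, rfl⟩ := hl.disj hx (glueLabel_mem (hp i' j').b_pos (hp i' j').b_lt)
      exact Or.inr (Or.inr (Or.inl ⟨rfl, rfl⟩))
    · obtain ⟨rfl, rfl⟩ := hl.disj hx (glueLabel_mem (hp i' j').c_pos (hp i' j').c_lt)
      exact Or.inr (Or.inr (Or.inr ⟨rfl, rfl⟩))
  adj_A := by
    rintro i y (⟨i', j', u, v, h, e, rfl⟩ | ⟨i', j', e, rfl⟩ | ⟨i', j', e, rfl⟩)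
    · have hu := (hp i' j').lt _ _ h
      have hv := (hp i' j').lt _ _ ((hp i' j').symm _ _ h)
      rcases Nat.eq_zero_or_pos u with rfl | h0
      · obtain rfl : i = i' := by cases i <;> cases i' <;> simp_all [glueLabel]
        rcases Nat.eq_zero_or_pos v with rfl | h1
        · exact ((hp i j').irrefl _ h).elim
        · exact ⟨j', glueLabel_mem h1 hv⟩
      · exact (hl.notMem i i' j' (e ▸ glueLabel_mem h0 hu)).elim
    · exact (hl.notMem i i' j' (e ▸ glueLabel_mem (hp i' j').b_pos (hp i' j').b_lt)).elim
    · exact (hl.notMem i i' j' (e ▸ glueLabel_mem (hp i' j').c_pos (hp i' j').c_lt)).elim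
  not_span := by
    intro i j l s t hs hf h1 h2
    have hN : 0 < N i j := (hp i j).b_pos.trans (hp i j).b_lt
    have hmem : l ∈ Set.range (List.map (glueLabel off i j)) := by
      rw [Set.range_list_map]
      intro x hx
      obtain ⟨y, -, h⟩ := (mem_insert_glueSet hN).1 ((hs.mem x).1 hx)
      exact ⟨y, h⟩
    obtain ⟨l, rfl⟩ := hmem
    have hm : ∀ x, x ∈ l ↔ x < N i j := by
      intro x
      have := hs.mem (glueLabel off i j x)
      rw [mem_insert_glueSet hN, List.mem_map] at this
      constructor
      · intro hx
        obtain ⟨y, hy, e⟩ := this.1 ⟨x, hx, rfl⟩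
        exact hl.glueLabel_injOn e ▸ hy
      · intro hx
        obtain ⟨y, hy, e⟩ := this.2 ⟨x, hx, rfl⟩
        exact hl.glueLabel_injOn e ▸ hy
    have hs' : SpanPath (R i j) {x | x < N i j} l := by
      refine ⟨?_, hs.nodup.of_map _, hm⟩
      have hc := hs.chain
      rw [List.isChain_map, List.isChain_iff_forall_rel_of_append_cons_cons] at hc
      rw [List.isChain_iff_forall_rel_of_append_cons_cons]
      intro x y p q e
      exact glue_glueLabel hp hl ((hm x).1 (by simp [e])) ((hm y).1 (by simp [e])) (hc e)
    obtain ⟨hf1, hf2⟩ := hf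
    rw [List.head?_map, Option.map_eq_some_iff] at hf1
    rw [List.getLast?_map, Option.map_eq_some_iff] at hf2
    obtain ⟨s, hf1, rfl⟩ := hf1
    obtain ⟨t, hf2, rfl⟩ := hf2
    exact (hp i j).not_span l s t hs' ⟨hf1, hf2⟩
      (h1.imp (fun e => hl.glueLabel_injOn (e.trans (glueLabel_zero i j).symm))
        (Or.imp hl.glueLabel_injOn hl.glueLabel_injOn))
      (h2.imp (fun e => hl.glueLabel_injOn (e.trans (glueLabel_zero i j).symm))
        (Or.imp hl.glueLabel_injOn hl.glueLabel_injOn))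
  exists_del := by
    intro i j v hv
    have hN : 0 < N i j := (hp i j).b_pos.trans (hp i j).b_lt
    obtain ⟨v, hvN, rfl⟩ := (mem_insert_glueSet hN).1 hv
    obtain ⟨l, h1, h2⟩ := (hp i j).exists_del v hvN
    refine ⟨l.map (glueLabel off i j), h1.map _ (fun _ _ => hl.glueLabel_injOn)
      (fun x y h => Or.inl ⟨i, j, x, y, h, rfl, rfl⟩) (fun y => ?_),
      h2.imp (FromTo.map _) (Or.imp (FromTo.map _) (FromTo.map _))⟩
    rw [Set.mem_sdiff, mem_insert_glueSet hN]
    constructor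
    · rintro ⟨⟨x, hx, rfl⟩, h⟩
      exact ⟨x, ⟨hx, fun e => h (congrArg _ e)⟩, rfl⟩
    · rintro ⟨x, ⟨hx, h⟩, rfl⟩
      exact ⟨⟨x, hx, rfl⟩, fun e => h (hl.glueLabel_injOn e)⟩
  exists_span_B := by
    intro i j
    obtain ⟨l, t, h1, h2⟩ := (hp i j).exists_span_b
    exact ⟨_, _, h1.map _ (fun _ _ => hl.glueLabel_injOn)
      (fun x y h => Or.inl ⟨i, j, x, y, h, rfl, rfl⟩)
      (fun y => mem_insert_glueSet ((hp i j).b_pos.trans (hp i j).b_lt)), h2.map _⟩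
  exists_span_C := by
    intro i j
    obtain ⟨l, t, h1, h2⟩ := (hp i j).exists_span_c
    exact ⟨_, _, h1.map _ (fun _ _ => hl.glueLabel_injOn)
      (fun x y h => Or.inl ⟨i, j, x, y, h, rfl, rfl⟩)
      (fun y => mem_insert_glueSet ((hp i j).b_pos.trans (hp i j).b_lt)), h2.map _⟩

/-- A graph glued from four pieces is hypotraceable. -/
theorem isHypotraceable_glue (hp : ∀ i j, IsPiece (R i j) (N i j) (b i j) (c i j))
    (hl : IsLayout N off) {T : ℕ} (hT : 2 ≤ T)
    (hc : ∀ x, x ∈ Assembly.carrier (glueSet N off) Bool.toNat ↔ x < T) :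
    (natGraph (Glue R b c off) (glue_symm hp) (glue_irrefl hp hl) T).IsHypotraceable := by
  refine isHypotraceable_natGraph _ _ hT (fun l h => ?_) fun v hv => ?_
  · exact (glue_assembly hp hl).not_spanPath l (h.congr fun x => (hc x).symm)
  · obtain ⟨l, h⟩ := (glue_assembly hp hl).exists_spanPath_del ((hc v).2 hv)
    exact ⟨l, h.congr fun x => and_congr_left' (hc x)⟩

end Glue

/-! ### Straight-line drawings -/

/-- A linear functional separates the ends of the edge `u v` from those of the edge `u' v'`, except
for common ends. -/
def EdgeSep (X Y : ℕ → ℤ) (u v u' v' : ℕ) : Prop :=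
  ∃ α β : ℤ, ∀ e f, (e = u ∨ e = v) → (f = u' ∨ f = v') →
    e = f ∨ α * X e + β * Y e < α * X f + β * Y f

namespace EdgeSep

variable {X Y : ℕ → ℤ} {u v u' v' : ℕ}

theorem swap_left (h : EdgeSep X Y u v u' v') : EdgeSep X Y v u u' v' := by
  obtain ⟨α, β, h⟩ := h
  exact ⟨α, β, fun e f he hf => h e f he.symm hf⟩

theorem swap_right (h : EdgeSep X Y u v u' v') : EdgeSep X Y u v v' u' := by
  obtain ⟨α, β, h⟩ := h
  exact ⟨α, β, fun e f he hf => h e f he hf.symm⟩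

theorem symm (h : EdgeSep X Y u v u' v') : EdgeSep X Y u' v' u v := by
  obtain ⟨α, β, h⟩ := h
  refine ⟨-α, -β, fun e f he hf => (h f e hf he).imp Eq.symm fun h => ?_⟩
  linarith

/-- The point with integer coordinates `X w`, `Y w`. -/
noncomputable def pt (X Y : ℕ → ℤ) (w : ℕ) : EuclideanSpace ℝ (Fin 2) := !₂[(X w : ℝ), (Y w : ℝ)]

/-- The functional with coefficients `α`, `β`. -/
noncomputable def func (α β : ℤ) : EuclideanSpace ℝ (Fin 2) →ₗ[ℝ] ℝ :=
  (α : ℝ) • (EuclideanSpace.proj 0).toLinearMap + (β : ℝ) • (EuclideanSpace.proj 1).toLinearMap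

theorem func_pt (α β : ℤ) (w : ℕ) : func α β (pt X Y w) = ((α * X w + β * Y w : ℤ) : ℝ) := by
  simp [func, pt]

theorem pt_injective {w z : ℕ} (h : pt X Y w = pt X Y z) : X w = X z ∧ Y w = Y z := by
  have h0 := congrArg (fun p : EuclideanSpace ℝ (Fin 2) => p 0) h
  have h1 := congrArg (fun p : EuclideanSpace ℝ (Fin 2) => p 1) h
  simpa [pt] using And.intro h0 h1

theorem eq_of_common {φ : EuclideanSpace ℝ (Fin 2) →ₗ[ℝ] ℝ} {p q r x : EuclideanSpace ℝ (Fin 2)}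
    (h₁ : x ∈ segment ℝ p q) (h₂ : x ∈ segment ℝ p r) (hq : φ q < φ p) (hr : φ p < φ r) :
    x = p := by
  obtain ⟨a, b, ha, hb, hab, rfl⟩ := h₁
  obtain ⟨c, d, hc, hd, hcd, h⟩ := h₂
  have h' := congrArg φ h
  simp only [map_add, map_smul, smul_eq_mul] at h'
  have e1 : c * φ p + d * φ r = φ p + d * (φ r - φ p) := by
    rw [show c = 1 - d by linarith]; ring
  have e2 : a * φ p + b * φ q = φ p - b * (φ p - φ q) := by
    rw [show a = 1 - b by linarith]; ring
  have h3 : 0 ≤ d * (φ r - φ p) := mul_nonneg hd (by linarith)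
  have h4 : 0 ≤ b * (φ p - φ q) := mul_nonneg hb (by linarith)
  have h5 : b * (φ p - φ q) = 0 := by linarith
  have h6 : b = 0 := (mul_eq_zero.1 h5).resolve_right (by linarith)
  rw [h6, show a = 1 by linarith]
  simp

theorem disjoint_segments {φ : EuclideanSpace ℝ (Fin 2) →ₗ[ℝ] ℝ}
    {p q r s x : EuclideanSpace ℝ (Fin 2)} (h₁ : x ∈ segment ℝ p q) (h₂ : x ∈ segment ℝ r s)
    (h : φ p < φ r ∧ φ p < φ s ∧ φ q < φ r ∧ φ q < φ s) : False := by
  have hl : IsLinearMap ℝ φ := φ.isLinear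
  have a1 := (convex_halfSpace_le hl (max (φ p) (φ q))).segment_subset
    (show p ∈ {w | φ w ≤ max (φ p) (φ q)} from le_max_left (φ p) (φ q))
    (show q ∈ {w | φ w ≤ max (φ p) (φ q)} from le_max_right (φ p) (φ q)) h₁
  have a2 := (convex_halfSpace_gt hl (max (φ p) (φ q))).segment_subset
    (show r ∈ {w | max (φ p) (φ q) < φ w} from max_lt h.1 h.2.2.1)
    (show s ∈ {w | max (φ p) (φ q) < φ w} from max_lt h.2.1 h.2.2.2) h₂
  rw [Set.mem_ofPred_eq] at a1 a2
  exact absurd a2 (not_lt.2 a1)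

/-- Separated segments meet at most in a common end. -/
theorem exists_common_end (h : EdgeSep X Y u v u' v') (huv : u ≠ v) (huv' : u' ≠ v')
    (hne : s(u, v) ≠ s(u', v')) {x : EuclideanSpace ℝ (Fin 2)}
    (h₁ : x ∈ segment ℝ (pt X Y u) (pt X Y v)) (h₂ : x ∈ segment ℝ (pt X Y u') (pt X Y v')) :
    ∃ w, (w = u ∨ w = v) ∧ (w = u' ∨ w = v') ∧ pt X Y w = x := by
  have key : ∀ {u v v' : ℕ}, EdgeSep X Y u v u v' → u ≠ v → u ≠ v' → v ≠ v' →
      x ∈ segment ℝ (pt X Y u) (pt X Y v) → x ∈ segment ℝ (pt X Y u) (pt X Y v') →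
      pt X Y u = x := by
    rintro u v v' ⟨α, β, h⟩ n1 n2 n3 h₁ h₂
    have a1 := (h v u (Or.inr rfl) (Or.inl rfl)).resolve_left n1.symm
    have a2 := (h u v' (Or.inl rfl) (Or.inr rfl)).resolve_left n2
    refine (eq_of_common (φ := func α β) h₁ h₂ ?_ ?_).symm
    · rw [func_pt, func_pt]; exact_mod_cast a1
    · rw [func_pt, func_pt]; exact_mod_cast a2
  simp only [ne_eq, Sym2.eq_iff, not_or, not_and] at hne
  by_cases c1 : u = u'
  · subst c1
    exact ⟨u, Or.inl rfl, Or.inl rfl, key h huv huv' (hne.1 rfl) h₁ h₂⟩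
  by_cases c2 : u = v'
  · subst c2
    rw [segment_symm] at h₂
    exact ⟨u, Or.inl rfl, Or.inr rfl, key h.swap_right huv c1 (hne.2 rfl) h₁ h₂⟩
  by_cases c3 : v = u'
  · subst c3
    rw [segment_symm] at h₁
    exact ⟨v, Or.inr rfl, Or.inl rfl, key h.swap_left huv.symm huv' c2 h₁ h₂⟩
  by_cases c4 : v = v'
  · subst c4
    rw [segment_symm] at h₁ h₂
    exact ⟨v, Or.inr rfl, Or.inr rfl, key h.swap_left.swap_right huv.symm huv'.symm c1 h₁ h₂⟩
  obtain ⟨α, β, h⟩ := h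
  have a1 := (h u u' (Or.inl rfl) (Or.inl rfl)).resolve_left c1
  have a2 := (h u v' (Or.inl rfl) (Or.inr rfl)).resolve_left c2
  have a3 := (h v u' (Or.inr rfl) (Or.inl rfl)).resolve_left c3
  have a4 := (h v v' (Or.inr rfl) (Or.inr rfl)).resolve_left c4
  refine (disjoint_segments (φ := func α β) h₁ h₂ ?_).elim
  simp only [func_pt]
  exact ⟨by exact_mod_cast a1, by exact_mod_cast a2, by exact_mod_cast a3, by exact_mod_cast a4⟩

end EdgeSep

/-- A straight-line drawing in which any two edges are separated is a plane embedding. -/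
theorem isPlanar_of_sep {R : ℕ → ℕ → Prop} (hsymm : ∀ x y, R x y → R y x) (hirr : ∀ x, ¬ R x x)
    {T : ℕ} (X Y : ℕ → ℤ)
    (hsep : ∀ u v u' v', R u v → R u' v' → s(u, v) ≠ s(u', v') → EdgeSep X Y u v u' v')
    (hne : ∀ u v, R u v → X u ≠ X v ∨ Y u ≠ Y v) (hdeg : ∀ u < T, ∃ v < T, R u v) :
    (natGraph R hsymm hirr T).IsPlanar := by
  have ne : ∀ u v, R u v → u ≠ v := fun u v h e => hirr u (by rwa [← e] at h)
  have common : ∀ u v u' v', R u v → R u' v' → s(u, v) ≠ s(u', v') → ∀ x,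
      x ∈ segment ℝ (EdgeSep.pt X Y u) (EdgeSep.pt X Y v) →
      x ∈ segment ℝ (EdgeSep.pt X Y u') (EdgeSep.pt X Y v') →
      ∃ w, (w = u ∨ w = v) ∧ (w = u' ∨ w = v') ∧ EdgeSep.pt X Y w = x :=
    fun u v u' v' h h' e x => (hsep u v u' v' h h' e).exists_common_end (ne _ _ h) (ne _ _ h') e
  have inj : ∀ w z, w < T → z < T → EdgeSep.pt X Y w = EdgeSep.pt X Y z → w = z := by
    intro w z hw hz e
    by_contra hwz
    obtain ⟨w', -, hw'⟩ := hdeg w hw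
    obtain ⟨z', -, hz'⟩ := hdeg z hz
    have e' := EdgeSep.pt_injective e
    by_cases hs : s(w, w') = s(z, z')
    · rcases Sym2.eq_iff.1 hs with ⟨h, -⟩ | ⟨-, rfl⟩
      · exact hwz h
      · rcases hne _ _ hw' with h | h
        · exact h e'.1
        · exact h e'.2
    · obtain ⟨α, β, h⟩ := hsep _ _ _ _ hw' hz' hs
      have := (h w z (Or.inl rfl) (Or.inl rfl)).resolve_left hwz
      rw [e'.1, e'.2] at this
      exact lt_irrefl _ this
  let arc : Sym2 (Fin T) → Set (EuclideanSpace ℝ (Fin 2)) :=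
    Sym2.lift ⟨fun u v => segment ℝ (EdgeSep.pt X Y u) (EdgeSep.pt X Y v), fun u v => segment_symm ..⟩
  have inter : ∀ e ∈ (natGraph R hsymm hirr T).edgeSet, ∀ f ∈ (natGraph R hsymm hirr T).edgeSet,
      e ≠ f → ∀ x ∈ arc e ∩ arc f, ∃ w : Fin T, w ∈ e ∧ w ∈ f ∧ EdgeSep.pt X Y w = x := by
    intro e
    induction e using Sym2.ind with
    | _ u v =>
    intro he f
    induction f using Sym2.ind with
    | _ u' v' =>
    intro hf hef x hx
    have hef' : s(u.1, v.1) ≠ s(u'.1, v'.1) := by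
      intro h
      apply hef
      simpa [Sym2.eq_iff, Fin.ext_iff] using h
    obtain ⟨w, h1, h2, h3⟩ := common u v u' v' he hf hef' x hx.1 hx.2
    have hw : w < T := by
      rcases h1 with rfl | rfl
      · exact u.2
      · exact v.2
    refine ⟨⟨w, hw⟩, ?_, ?_, h3⟩
    · simpa [Sym2.mem_iff, Fin.ext_iff] using h1
    · simpa [Sym2.mem_iff, Fin.ext_iff] using h2
  refine ⟨⟨fun u => EdgeSep.pt X Y u, arc, fun u v h => Fin.ext (inj u v u.2 v.2 h), ?_, ?_, inter⟩⟩
  · intro u v h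
    refine ⟨Path.segment _ _, Path.segment_injective_of_ne fun e => ?_, Path.range_segment _ _⟩
    exact ne _ _ h (inj u v u.2 v.2 e)
  · intro e he w hw
    by_contra hwe
    obtain ⟨z, hz, hwz⟩ := hdeg w w.2
    have hf : s(w, ⟨z, hz⟩) ∈ (natGraph R hsymm hirr T).edgeSet := hwz
    obtain ⟨y, hy, -, e'⟩ := inter e he _ hf (fun h => hwe (h ▸ Sym2.mem_mk_left _ _))
      (EdgeSep.pt X Y w) ⟨hw, left_mem_segment ℝ _ _⟩
    rw [Fin.ext (inj y w y.2 w.2 e')] at hy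
    exact hwe hy

/-- A subgraph of a planar graph is planar. -/
theorem SimpleGraph.IsPlanar.mono {V : Type*} {G H : SimpleGraph V} (h : G ≤ H)
    (hH : H.IsPlanar) : G.IsPlanar := by
  obtain ⟨p⟩ := hH
  have sub := SimpleGraph.edgeSet_mono h
  exact ⟨⟨p.point, p.arc, p.point_injective, fun u v huv => p.arc_isArc u v (h huv),
    fun e he => p.vertex_of_mem_arc e (sub he),
    fun e he f hf => p.arc_inter_arc e (sub he) f (sub hf)⟩⟩

/-! ### Drawing a ladder around a square -/

theorem EdgeSep.of_four {X Y : ℕ → ℤ} {u v u' v' : ℕ} (α β : ℤ)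
    (h₁ : u = u' ∨ α * X u + β * Y u < α * X u' + β * Y u')
    (h₂ : u = v' ∨ α * X u + β * Y u < α * X v' + β * Y v')
    (h₃ : v = u' ∨ α * X v + β * Y v < α * X u' + β * Y u')
    (h₄ : v = v' ∨ α * X v + β * Y v < α * X v' + β * Y v') : EdgeSep X Y u v u' v' := by
  refine ⟨α, β, ?_⟩
  rintro e f (rfl | rfl) (rfl | rfl) <;> assumption

namespace Ladder

/-- The sign that belongs to a side. -/
def sg (s : Bool) : ℤ := bif s then 1 else -1

/-- The vertex at the corner `(s, ε)` of the `c`-th of `h` nested squares, for a ladder with `2 h`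
rungs. -/
def lab (K h : ℕ) (s ε : Bool) (c : ℕ) : ℕ :=
  (bif s then K + 2 * (2 * h - 1 - c) else K + 2 * c) + ε.toNat

/-- The edges of the ladder except for the first and the last rung. -/
inductive OuterEdge (K h : ℕ) : ℕ → ℕ → Prop
  | side (s : Bool) (c : ℕ) (h₁ : 1 ≤ c) (h₂ : c < h) :
    OuterEdge K h (lab K h s false c) (lab K h s true c)
  | spoke (s ε : Bool) (c : ℕ) (h₁ : c + 1 < h) :
    OuterEdge K h (lab K h s ε c) (lab K h s ε (c + 1))
  | long (ε : Bool) : OuterEdge K h (lab K h false ε (h - 1)) (lab K h true ε (h - 1))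

/-- The corners of the nested squares around the square of side length `S`. -/
structure IsNested (K h : ℕ) (S : ℤ) (X Y : ℕ → ℤ) : Prop where
  two_le : 2 ≤ h
  pos : 0 < S
  hx : ∀ s ε c, c < h → 2 * X (lab K h s ε c) = S + sg s * (S + 2 * c)
  hy : ∀ s ε c, c < h → 2 * Y (lab K h s ε c) = S + sg ε * (S + 2 * c)

/-- A vertex inside the innermost square, or one of its corners. -/
structure IsInside (K h : ℕ) (S : ℤ) (X Y : ℕ → ℤ) (e : ℕ) : Prop where
  hx : 0 ≤ X e ∧ X e ≤ S
  hy : 0 ≤ Y e ∧ Y e ≤ S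
  corner : ∀ s ε, e = lab K h s ε 0 ∨ sg s * (2 * X e - S) + sg ε * (2 * Y e - S) < 2 * S

variable {K h : ℕ} {S : ℤ} {X Y : ℕ → ℤ}

namespace IsNested

theorem side_side (H : IsNested K h S X Y) {s s' : Bool} {c d : ℕ} (hd : d < h) (hcd : c < d) :
    EdgeSep X Y (lab K h s false c) (lab K h s true c) (lab K h s' false d) (lab K h s' true d) := by
  have a1 := H.hx s false c (by omega)
  have a2 := H.hx s true c (by omega)
  have a3 := H.hx s' false d hd
  have a4 := H.hx s' true d hd
  have := H.pos
  refine .of_four (sg s') 0 ?_ ?_ ?_ ?_ <;> right <;> cases s <;> cases s' <;>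
    simp only [sg, cond_true, cond_false] at * <;> omega

theorem side_side_opposite (H : IsNested K h S X Y) {s : Bool} {c d : ℕ} (hc : c < h) (hd : d < h) :
    EdgeSep X Y (lab K h s false c) (lab K h s true c) (lab K h (!s) false d)
      (lab K h (!s) true d) := by
  have a1 := H.hx s false c (by omega)
  have a2 := H.hx s true c (by omega)
  have a3 := H.hx (!s) false d hd
  have a4 := H.hx (!s) true d hd
  have := H.pos
  refine .of_four (sg (!s)) 0 ?_ ?_ ?_ ?_ <;> right <;> cases s <;>
    simp only [sg, Bool.not_true, Bool.not_false, cond_true, cond_false] at * <;> omega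

theorem side_spoke_opposite (H : IsNested K h S X Y) {s ε : Bool} {c d : ℕ} (hc : c < h)
    (hd : d + 1 < h) :
    EdgeSep X Y (lab K h s false c) (lab K h s true c) (lab K h (!s) ε d)
      (lab K h (!s) ε (d + 1)) := by
  have a1 := H.hx s false c (by omega)
  have a2 := H.hx s true c (by omega)
  have a3 := H.hx (!s) ε d (by omega)
  have a4 := H.hx (!s) ε (d + 1) hd
  have := H.pos
  refine .of_four (sg (!s)) 0 ?_ ?_ ?_ ?_ <;> right <;> cases s <;>
    simp only [sg, Bool.not_true, Bool.not_false, cond_true, cond_false] at * <;> omega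

theorem side_spoke (H : IsNested K h S X Y) {s ε : Bool} {c d : ℕ} (hc : c < h) (hd : d + 1 < h) :
    EdgeSep X Y (lab K h s false c) (lab K h s true c) (lab K h s ε d) (lab K h s ε (d + 1)) := by
  have a1 := H.hx s false c hc
  have a2 := H.hx s true c hc
  have a3 := H.hx s ε d (by omega)
  have a4 := H.hx s ε (d + 1) hd
  have b1 := H.hy s false c hc
  have b2 := H.hy s true c hc
  have b3 := H.hy s ε d (by omega)
  have b4 := H.hy s ε (d + 1) hd
  have := H.pos
  by_cases hcd : c ≤ d
  · rcases Nat.eq_or_lt_of_le hcd with rfl | hlt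
    · refine .of_four 0 (sg ε) ?_ ?_ ?_ ?_ <;> cases ε <;>
        simp only [sg, cond_true, cond_false, true_or] at * <;> right <;> omega
    · refine .of_four 0 (sg ε) ?_ ?_ ?_ ?_ <;> right <;> cases ε <;>
        simp only [sg, cond_true, cond_false] at * <;> omega
  · refine EdgeSep.symm ?_
    rcases Nat.eq_or_lt_of_le (show d + 1 ≤ c by omega) with rfl | hlt
    · refine .of_four (2 * sg s) (- sg ε) ?_ ?_ ?_ ?_ <;> cases s <;> cases ε <;>
        simp only [sg, cond_true, cond_false, true_or] at * <;> right <;> omega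
    · refine .of_four (2 * sg s) (- sg ε) ?_ ?_ ?_ ?_ <;> right <;> cases s <;> cases ε <;>
        simp only [sg, cond_true, cond_false] at * <;> omega

theorem side_long (H : IsNested K h S X Y) {s ε : Bool} {c : ℕ} (hc : c < h) :
    EdgeSep X Y (lab K h s false c) (lab K h s true c) (lab K h false ε (h - 1))
      (lab K h true ε (h - 1)) := by
  have h2 := H.two_le
  have a1 := H.hx s false c hc
  have a2 := H.hx s true c hc
  have a3 := H.hx false ε (h - 1) (by omega)
  have a4 := H.hx true ε (h - 1) (by omega)
  have b1 := H.hy s false c hc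
  have b2 := H.hy s true c hc
  have b3 := H.hy false ε (h - 1) (by omega)
  have b4 := H.hy true ε (h - 1) (by omega)
  have := H.pos
  rcases Nat.eq_or_lt_of_le (show c ≤ h - 1 by omega) with rfl | hlt
  · refine .of_four (- sg s) (sg ε) ?_ ?_ ?_ ?_ <;> cases s <;> cases ε <;>
      simp only [sg, cond_true, cond_false, true_or] at * <;> right <;> omega
  · refine .of_four 0 (sg ε) ?_ ?_ ?_ ?_ <;> right <;> cases s <;> cases ε <;>
      simp only [sg, cond_true, cond_false] at * <;> omega

theorem spoke_spoke (H : IsNested K h S X Y) {s s' ε ε' : Bool} {c d : ℕ} (hc : c + 1 < h)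
    (hd : d + 1 < h) (hne : s = s' → ε = ε' → c < d) :
    EdgeSep X Y (lab K h s ε c) (lab K h s ε (c + 1)) (lab K h s' ε' d)
      (lab K h s' ε' (d + 1)) := by
  have a1 := H.hx s ε c (by omega)
  have a2 := H.hx s ε (c + 1) hc
  have a3 := H.hx s' ε' d (by omega)
  have a4 := H.hx s' ε' (d + 1) hd
  have b1 := H.hy s ε c (by omega)
  have b2 := H.hy s ε (c + 1) hc
  have b3 := H.hy s' ε' d (by omega)
  have b4 := H.hy s' ε' (d + 1) hd
  have := H.pos
  by_cases hs : s = s'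
  · by_cases hε : ε = ε'
    · have hcd := hne hs hε
      subst hs hε
      rcases Nat.eq_or_lt_of_le (show c + 1 ≤ d by omega) with rfl | hlt
      · refine .of_four (sg s) 0 ?_ ?_ ?_ ?_ <;> cases s <;>
          simp only [sg, cond_true, cond_false, true_or] at * <;> right <;> omega
      · refine .of_four (sg s) 0 ?_ ?_ ?_ ?_ <;> right <;> cases s <;>
          simp only [sg, cond_true, cond_false] at * <;> omega
    · obtain rfl : ε = !ε' := by cases ε <;> cases ε' <;> simp_all
      refine .of_four 0 (sg ε') ?_ ?_ ?_ ?_ <;> right <;> cases ε' <;>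
        simp only [sg, Bool.not_true, Bool.not_false, cond_true, cond_false] at * <;> omega
  · obtain rfl : s = !s' := by cases s <;> cases s' <;> simp_all
    refine .of_four (sg s') 0 ?_ ?_ ?_ ?_ <;> right <;> cases s' <;>
      simp only [sg, Bool.not_true, Bool.not_false, cond_true, cond_false] at * <;> omega

theorem spoke_long (H : IsNested K h S X Y) {s ε ε' : Bool} {c : ℕ} (hc : c + 1 < h) :
    EdgeSep X Y (lab K h s ε' c) (lab K h s ε' (c + 1)) (lab K h false ε (h - 1))
      (lab K h true ε (h - 1)) := by
  have h2 := H.two_le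
  have a1 := H.hx s ε' c (by omega)
  have a2 := H.hx s ε' (c + 1) hc
  have a3 := H.hx false ε (h - 1) (by omega)
  have a4 := H.hx true ε (h - 1) (by omega)
  have b1 := H.hy s ε' c (by omega)
  have b2 := H.hy s ε' (c + 1) hc
  have b3 := H.hy false ε (h - 1) (by omega)
  have b4 := H.hy true ε (h - 1) (by omega)
  have := H.pos
  by_cases hε : ε = ε'
  · subst hε
    rcases Nat.eq_or_lt_of_le (show c + 1 ≤ h - 1 by omega) with he | hlt
    · rw [← he] at a3 a4 b3 b4 ⊢
      refine .of_four (- sg s) (2 * sg ε) ?_ ?_ ?_ ?_ <;> cases s <;> cases ε <;>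
        simp only [sg, cond_true, cond_false, true_or] at * <;> right <;> omega
    · refine .of_four (- sg s) (2 * sg ε) ?_ ?_ ?_ ?_ <;> right <;> cases s <;> cases ε <;>
        simp only [sg, cond_true, cond_false] at * <;> omega
  · obtain rfl : ε' = !ε := by cases ε <;> cases ε' <;> simp_all
    refine .of_four 0 (sg ε) ?_ ?_ ?_ ?_ <;> right <;> cases ε <;>
      simp only [sg, Bool.not_true, Bool.not_false, cond_true, cond_false] at * <;> omega

theorem long_long (H : IsNested K h S X Y) {ε ε' : Bool} (hε : ε ≠ ε') :
    EdgeSep X Y (lab K h false ε (h - 1)) (lab K h true ε (h - 1)) (lab K h false ε' (h - 1))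
      (lab K h true ε' (h - 1)) := by
  have h2 := H.two_le
  have b1 := H.hy false ε (h - 1) (by omega)
  have b2 := H.hy true ε (h - 1) (by omega)
  have b3 := H.hy false ε' (h - 1) (by omega)
  have b4 := H.hy true ε' (h - 1) (by omega)
  have := H.pos
  obtain rfl : ε = !ε' := by cases ε <;> cases ε' <;> simp_all
  refine .of_four 0 (sg ε') ?_ ?_ ?_ ?_ <;> right <;> cases ε' <;>
    simp only [sg, Bool.not_true, Bool.not_false, cond_true, cond_false] at * <;> omega

theorem outer_outer (H : IsNested K h S X Y) {u v u' v' : ℕ} (h₁ : OuterEdge K h u v)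
    (h₂ : OuterEdge K h u' v') (hne : s(u, v) ≠ s(u', v')) : EdgeSep X Y u v u' v' := by
  cases h₁ with
  | side s c c1 c2 =>
    cases h₂ with
    | side s' d d1 d2 =>
      rcases Nat.lt_trichotomy c d with hcd | rfl | hcd
      · exact H.side_side d2 hcd
      · by_cases hs : s = s'
        · subst hs
          exact (hne rfl).elim
        · obtain rfl : s' = !s := by cases s <;> cases s' <;> simp_all
          exact H.side_side_opposite c2 d2
      · exact (H.side_side c2 hcd).symm
    | spoke s' ε d d1 =>
      by_cases hs : s = s'
      · subst hs
        exact H.side_spoke c2 d1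
      · obtain rfl : s' = !s := by cases s <;> cases s' <;> simp_all
        exact H.side_spoke_opposite c2 d1
    | long ε => exact H.side_long c2
  | spoke s ε c c1 =>
    cases h₂ with
    | side s' d d1 d2 =>
      refine EdgeSep.symm ?_
      by_cases hs : s' = s
      · subst hs
        exact H.side_spoke d2 c1
      · obtain rfl : s = !s' := by cases s <;> cases s' <;> simp_all
        exact H.side_spoke_opposite d2 c1
    | spoke s' ε' d d1 =>
      by_cases hcd : s = s' ∧ ε = ε' ∧ d ≤ c
      · obtain ⟨rfl, rfl, hdc⟩ := hcd
        rcases Nat.eq_or_lt_of_le hdc with rfl | hlt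
        · exact (hne rfl).elim
        · exact (H.spoke_spoke d1 c1 fun _ _ => hlt).symm
      · exact H.spoke_spoke c1 d1 fun e1 e2 => by
          by_contra hlt
          exact hcd ⟨e1, e2, by omega⟩
    | long ε' => exact H.spoke_long c1
  | long ε =>
    cases h₂ with
    | side s' d d1 d2 => exact (H.side_long d2).symm
    | spoke s' ε' d d1 => exact (H.spoke_long d1).symm
    | long ε' =>
      refine H.long_long ?_
      rintro rfl
      exact hne rfl

theorem inside_outer (H : IsNested K h S X Y) {u v u' v' : ℕ} (hu : IsInside K h S X Y u)
    (hv : IsInside K h S X Y v) (h₂ : OuterEdge K h u' v') : EdgeSep X Y u v u' v' := by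
  have key : ∀ α β, (∀ e, IsInside K h S X Y e →
      (e = u' ∨ α * X e + β * Y e < α * X u' + β * Y u') ∧
      (e = v' ∨ α * X e + β * Y e < α * X v' + β * Y v')) → EdgeSep X Y u v u' v' :=
    fun α β hk => .of_four α β (hk u hu).1 (hk u hu).2 (hk v hv).1 (hk v hv).2
  have hS := H.pos
  have h2 := H.two_le
  cases h₂ with
  | side s d d1 d2 =>
    have a3 := H.hx s false d d2
    have a4 := H.hx s true d d2
    refine key (sg s) 0 fun e he => ?_
    have := he.hx
    constructor <;> right <;> cases s <;> simp only [sg, cond_true, cond_false] at * <;> omega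
  | spoke s ε d d1 =>
    have a3 := H.hx s ε d (by omega)
    have a4 := H.hx s ε (d + 1) d1
    have b3 := H.hy s ε d (by omega)
    have b4 := H.hy s ε (d + 1) d1
    refine key (sg s) (sg ε) fun e he => ?_
    have c1 := he.hx
    have c2 := he.hy
    constructor
    · rcases he.corner s ε with hc | hc
      · rcases Nat.eq_zero_or_pos d with rfl | hd
        · exact Or.inl hc
        · right
          cases s <;> cases ε <;> simp only [sg, cond_true, cond_false] at * <;> omega
      · right
        cases s <;> cases ε <;> simp only [sg, cond_true, cond_false] at * <;> omega
    · right
      cases s <;> cases ε <;> simp only [sg, cond_true, cond_false] at * <;> omega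
  | long ε =>
    have b3 := H.hy false ε (h - 1) (by omega)
    have b4 := H.hy true ε (h - 1) (by omega)
    refine key 0 (sg ε) fun e he => ?_
    have := he.hy
    constructor <;> right <;> cases ε <;> simp only [sg, cond_true, cond_false] at * <;> omega

theorem outer_ne (H : IsNested K h S X Y) {u v : ℕ} (h₁ : OuterEdge K h u v) :
    X u ≠ X v ∨ Y u ≠ Y v := by
  have hS := H.pos
  have h2 := H.two_le
  cases h₁ with
  | side s d d1 d2 =>
    have b3 := H.hy s false d d2
    have b4 := H.hy s true d d2
    simp only [sg, cond_true, cond_false] at *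
    omega
  | spoke s ε d d1 =>
    have a3 := H.hx s ε d (by omega)
    have a4 := H.hx s ε (d + 1) d1
    cases s <;> simp only [sg, cond_true, cond_false] at * <;> omega
  | long ε =>
    have a3 := H.hx false ε (h - 1) (by omega)
    have a4 := H.hx true ε (h - 1) (by omega)
    simp only [sg, cond_true, cond_false] at *
    omega

end IsNested

end Ladder

namespace Ladder

/-- The number of the nested square that contains the vertex `x` of the ladder. -/
def level (K h x : ℕ) : ℕ := if x < K + 2 * h then (x - K) / 2 else (K + 4 * h - 1 - x) / 2

/-- The abscissae of a drawing of the ladder around a drawing of the other vertices. -/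
def drawX (K h : ℕ) (S : ℤ) (cx : ℕ → ℤ) (x : ℕ) : ℤ :=
  if x < K then cx x else if x < K + 2 * h then -(level K h x : ℤ) else S + level K h x

/-- The ordinates of a drawing of the ladder around a drawing of the other vertices. -/
def drawY (K h : ℕ) (S : ℤ) (cy : ℕ → ℤ) (x : ℕ) : ℤ :=
  if x < K then cy x else if (x - K) % 2 = 0 then -(level K h x : ℤ) else S + level K h x

/-- A drawing of the graph `adj` on `{0, …, K + 3}` in a square whose corners are the last four
vertices. -/
structure IsSquareDrawing (adj : ℕ → ℕ → Prop) (K : ℕ) (S : ℤ) (cx cy : ℕ → ℤ) : Prop where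
  symm : ∀ x y, adj x y → adj y x
  irrefl : ∀ x, ¬ adj x x
  pos : 0 < S
  adj_left : adj K (K + 1)
  adj_right : adj (K + 2) (K + 3)
  exists_adj : ∀ x < K, ∃ y < K + 4, adj x y
  inside_x : ∀ x < K, 0 < cx x ∧ cx x < S
  inside_y : ∀ x < K, 0 < cy x ∧ cy x < S
  corner_x : cx K = 0 ∧ cx (K + 1) = 0 ∧ cx (K + 2) = S ∧ cx (K + 3) = S
  corner_y : cy K = 0 ∧ cy (K + 1) = S ∧ cy (K + 2) = 0 ∧ cy (K + 3) = S
  ne : ∀ x y, adj x y → cx x ≠ cx y ∨ cy x ≠ cy y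
  sep : ∀ u₁ v₁ u₂ v₂, adj u₁ v₁ → adj u₂ v₂ → s(u₁, v₁) ≠ s(u₂, v₂) → EdgeSep cx cy u₁ v₁ u₂ v₂

/-- The vertices outside the inner rungs. -/
def IsCore (K h x : ℕ) : Prop := x < K + 2 ∨ (K + 4 * h ≤ x + 2 ∧ x < K + 4 * h)

/-- The label of a vertex outside the inner rungs before the insertion of these rungs. -/
def coreLabel (K h x : ℕ) : ℕ := if x < K + 2 then x else x + 4 - 4 * h

variable {adj : ℕ → ℕ → Prop} {K h : ℕ} {S : ℤ} {cx cy : ℕ → ℤ}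

theorem coreLabel_injOn {x y : ℕ} (hx : IsCore K h x) (hy : IsCore K h y)
    (e : coreLabel K h x = coreLabel K h y) : x = y := by
  unfold IsCore at hx hy
  unfold coreLabel at e
  split_ifs at e <;> omega

theorem lab_left (ε : Bool) (c : ℕ) : lab K h false ε c = K + 2 * c + ε.toNat := rfl

theorem lab_right (ε : Bool) (c : ℕ) : lab K h true ε c = K + 2 * (2 * h - 1 - c) + ε.toNat := rfl

theorem isNested_draw (hS : 0 < S) (hh : 2 ≤ h) :
    IsNested K h S (drawX K h S cx) (drawY K h S cy) := by
  refine ⟨hh, hS, fun s ε c hc => ?_, fun s ε c hc => ?_⟩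
  · have hε := ε.toNat_le
    cases s
    · rw [lab_left, drawX, if_neg (by omega), if_pos (by omega), level, if_pos (by omega)]
      simp only [sg, cond_false]
      omega
    · rw [lab_right, drawX, if_neg (by omega), if_neg (by omega), level, if_neg (by omega)]
      simp only [sg, cond_true]
      omega
  · have hl : level K h (lab K h s ε c) = c := by
      have hε := ε.toNat_le
      cases s
      · rw [lab_left, level, if_pos (by omega)]
        omega
      · rw [lab_right, level, if_neg (by omega)]
        omega
    rw [drawY, hl, if_neg (by cases s <;> simp [lab] <;> omega)]
    have hm : (lab K h s ε c - K) % 2 = ε.toNat := by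
      cases s <;> cases ε <;> simp [lab] <;> omega
    rw [hm]
    cases ε
    · simp only [sg, cond_false, Bool.toNat_false, if_true]
      omega
    · simp only [sg, cond_true, Bool.toNat_true, one_ne_zero, if_false]
      omega

theorem edge_cases (hA : adj K (K + 1)) (hB : adj (K + 2) (K + 3)) (hh : 2 ≤ h) {x y : ℕ}
    (he : Edge adj K (2 * h) x y) :
    (IsCore K h x ∧ IsCore K h y ∧ adj (coreLabel K h x) (coreLabel K h y)) ∨
      OuterEdge K h x y ∨ OuterEdge K h y x := by
  rcases he with ⟨h1, h2, h3⟩ | ⟨h1, h2, h3, h4⟩ | ⟨h1, h2, h3⟩ | ⟨h1, h2, h3, h4⟩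
  · left
    refine ⟨Or.inl (by omega), Or.inl h2, ?_⟩
    rwa [coreLabel, if_pos (by omega), coreLabel, if_pos h2]
  · left
    refine ⟨Or.inl (by omega), Or.inr ⟨by omega, by omega⟩, ?_⟩
    rw [coreLabel, if_pos (by omega), coreLabel, if_neg (by omega)]
    have e : y + 4 - 4 * h = y + 4 - 2 * (2 * h) := by omega
    rwa [e]
  · right
    obtain ⟨c, ε, rfl⟩ : ∃ c, ∃ ε : Bool, x = K + 2 * c + ε.toNat := by
      rcases Nat.mod_two_eq_zero_or_one (x - K) with h | h
      · exact ⟨(x - K) / 2, false, by simp; omega⟩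
      · exact ⟨(x - K) / 2, true, by simp; omega⟩
    have hε := ε.toNat_le
    rcases Nat.lt_trichotomy (c + 1) h with hc | hc | hc
    · left
      have e1 : K + 2 * c + ε.toNat = lab K h false ε c := rfl
      have e2 : y = lab K h false ε (c + 1) := by rw [lab_left]; omega
      rw [e1, e2]
      exact .spoke _ _ _ hc
    · left
      have e1 : K + 2 * c + ε.toNat = lab K h false ε (h - 1) := by rw [lab_left]; omega
      have e2 : y = lab K h true ε (h - 1) := by rw [lab_right]; omega
      rw [e1, e2]
      exact .long _
    · right
      have e1 : K + 2 * c + ε.toNat = lab K h true ε (2 * h - 2 - c + 1) := by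
        rw [lab_right]; omega
      have e2 : y = lab K h true ε (2 * h - 2 - c) := by rw [lab_right]; omega
      rw [e1, e2]
      exact .spoke _ _ _ (by omega)
  · obtain ⟨c, rfl⟩ : ∃ c, x = K + 2 * c := ⟨(x - K) / 2, by omega⟩
    by_cases c1 : c = 0
    · subst c1
      left
      refine ⟨Or.inl (by omega), Or.inl (by omega), ?_⟩
      rw [coreLabel, if_pos (by omega), coreLabel, if_pos (by omega), h3]
      exact hA
    · by_cases c2 : c = 2 * h - 1
      · left
        refine ⟨Or.inr ⟨by omega, by omega⟩, Or.inr ⟨by omega, by omega⟩, ?_⟩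
        rw [coreLabel, if_neg (by omega), coreLabel, if_neg (by omega)]
        have e1 : K + 2 * c + 4 - 4 * h = K + 2 := by omega
        have e2 : y + 4 - 4 * h = K + 3 := by omega
        rwa [e1, e2]
      · right; left
        by_cases c3 : c < h
        · have e1 : K + 2 * c = lab K h false false c := rfl
          have e2 : y = lab K h false true c := by rw [lab_left, h3]; rfl
          rw [e1, e2]
          exact .side _ _ (by omega) c3
        · have e1 : K + 2 * c = lab K h true false (2 * h - 1 - c) := by
            rw [lab_right]; simp; omega
          have e2 : y = lab K h true true (2 * h - 1 - c) := by
            rw [lab_right]; simp; omega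
          rw [e1, e2]
          exact .side _ _ (by omega) (by omega)

namespace IsSquareDrawing

theorem draw_coreLabel (D : IsSquareDrawing adj K S cx cy) (hh : 2 ≤ h) {x : ℕ}
    (hx : IsCore K h x) : drawX K h S cx x = cx (coreLabel K h x) ∧
      drawY K h S cy x = cy (coreLabel K h x) := by
  obtain ⟨x0, x1, x2, x3⟩ := D.corner_x
  obtain ⟨y0, y1, y2, y3⟩ := D.corner_y
  by_cases h1 : x < K
  · rw [drawX, drawY, if_pos h1, if_pos h1, coreLabel, if_pos (by omega)]
    exact ⟨rfl, rfl⟩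
  rcases hx with hx | ⟨hx, hx'⟩
  · have e : coreLabel K h x = x := if_pos hx
    rw [e, drawX, drawY, if_neg h1, if_neg h1, if_pos (by omega), level, if_pos (by omega)]
    rcases Nat.eq_or_lt_of_le (show K ≤ x by omega) with rfl | h2
    · simp [x0, y0]
    · obtain rfl : x = K + 1 := by omega
      simp [x1, y1]
  · have e : coreLabel K h x = x + 4 - 4 * h := if_neg (by omega)
    have hl : level K h x = 0 := by
      rw [level, if_neg (by omega)]; omega
    rw [e, drawX, drawY, if_neg h1, if_neg h1, if_neg (by omega), hl]
    by_cases h2 : x + 2 = K + 4 * h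
    · have e1 : x + 4 - 4 * h = K + 2 := by omega
      rw [e1, if_pos (by omega)]
      simp [x2, y2]
    · have e1 : x + 4 - 4 * h = K + 3 := by omega
      rw [e1, if_neg (by omega)]
      simp [x3, y3]

theorem isInside (D : IsSquareDrawing adj K S cx cy) (hh : 2 ≤ h) {x : ℕ} (hx : IsCore K h x) :
    IsInside K h S (drawX K h S cx) (drawY K h S cy) x := by
  have hS := D.pos
  by_cases h1 : x < K
  · have h2 := D.inside_x x h1
    have h3 := D.inside_y x h1
    have e1 : drawX K h S cx x = cx x := if_pos h1
    have e2 : drawY K h S cy x = cy x := if_pos h1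
    refine ⟨by omega, by omega, fun s ε => Or.inr ?_⟩
    rw [e1, e2]
    cases s <;> cases ε <;> simp only [sg, cond_true, cond_false] <;> omega
  · obtain ⟨s, ε, rfl⟩ : ∃ s ε, x = lab K h s ε 0 := by
      rcases hx with hx | ⟨hx, hx'⟩
      · rcases Nat.eq_or_lt_of_le (show K ≤ x by omega) with rfl | h2
        · exact ⟨false, false, rfl⟩
        · exact ⟨false, true, by rw [lab_left]; simp; omega⟩
      · by_cases h2 : x + 2 = K + 4 * h
        · exact ⟨true, false, by rw [lab_right]; simp; omega⟩
        · exact ⟨true, true, by rw [lab_right]; simp; omega⟩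
    have H := isNested_draw (K := K) (h := h) (cx := cx) (cy := cy) hS hh
    have a := H.hx s ε 0 (by omega)
    have b := H.hy s ε 0 (by omega)
    refine ⟨?_, ?_, fun s' ε' => ?_⟩
    · cases s <;> simp only [sg, cond_true, cond_false] at a <;> omega
    · cases ε <;> simp only [sg, cond_true, cond_false] at b <;> omega
    · by_cases hs : s' = s
      · by_cases hε : ε' = ε
        · left; rw [hs, hε]
        · right
          obtain rfl : ε' = !ε := by cases ε <;> cases ε' <;> simp_all
          subst hs
          cases s' <;> cases ε <;>
            simp only [sg, Bool.not_true, Bool.not_false, cond_true, cond_false] at a b ⊢ <;> omega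
      · right
        obtain rfl : s' = !s := by cases s <;> cases s' <;> simp_all
        cases s <;> cases ε <;> cases ε' <;>
          simp only [sg, Bool.not_true, Bool.not_false, cond_true, cond_false] at a b ⊢ <;> omega

/-- The graph with a ladder of `2 h` rungs is planar. -/
theorem isPlanar (D : IsSquareDrawing adj K S cx cy) (hh : 2 ≤ h) {n : ℕ} (hn : n = 2 * h) :
    (natGraph (Adj adj K n) Adj.symm (Adj.irrefl (by omega) D.irrefl) (K + 2 * n)).IsPlanar := by
  subst hn
  have H := isNested_draw (K := K) (h := h) (cx := cx) (cy := cy) D.pos hh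
  have cases : ∀ x y, Adj adj K (2 * h) x y →
      (IsCore K h x ∧ IsCore K h y ∧ adj (coreLabel K h x) (coreLabel K h y)) ∨
      OuterEdge K h x y ∨ OuterEdge K h y x := by
    rintro x y (h | h)
    · exact edge_cases D.adj_left D.adj_right hh h
    · rcases edge_cases D.adj_left D.adj_right hh h with ⟨h1, h2, h3⟩ | h | h
      · exact Or.inl ⟨h2, h1, D.symm _ _ h3⟩
      · exact Or.inr (Or.inr h)
      · exact Or.inr (Or.inl h)
  refine isPlanar_of_sep _ _ (drawX K h S cx) (drawY K h S cy) ?_ ?_ ?_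
  · intro u v u' v' h₁ h₂ hne
    have co : ∀ {u v u' v'}, (IsCore K h u ∧ IsCore K h v ∧
        adj (coreLabel K h u) (coreLabel K h v)) → OuterEdge K h u' v' ∨ OuterEdge K h v' u' →
        EdgeSep (drawX K h S cx) (drawY K h S cy) u v u' v' := by
      rintro u v u' v' ⟨h1, h2, -⟩ (h | h)
      · exact H.inside_outer (D.isInside hh h1) (D.isInside hh h2) h
      · exact (H.inside_outer (D.isInside hh h1) (D.isInside hh h2) h).swap_right
    rcases cases u v h₁ with c₁ | c₁
    · rcases cases u' v' h₂ with c₂ | c₂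
      · obtain ⟨a1, a2, a3⟩ := c₁
        obtain ⟨b1, b2, b3⟩ := c₂
        obtain ⟨α, β, hs⟩ := D.sep _ _ _ _ a3 b3 (by
          intro e
          apply hne
          rcases Sym2.eq_iff.1 e with ⟨e1, e2⟩ | ⟨e1, e2⟩
          · rw [coreLabel_injOn a1 b1 e1, coreLabel_injOn a2 b2 e2]
          · rw [coreLabel_injOn a1 b2 e1, coreLabel_injOn a2 b1 e2, Sym2.eq_swap])
        refine ⟨α, β, fun e f he hf => ?_⟩
        have ce : IsCore K h e := by rcases he with rfl | rfl <;> assumption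
        have cf : IsCore K h f := by rcases hf with rfl | rfl <;> assumption
        rw [(D.draw_coreLabel hh ce).1, (D.draw_coreLabel hh ce).2, (D.draw_coreLabel hh cf).1,
          (D.draw_coreLabel hh cf).2]
        exact (hs _ _ (he.imp (congrArg _) (congrArg _)) (hf.imp (congrArg _) (congrArg _))).imp
          (coreLabel_injOn ce cf) id
      · exact co c₁ c₂
    · rcases cases u' v' h₂ with c₂ | c₂
      · exact (co c₂ c₁).symm
      · rcases c₁ with c₁ | c₁
        · rcases c₂ with c₂ | c₂
          · exact H.outer_outer c₁ c₂ hne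
          · exact (H.outer_outer c₁ c₂ (by rwa [Sym2.eq_swap (a := v')])).swap_right
        · rcases c₂ with c₂ | c₂
          · exact (H.outer_outer c₁ c₂ (by rwa [Sym2.eq_swap (a := v)])).swap_left
          · exact (H.outer_outer c₁ c₂ (by
              rwa [Sym2.eq_swap (a := v), Sym2.eq_swap (a := v')])).swap_left.swap_right
  · intro u v h₁
    rcases cases u v h₁ with ⟨a1, a2, a3⟩ | c | c
    · rw [(D.draw_coreLabel hh a1).1, (D.draw_coreLabel hh a1).2, (D.draw_coreLabel hh a2).1,
        (D.draw_coreLabel hh a2).2]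
      exact D.ne _ _ a3
    · exact H.outer_ne c
    · exact (H.outer_ne c).imp Ne.symm Ne.symm
  · intro u hu
    by_cases h1 : u < K
    · obtain ⟨y, hy, hxy⟩ := D.exists_adj u h1
      by_cases h2 : y < K + 2
      · exact ⟨y, by omega, Or.inl (Or.inl ⟨h1, h2, hxy⟩)⟩
      · refine ⟨y + 2 * (2 * h) - 4, by omega, Or.inl (Or.inr (Or.inl ⟨h1, by omega, by omega, ?_⟩))⟩
        have e : y + 2 * (2 * h) - 4 + 4 - 2 * (2 * h) = y := by omega
        rwa [e]
    · by_cases h2 : u + 2 < K + 2 * (2 * h)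
      · exact ⟨u + 2, h2, Or.inl (Or.inr (Or.inr (Or.inl ⟨by omega, rfl, h2⟩)))⟩
      · exact ⟨u - 2, by omega, Or.inr (Or.inr (Or.inr (Or.inl ⟨by omega, by omega, by omega⟩)))⟩

end IsSquareDrawing

end Ladder

/-! ### Checking a straight-line drawing -/

namespace DrawingCheck

open PathSearch

/-- A segment from the point `(x₁, y₁)` with label `l₁` to the point `(x₂, y₂)` with label `l₂`. -/
structure Seg where
  l₁ : ℕ
  x₁ : ℕ
  y₁ : ℕ
  l₂ : ℕ
  x₂ : ℕ
  y₂ : ℕ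

/-- All of `a₁`, `a₂` are smaller than all of `b₁`, `b₂`. -/
def allLt (a₁ a₂ b₁ b₂ : ℕ) : Bool :=
  and (Nat.blt a₁ b₁) (and (Nat.blt a₁ b₂) (and (Nat.blt a₂ b₁) (Nat.blt a₂ b₂)))

/-- Equal labels, or the functional with coefficients `α₁ - α₂`, `β₁ - β₂` increases. -/
def ltOrEq (α₁ α₂ β₁ β₂ l x y m u v : ℕ) : Bool :=
  or (Nat.beq l m) (Nat.blt
    (Nat.add (Nat.add (Nat.mul α₁ x) (Nat.mul α₂ u)) (Nat.add (Nat.mul β₁ y) (Nat.mul β₂ v)))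
    (Nat.add (Nat.add (Nat.mul α₁ u) (Nat.mul α₂ x)) (Nat.add (Nat.mul β₁ v) (Nat.mul β₂ y))))

/-- The functional with coefficients `α₁ - α₂`, `β₁ - β₂` separates `s` from `t`. -/
def sepWith (s t : Seg) (α₁ α₂ β₁ β₂ : ℕ) : Bool :=
  and (ltOrEq α₁ α₂ β₁ β₂ s.l₁ s.x₁ s.y₁ t.l₁ t.x₁ t.y₁)
  (and (ltOrEq α₁ α₂ β₁ β₂ s.l₁ s.x₁ s.y₁ t.l₂ t.x₂ t.y₂)
  (and (ltOrEq α₁ α₂ β₁ β₂ s.l₂ s.x₂ s.y₂ t.l₁ t.x₁ t.y₁)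
    (ltOrEq α₁ α₂ β₁ β₂ s.l₂ s.x₂ s.y₂ t.l₂ t.x₂ t.y₂)))

/-- `sepWith` for a functional and its negative. -/
def sepBoth (s t : Seg) (α₁ α₂ β₁ β₂ : ℕ) : Bool :=
  or (sepWith s t α₁ α₂ β₁ β₂) (sepWith s t α₂ α₁ β₂ β₁)

/-- `sepBoth` for a functional that is suited to segments with the common end `(x, y)`. -/
def sepCommon (s t : Seg) (x y : ℕ) : Bool :=
  sepBoth s t (Nat.mul 4 y) (Nat.add (Nat.add s.y₁ s.y₂) (Nat.add t.y₁ t.y₂))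
    (Nat.add (Nat.add s.x₁ s.x₂) (Nat.add t.x₁ t.x₂)) (Nat.mul 4 x)

/-- Some functional among the obvious candidates separates `s` from `t`. -/
def sepSeg (s t : Seg) : Bool :=
  or (allLt s.x₁ s.x₂ t.x₁ t.x₂) (or (allLt t.x₁ t.x₂ s.x₁ s.x₂) (or (allLt s.y₁ s.y₂ t.y₁ t.y₂)
    (or (allLt t.y₁ t.y₂ s.y₁ s.y₂) (or (sepBoth s t s.y₁ s.y₂ s.x₂ s.x₁)
    (or (sepBoth s t t.y₁ t.y₂ t.x₂ t.x₁)
    (bif or (Nat.beq s.l₁ t.l₁) (Nat.beq s.l₁ t.l₂) then sepCommon s t s.x₁ s.y₁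
      else sepCommon s t s.x₂ s.y₂))))))

/-- The segment `s` is part of the drawing with coordinates `cx`, `cy`. -/
def Seg.Drawn (s : Seg) (cx cy : ℕ → ℤ) : Prop :=
  cx s.l₁ = s.x₁ ∧ cy s.l₁ = s.y₁ ∧ cx s.l₂ = s.x₂ ∧ cy s.l₂ = s.y₂

variable {cx cy : ℕ → ℤ} {s t : Seg}

theorem ltOrEq_sound {α₁ α₂ β₁ β₂ l x y m u v : ℕ} (h : ltOrEq α₁ α₂ β₁ β₂ l x y m u v = true)
    (hx : cx l = x) (hy : cy l = y) (hu : cx m = u) (hv : cy m = v) :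
    l = m ∨ ((α₁ : ℤ) - α₂) * cx l + ((β₁ : ℤ) - β₂) * cy l <
      ((α₁ : ℤ) - α₂) * cx m + ((β₁ : ℤ) - β₂) * cy m := by
  rw [ltOrEq, Bool.or_eq_true, beq_iff, Nat.blt_eq] at h
  refine h.imp id fun h => ?_
  change (α₁ * x + α₂ * u) + (β₁ * y + β₂ * v) < (α₁ * u + α₂ * x) + (β₁ * v + β₂ * y) at h
  zify at h
  rw [hx, hy, hu, hv]
  linarith

theorem sepWith_sound {α₁ α₂ β₁ β₂ : ℕ} (h : sepWith s t α₁ α₂ β₁ β₂ = true)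
    (hs : s.Drawn cx cy) (ht : t.Drawn cx cy) : EdgeSep cx cy s.l₁ s.l₂ t.l₁ t.l₂ := by
  simp only [sepWith, Bool.and_eq_true] at h
  obtain ⟨h1, h2, h3, h4⟩ := h
  exact .of_four _ _ (ltOrEq_sound h1 hs.1 hs.2.1 ht.1 ht.2.1)
    (ltOrEq_sound h2 hs.1 hs.2.1 ht.2.2.1 ht.2.2.2)
    (ltOrEq_sound h3 hs.2.2.1 hs.2.2.2 ht.1 ht.2.1)
    (ltOrEq_sound h4 hs.2.2.1 hs.2.2.2 ht.2.2.1 ht.2.2.2)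

theorem sepBoth_sound {α₁ α₂ β₁ β₂ : ℕ} (h : sepBoth s t α₁ α₂ β₁ β₂ = true)
    (hs : s.Drawn cx cy) (ht : t.Drawn cx cy) : EdgeSep cx cy s.l₁ s.l₂ t.l₁ t.l₂ := by
  rw [sepBoth, Bool.or_eq_true] at h
  exact h.elim (sepWith_sound · hs ht) (sepWith_sound · hs ht)

theorem sepSeg_sound (h : sepSeg s t = true) (hs : s.Drawn cx cy) (ht : t.Drawn cx cy) :
    EdgeSep cx cy s.l₁ s.l₂ t.l₁ t.l₂ := by
  have hs' := hs
  have ht' := ht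
  obtain ⟨a1, a2, a3, a4⟩ := hs'
  obtain ⟨b1, b2, b3, b4⟩ := ht'
  simp only [sepSeg, Bool.or_eq_true, allLt, Bool.and_eq_true, Nat.blt_eq] at h
  rcases h with h | h | h | h | h | h | h
  · refine .of_four 1 0 ?_ ?_ ?_ ?_ <;> right <;> omega
  · refine EdgeSep.symm (.of_four 1 0 ?_ ?_ ?_ ?_) <;> right <;> omega
  · refine .of_four 0 1 ?_ ?_ ?_ ?_ <;> right <;> omega
  · refine EdgeSep.symm (.of_four 0 1 ?_ ?_ ?_ ?_) <;> right <;> omega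
  · exact sepBoth_sound h hs ht
  · exact sepBoth_sound h hs ht
  · cases hc : (Nat.beq s.l₁ t.l₁ || Nat.beq s.l₁ t.l₂) with
    | true =>
      rw [hc, cond_true, sepCommon] at h
      exact sepBoth_sound h hs ht
    | false =>
      rw [hc, cond_false, sepCommon] at h
      exact sepBoth_sound h hs ht

/-- All pairs of members of a list of segments are separated. -/
def allPairs : List Seg → Bool
  | [] => true
  | s :: l => and (l.all (sepSeg s)) (allPairs l)

theorem allPairs_sound {l : List Seg} (h : allPairs l = true) :
    l.Pairwise fun s t => sepSeg s t = true := by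
  induction l with
  | nil => exact List.Pairwise.nil
  | cons s l ih =>
    rw [allPairs, Bool.and_eq_true, List.all_eq_true] at h
    exact List.Pairwise.cons h.1 (ih h.2)

/-- Evaluation of a list of points. -/
def forcePoints : List (ℕ × ℕ) → (List (ℕ × ℕ) → Bool) → Bool
  | [], k => k []
  | p :: l, k => eager p.1 fun x => eager p.2 fun y => forcePoints l fun l' => k ((x, y) :: l')

theorem forcePoints_eq (l : List (ℕ × ℕ)) (k : List (ℕ × ℕ) → Bool) : forcePoints l k = k l := by
  induction l generalizing k with
  | nil => rfl
  | cons p l ih => simp only [forcePoints, eager_eq, ih]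

/-- The segment of an edge. -/
def mkSeg (pts : List (ℕ × ℕ)) (e : ℕ × ℕ) : Seg :=
  ⟨e.1, (pts.getD e.1 (0, 0)).1, (pts.getD e.1 (0, 0)).2,
    e.2, (pts.getD e.2 (0, 0)).1, (pts.getD e.2 (0, 0)).2⟩

/-- Evaluation of the list of the segments of a list of edges. -/
def forceSegs (pts : List (ℕ × ℕ)) : List (ℕ × ℕ) → (List Seg → Bool) → Bool
  | [], k => k []
  | e :: l, k => eager e.1 fun u => eager e.2 fun v =>
      eager (pts.getD u (0, 0)).1 fun x => eager (pts.getD u (0, 0)).2 fun y =>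
      eager (pts.getD v (0, 0)).1 fun x' => eager (pts.getD v (0, 0)).2 fun y' =>
      forceSegs pts l fun l' => k (⟨u, x, y, v, x', y'⟩ :: l')

theorem forceSegs_eq (pts l : List (ℕ × ℕ)) (k : List Seg → Bool) :
    forceSegs pts l k = k (l.map (mkSeg pts)) := by
  induction l generalizing k with
  | nil => rfl
  | cons p l ih =>
    simp only [forceSegs, eager_eq, ih]
    rfl

/-- The point `p` lies strictly inside the square of side length `S`. -/
def inSquare (S : ℕ) (p : ℕ × ℕ) : Bool :=
  and (and (Nat.blt 0 p.1) (Nat.blt p.1 S)) (and (Nat.blt 0 p.2) (Nat.blt p.2 S))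

/-- The ends of `s` are different points. -/
def nondegenerate (s : Seg) : Bool := not (and (Nat.beq s.x₁ s.x₂) (Nat.beq s.y₁ s.y₂))

/-- The corners of a square. -/
def corners (S : ℕ) : List (ℕ × ℕ) := [(0, 0), (0, S), (S, 0), (S, S)]

/-- Conditions on the segments of a drawing with `K` inner vertices. -/
def segsOK (K : ℕ) (segs : List Seg) : Bool :=
  and (allPairs segs) (and (segs.all nondegenerate) (and
    (segs.all fun s => and (Nat.blt s.l₁ (Nat.add K 4)) (Nat.blt s.l₂ (Nat.add K 4)))
    ((List.range K).all fun x => segs.any fun s => or (Nat.beq s.l₁ x) (Nat.beq s.l₂ x))))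

/-- Checks a drawing of the edges `E`, with inner vertices at the points `pre`. -/
def check (pre E : List (ℕ × ℕ)) (K S : ℕ) : Bool :=
  eager S fun S => eager K fun K => forcePoints pre fun pre =>
    and (and (Nat.beq pre.length K) (pre.all (inSquare S)))
      (forceSegs (pre ++ corners S) E (segsOK K))

/-- Adjacency for a list of edges. -/
def ListAdj (E : List (ℕ × ℕ)) (x y : ℕ) : Prop := (x, y) ∈ E ∨ (y, x) ∈ E

theorem check_sound {pre E : List (ℕ × ℕ)} {K S : ℕ} (h : check pre E K S = true) (hS : 0 < S)
    (hl : (K, K + 1) ∈ E) (hr : (K + 2, K + 3) ∈ E) :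
    Ladder.IsSquareDrawing (ListAdj E) K S (fun x => ((pre ++ corners S).getD x (0, 0)).1)
      (fun x => ((pre ++ corners S).getD x (0, 0)).2) := by
  simp only [check, eager_eq, forcePoints_eq, forceSegs_eq, segsOK, Bool.and_eq_true, beq_iff,
    List.all_eq_true, List.any_eq_true, Bool.or_eq_true, Nat.blt_eq, List.mem_range,
    List.forall_mem_map] at h
  obtain ⟨⟨hlen, hin⟩, hpairs, hnd, hlt, hdeg⟩ := h
  set pts := pre ++ corners S with hpts
  set cx : ℕ → ℤ := fun x => ((pts.getD x (0, 0)).1 : ℤ) with hcx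
  set cy : ℕ → ℤ := fun x => ((pts.getD x (0, 0)).2 : ℤ) with hcy
  have drawn : ∀ e, (mkSeg pts e).Drawn cx cy := fun e => ⟨rfl, rfl, rfl, rfl⟩
  have inside : ∀ x < K, inSquare S (pts.getD x (0, 0)) = true := by
    intro x hx
    have : pts.getD x (0, 0) = pre[x]'(by omega) := by
      rw [hpts, List.getD_append _ _ _ _ (by omega), List.getD_eq_getElem]
    rw [this]
    exact hin _ (List.getElem_mem _)
  have corner : ∀ i, pts.getD (K + i) (0, 0) = (corners S).getD i (0, 0) := by
    intro i
    rw [hpts, List.getD_append_right _ _ _ _ (by omega)]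
    congr 1
    omega
  have ne : ∀ e ∈ E, cx e.1 ≠ cx e.2 ∨ cy e.1 ≠ cy e.2 := by
    intro e he
    have := hnd e he
    by_contra hno
    push Not at hno
    have e1 : (mkSeg pts e).x₁ = (mkSeg pts e).x₂ := Int.ofNat_inj.1 hno.1
    have e2 : (mkSeg pts e).y₁ = (mkSeg pts e).y₂ := Int.ofNat_inj.1 hno.2
    rw [nondegenerate, e1, e2, beq_iff.2 rfl, beq_iff.2 rfl] at this
    simp at this
  have sep : ∀ e ∈ E, ∀ f ∈ E, e ≠ f → EdgeSep cx cy e.1 e.2 f.1 f.2 := by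
    have hp := List.pairwise_map.1 (allPairs_sound hpairs)
    have hp' : E.Pairwise fun e f => EdgeSep cx cy e.1 e.2 f.1 f.2 :=
      hp.imp fun h => sepSeg_sound h (drawn _) (drawn _)
    intro e he f hf hne
    have : Std.Symm fun e f : ℕ × ℕ => EdgeSep cx cy e.1 e.2 f.1 f.2 := ⟨fun _ _ h => h.symm⟩
    exact hp'.forall he hf hne
  refine ⟨fun x y => Or.symm, fun x hx => ?_, by exact_mod_cast hS, Or.inl hl, Or.inl hr,
    fun x hx => ?_, fun x hx => ?_, fun x hx => ?_, ?_, ?_, fun x y hxy => ?_, ?_⟩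
  · rcases hx with hx | hx <;> exact (ne _ hx).elim (· rfl) (· rfl)
  · obtain ⟨s, hs, h⟩ := hdeg x hx
    obtain ⟨e, he, rfl⟩ := List.mem_map.1 hs
    rcases h with h | h
    · exact ⟨e.2, (hlt e he).2, Or.inl (by rw [← h]; exact he)⟩
    · exact ⟨e.1, (hlt e he).1, Or.inr (by rw [← h]; exact he)⟩
  · have := inside x hx
    simp only [inSquare, Bool.and_eq_true, Nat.blt_eq] at this
    exact ⟨Int.ofNat_lt.2 this.1.1, Int.ofNat_lt.2 this.1.2⟩
  · have := inside x hx
    simp only [inSquare, Bool.and_eq_true, Nat.blt_eq] at this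
    exact ⟨Int.ofNat_lt.2 this.2.1, Int.ofNat_lt.2 this.2.2⟩
  · simp only [hcx, corner]
    have := corner 0
    rw [Nat.add_zero] at this
    rw [this]
    exact ⟨rfl, rfl, rfl, rfl⟩
  · simp only [hcy, corner]
    have := corner 0
    rw [Nat.add_zero] at this
    rw [this]
    exact ⟨rfl, rfl, rfl, rfl⟩
  · rcases hxy with h | h
    · exact ne _ h
    · exact (ne _ h).imp Ne.symm Ne.symm
  · intro u v u' v' h₁ h₂ hne
    rcases h₁ with h₁ | h₁ <;> rcases h₂ with h₂ | h₂
    · exact sep _ h₁ _ h₂ (by rintro ⟨⟩; exact hne rfl)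
    · exact (sep _ h₁ _ h₂ (by rintro ⟨⟩; exact hne Sym2.eq_swap)).swap_right
    · exact (sep _ h₁ _ h₂ (by rintro ⟨⟩; exact hne Sym2.eq_swap)).swap_left
    · exact (sep _ h₁ _ h₂ (by rintro ⟨⟩; exact hne rfl)).swap_left.swap_right

end DrawingCheck

/-! ### The graphs -/

namespace Construction

open PathSearch DrawingCheck Ladder

/-- The number of vertices of a piece without a ladder. -/
def size (g : Bool) : ℕ := bif g then 38 else 35

/-- The adjacency matrix of a piece without a ladder. -/
def mat (g : Bool) : ℕ := bif g then largeMat else smallMat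

/-- The third terminal of a piece without a ladder. -/
def third (g : Bool) : ℕ := bif g then 2 else 31

theorem isPiece_mat (g : Bool) :
    IsPiece (MatAdj (mat g) (size g + 1) (size g)) (size g) 1 (third g) := by
  cases g
  · exact isPiece_small
  · exact isPiece_large

theorem size_bounds (g : Bool) : 35 ≤ size g ∧ size g ≤ 38 := by cases g <;> decide

/-- The pieces of the graph. -/
def pieceAdj (p q r : Bool) (k : ℕ) : Bool → Bool → ℕ → ℕ → Prop
  | false, false => MatAdj (mat p) (size p + 1) (size p)
  | false, true => MatAdj (mat q) (size q + 1) (size q)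
  | true, false => MatAdj (mat r) (size r + 1) (size r)
  | true, true => Adj (MatAdj smallMat 36 35) 31 (4 + 2 * k)

/-- The numbers of vertices of the pieces. -/
def pieceSize (p q r : Bool) (k : ℕ) : Bool → Bool → ℕ
  | false, false => size p
  | false, true => size q
  | true, false => size r
  | true, true => 31 + 2 * (4 + 2 * k)

/-- The third terminals of the pieces. -/
def pieceThird (p q r : Bool) : Bool → Bool → ℕ
  | false, false => third p
  | false, true => third q
  | true, false => third r
  | true, true => 31

/-- The positions of the labels of the pieces. -/
def pieceOffset (p q r : Bool) : Bool → Bool → ℕ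
  | false, false => 1
  | false, true => size p
  | true, false => size p + size q - 1
  | true, true => size p + size q + size r - 2

theorem isPiece_pieceAdj (p q r : Bool) (k : ℕ) (i j : Bool) :
    IsPiece (pieceAdj p q r k i j) (pieceSize p q r k i j) 1 (pieceThird p q r i j) := by
  cases i <;> cases j
  · exact isPiece_mat p
  · exact isPiece_mat q
  · exact isPiece_mat r
  · exact Ladder.isPiece k

theorem isLayout (p q r : Bool) (k : ℕ) : IsLayout (pieceSize p q r k) (pieceOffset p q r) := by
  have hp := size_bounds p
  have hq := size_bounds q
  have hr := size_bounds r
  constructor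
  · intro i j
    cases i <;> cases j <;> simp only [pieceOffset] <;> omega
  · rintro i j i' j' x ⟨h1, h2⟩ ⟨h3, h4⟩
    cases i <;> cases j <;> cases i' <;> cases j' <;>
      simp only [pieceOffset, pieceSize, and_self, and_true, and_false,
        reduceCtorEq] at * <;> omega

/-- The number of labels before the ladder. -/
def ladderStart (p q r : Bool) : ℕ := pieceOffset p q r true true + 31

theorem mem_carrier_iff (p q r : Bool) (k x : ℕ) :
    x ∈ Assembly.carrier (glueSet (pieceSize p q r k) (pieceOffset p q r)) Bool.toNat ↔
      x < ladderStart p q r + 2 * (4 + 2 * k) := by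
  have hp := size_bounds p
  have hq := size_bounds q
  have hr := size_bounds r
  simp only [Assembly.carrier, glueSet, Set.mem_ofPred_eq, Bool.exists_bool, Bool.toNat_false,
    Bool.toNat_true, pieceOffset, pieceSize, ladderStart]
  omega

/-- The edges of a graph given by a matrix, with vertices renamed. -/
def matEdges (M N : ℕ) (f : ℕ → ℕ) : List (ℕ × ℕ) :=
  (List.range N).flatMap fun u => ((List.range N).filter fun v =>
    and (Nat.blt u v) (bit M (Nat.add (Nat.mul (Nat.succ N) u) v))).map fun v => (f u, f v)

theorem mem_matEdges {M N : ℕ} {f : ℕ → ℕ} {u v : ℕ} (h : MatAdj M (N + 1) N u v) (huv : u < v) :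
    (f u, f v) ∈ matEdges M N f := by
  simp only [matEdges, List.mem_flatMap, List.mem_map, List.mem_filter, List.mem_range,
    Bool.and_eq_true, Nat.blt_eq, bit_eq]
  exact ⟨u, h.1, v, ⟨h.2.1, huv, h.2.2⟩, rfl⟩

/-- The edges of the graph with a ladder of two rungs. -/
def edges (p q r : Bool) : List (ℕ × ℕ) :=
  matEdges (mat p) (size p) (glueLabel (pieceOffset p q r) false false) ++
  matEdges (mat q) (size q) (glueLabel (pieceOffset p q r) false true) ++
  matEdges (mat r) (size r) (glueLabel (pieceOffset p q r) true false) ++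
  matEdges smallMat 35 (glueLabel (pieceOffset p q r) true true) ++
  [(pieceOffset p q r false false + 1, pieceOffset p q r true false + 1),
    (pieceOffset p q r false false + third p, pieceOffset p q r true false + third r),
    (pieceOffset p q r false true + 1, pieceOffset p q r true true + 1),
    (pieceOffset p q r false true + third q, pieceOffset p q r true true + 31)]

/-- Barycentric coordinates for a drawing of the graph `smallMat` in a triangle. -/
def smallPoints : List (ℕ × ℕ × ℕ) :=
  [(120, 0, 0), (0, 120, 0), (45, 33, 42), (48, 28, 44), (59, 25, 36), (58, 32, 30), (45, 39, 36),
  (71, 14, 35), (71, 33, 16), (34, 36, 50), (32, 39, 49), (29, 37, 54), (34, 32, 54), (40, 25,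
  55), (38, 30, 52), (12, 73, 35), (21, 62, 37), (29, 60, 31), (34, 66, 20), (34, 49, 37), (38,
  51, 31), (30, 53, 37), (28, 50, 42), (29, 45, 46), (34, 43, 43), (24, 52, 44), (39, 39, 42),
  (40, 33, 47), (23, 43, 54), (38, 36, 46), (27, 42, 51), (0, 0, 120), (35, 18, 67), (16, 37, 67),
  (28, 31, 61)]

/-- Barycentric coordinates for a drawing of the graph `largeMat` in a triangle. -/
def largePoints : List (ℕ × ℕ × ℕ) :=
  [(120, 0, 0), (0, 120, 0), (0, 0, 120), (16, 35, 69), (28, 29, 63), (39, 25, 56), (46, 28, 46),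
  (58, 25, 37), (71, 14, 35), (35, 17, 68), (33, 40, 47), (30, 40, 50), (29, 45, 46), (32, 47,
  41), (35, 42, 43), (36, 30, 54), (32, 31, 57), (32, 37, 51), (34, 38, 48), (33, 37, 50), (71,
  34, 15), (57, 33, 30), (34, 53, 33), (24, 57, 39), (13, 71, 36), (35, 69, 16), (37, 34, 49),
  (37, 37, 46), (38, 40, 42), (43, 40, 37), (42, 34, 44), (23, 40, 57), (27, 38, 55), (29, 34,
  57), (34, 35, 51), (32, 34, 54), (31, 35, 54), (26, 47, 47)]

/-- Coordinates of the vertices of the graph `smallMat` outside the 4-cycle, in a square. -/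
def innerPoints : List (ℕ × ℕ) :=
  [(28, 18), (24, 36), (19, 38), (17, 35), (22, 31), (27, 32), (11, 36), (22, 26), (35, 38), (38,
  35), (43, 37), (37, 43), (15, 43), (27, 41), (38, 12), (37, 17), (33, 21), (28, 23), (33, 27),
  (29, 27), (34, 24), (37, 23), (38, 26), (35, 30), (39, 18), (31, 33), (27, 38), (44, 15), (31,
  36), (41, 26)]

/-- The combination of three points with given coefficients. -/
def comb (A B C : ℕ × ℕ) (t : ℕ × ℕ × ℕ) : ℕ × ℕ :=
  (t.1 * A.1 + t.2.1 * B.1 + t.2.2 * C.1, t.1 * A.2 + t.2.1 * B.2 + t.2.2 * C.2)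

/-- A point in the triangle that contains all pieces but one. -/
def place (x y : ℕ) : ℕ × ℕ := comb (16, 24) (18, 18) (11, 14) (12 - x - y, x, y)

/-- The drawing of a piece, without the first vertex, in a triangle. -/
def piecePoints (g : Bool) (A B C : ℕ × ℕ) : List (ℕ × ℕ) :=
  (bif g then largePoints else smallPoints).tail.map (comb A B C)

/-- The points for the vertices before the ladder. -/
def points (p q r : Bool) : List (ℕ × ℕ) :=
  [comb (place 4 4) (0, 0) (0, 0) (120, 0, 0), comb (place 0 0) (0, 0) (0, 0) (120, 0, 0)] ++
  (piecePoints p (place 4 4) (place 3 2) (place 2 3) ++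
  (piecePoints q (place 4 4) (place 12 0) (place 0 12) ++
  (piecePoints r (place 0 0) (place 2 1) (place 1 2) ++
  innerPoints.map fun a => (1440 * a.1, 1440 * a.2))))

theorem check_small_small_small : check (points false false false) (edges false false false)
    (ladderStart false false false) 72000 = true := by
  decide +kernel

theorem check_large_small_small : check (points true false false) (edges true false false)
    (ladderStart true false false) 72000 = true := by
  decide +kernel

theorem check_large_large_small : check (points true true false) (edges true true false)
    (ladderStart true true false) 72000 = true := by
  decide +kernel

theorem check_large_large_large : check (points true true true) (edges true true true)
    (ladderStart true true true) 72000 = true := by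
  decide +kernel

theorem listAdj_of_matAdj {g : Bool} {E : List (ℕ × ℕ)} {f : ℕ → ℕ}
    (hE : ∀ e ∈ matEdges (mat g) (size g) f, e ∈ E) {u v : ℕ}
    (h : MatAdj (mat g) (size g + 1) (size g) u v) : ListAdj E (f u) (f v) := by
  rcases Nat.lt_trichotomy u v with huv | rfl | huv
  · exact Or.inl (hE _ (mem_matEdges h huv))
  · exact ((isPiece_mat g).irrefl u h).elim
  · exact Or.inr (hE _ (mem_matEdges ((isPiece_mat g).symm _ _ h) huv))

theorem listAdj_edges (p q r : Bool) {u v : ℕ} :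
    (MatAdj (mat p) (size p + 1) (size p) u v → ListAdj (edges p q r)
      (glueLabel (pieceOffset p q r) false false u) (glueLabel (pieceOffset p q r) false false v)) ∧
    (MatAdj (mat q) (size q + 1) (size q) u v → ListAdj (edges p q r)
      (glueLabel (pieceOffset p q r) false true u) (glueLabel (pieceOffset p q r) false true v)) ∧
    (MatAdj (mat r) (size r + 1) (size r) u v → ListAdj (edges p q r)
      (glueLabel (pieceOffset p q r) true false u) (glueLabel (pieceOffset p q r) true false v)) ∧
    (MatAdj smallMat 36 35 u v → ListAdj (edges p q r)
      (glueLabel (pieceOffset p q r) true true u) (glueLabel (pieceOffset p q r) true true v)) := by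
  refine ⟨listAdj_of_matAdj ?_, listAdj_of_matAdj ?_, listAdj_of_matAdj ?_,
    listAdj_of_matAdj (g := false) ?_⟩
  all_goals
    intro e he
    simp only [edges, List.mem_append]
  · exact Or.inl (Or.inl (Or.inl (Or.inl he)))
  · exact Or.inl (Or.inl (Or.inl (Or.inr he)))
  · exact Or.inl (Or.inl (Or.inr he))
  · exact Or.inl (Or.inr he)

theorem glueLabel_lt (p q r : Bool) {i j : Bool} (hij : ¬ (i = true ∧ j = true)) {k x : ℕ}
    (hx : x < pieceSize p q r k i j) :
    glueLabel (pieceOffset p q r) i j x < ladderStart p q r := by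
  have hp := size_bounds p
  have hq := size_bounds q
  have hr := size_bounds r
  have hi := i.toNat_le
  unfold glueLabel
  cases i <;> cases j <;> simp only [pieceSize, pieceOffset, ladderStart, not_true, and_self] at * <;>
    split_ifs <;> omega

theorem edge_glueLabel (p q r : Bool) {n u v : ℕ} (hn : 4 ≤ n)
    (h : Edge (MatAdj smallMat 36 35) 31 n u v) :
    Edge (ListAdj (edges p q r)) (ladderStart p q r) n
      (glueLabel (pieceOffset p q r) true true u) (glueLabel (pieceOffset p q r) true true v) := by
  have hp := size_bounds p
  have hs : ladderStart p q r = pieceOffset p q r true true + 31 := rfl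
  have ho : 1 ≤ pieceOffset p q r true true := (isLayout p q r 0).pos true true
  have lt : ∀ x, glueLabel (pieceOffset p q r) true true x ≤ pieceOffset p q r true true + x := by
    intro x
    unfold glueLabel
    split_ifs
    · simp; omega
    · omega
  have pos : ∀ x, 0 < x →
      glueLabel (pieceOffset p q r) true true x = pieceOffset p q r true true + x :=
    fun x hx => glueLabel_pos hx
  rcases h with ⟨h1, h2, h3⟩ | ⟨h1, h2, h3, h4⟩ | ⟨h1, h2, h3⟩ | ⟨h1, h2, h3, h4⟩
  · left
    have a := lt u
    have b := lt v
    exact ⟨by omega, by omega, (listAdj_edges p q r).2.2.2 h3⟩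
  · right; left
    have a := lt u
    rw [pos v (by omega)]
    refine ⟨by omega, by omega, by omega, ?_⟩
    have e : pieceOffset p q r true true + v + 4 - 2 * n =
        glueLabel (pieceOffset p q r) true true (v + 4 - 2 * n) := by
      rw [pos _ (by omega)]; omega
    rw [e]
    exact (listAdj_edges p q r).2.2.2 h4
  · right; right; left
    rw [pos u (by omega), pos v (by omega)]
    omega
  · right; right; right
    rw [pos u (by omega), pos v (by omega)]
    omega

/-- The glued graph is a subgraph of the graph with a ladder that is drawn. -/
theorem adj_of_glue (p q r : Bool) (k : ℕ) {x y : ℕ}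
    (h : Glue (pieceAdj p q r k) (fun _ _ => 1) (pieceThird p q r) (pieceOffset p q r) x y) :
    Adj (ListAdj (edges p q r)) (ladderStart p q r) (4 + 2 * k) x y := by
  have hpc := isPiece_pieceAdj p q r k
  have inner : ∀ {i j u v}, ¬ (i = true ∧ j = true) → u < pieceSize p q r k i j →
      v < pieceSize p q r k i j → ListAdj (edges p q r)
        (glueLabel (pieceOffset p q r) i j u) (glueLabel (pieceOffset p q r) i j v) →
      Adj (ListAdj (edges p q r)) (ladderStart p q r) (4 + 2 * k)
        (glueLabel (pieceOffset p q r) i j u) (glueLabel (pieceOffset p q r) i j v) :=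
    fun hij hu hv h => Or.inl (Or.inl ⟨glueLabel_lt p q r hij hu,
      (glueLabel_lt p q r hij hv).trans (by omega), h⟩)
  have t1 : ∀ d i j, 0 < d → d < pieceSize p q r k i j → ¬ (i = true ∧ j = true) →
      pieceOffset p q r i j + d < ladderStart p q r := by
    intro d i j h0 hd hij
    have := glueLabel_lt p q r hij hd
    rwa [glueLabel_pos h0] at this
  have mem : ∀ e ∈ [(pieceOffset p q r false false + 1, pieceOffset p q r true false + 1),
      (pieceOffset p q r false false + third p, pieceOffset p q r true false + third r),
      (pieceOffset p q r false true + 1, pieceOffset p q r true true + 1),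
      (pieceOffset p q r false true + third q, pieceOffset p q r true true + 31)],
      e ∈ edges p q r := fun e he => List.mem_append_right _ he
  have ff := t1 1 false false (by omega) (hpc false false).b_lt (by simp)
  have ft := t1 1 false true (by omega) (hpc false true).b_lt (by simp)
  have tf := t1 1 true false (by omega) (hpc true false).b_lt (by simp)
  have ff' := t1 (third p) false false (hpc false false).c_pos (hpc false false).c_lt (by simp)
  have ft' := t1 (third q) false true (hpc false true).c_pos (hpc false true).c_lt (by simp)
  have tf' := t1 (third r) true false (hpc true false).c_pos (hpc true false).c_lt (by simp)
  have tt : pieceOffset p q r true true + 31 = ladderStart p q r := rfl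
  rcases h with ⟨i, j, u, v, h, rfl, rfl⟩ | ⟨i, j, rfl, rfl⟩ | ⟨i, j, rfl, rfl⟩
  · have hu := (hpc i j).lt _ _ h
    have hv := (hpc i j).lt _ _ ((hpc i j).symm _ _ h)
    cases i <;> cases j
    · exact inner (by simp) hu hv ((listAdj_edges p q r).1 h)
    · exact inner (by simp) hu hv ((listAdj_edges p q r).2.1 h)
    · exact inner (by simp) hu hv ((listAdj_edges p q r).2.2.1 h)
    · exact h.imp (edge_glueLabel p q r (by omega)) (edge_glueLabel p q r (by omega))
  · rw [glueLabel_pos Nat.one_pos, glueLabel_pos Nat.one_pos]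
    cases i <;> cases j
    · exact Or.inl (Or.inl ⟨ff, tf.trans (by omega), Or.inl (mem _ (by simp))⟩)
    · exact Or.inl (Or.inl ⟨ft, by rw [← tt]; simp, Or.inl (mem _ (by simp))⟩)
    · exact Or.inl (Or.inl ⟨tf, ff.trans (by omega), Or.inr (mem _ (by simp))⟩)
    · exact Or.inr (Or.inl ⟨ft, by rw [← tt]; simp, Or.inl (mem _ (by simp))⟩)
  · rw [glueLabel_pos (hpc _ _).c_pos, glueLabel_pos (hpc _ _).c_pos]
    cases i <;> cases j
    · exact Or.inl (Or.inl ⟨ff', tf'.trans (by omega), Or.inl (mem _ (by simp [pieceThird]))⟩)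
    · exact Or.inl (Or.inl ⟨ft', by rw [← tt]; simp [pieceThird],
        Or.inl (mem _ (by simp [pieceThird]))⟩)
    · exact Or.inl (Or.inl ⟨tf', ff'.trans (by omega), Or.inr (mem _ (by simp [pieceThird]))⟩)
    · exact Or.inr (Or.inl ⟨ft', by rw [← tt]; simp [pieceThird],
        Or.inl (mem _ (by simp [pieceThird]))⟩)

theorem exists_graph {p q r : Bool}
    (h : check (points p q r) (edges p q r) (ladderStart p q r) 72000 = true) (k : ℕ) {T : ℕ}
    (hT : ladderStart p q r + 2 * (4 + 2 * k) = T) :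
    ∃ G : SimpleGraph (Fin T), G.IsPlanar ∧ G.IsHypotraceable := by
  subst hT
  have hpc := isPiece_pieceAdj p q r k
  have hl := isLayout p q r k
  refine ⟨_, ?_, isHypotraceable_glue hpc hl (by omega) (mem_carrier_iff p q r k)⟩
  have small : ∀ u v, u < v → MatAdj smallMat 36 35 u v →
      (glueLabel (pieceOffset p q r) true true u, glueLabel (pieceOffset p q r) true true v) ∈
        edges p q r := by
    intro u v huv h
    simp only [edges, List.mem_append]
    exact Or.inl (Or.inr (mem_matEdges (N := 35) h huv))
  have D := check_sound h (by omega) (small 31 32 (by omega) (by decide +kernel))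
    (small 33 34 (by omega) (by decide +kernel))
  exact (D.isPlanar (h := 2 + k) (by omega) (by omega)).mono fun u v huv => adj_of_glue p q r k huv

end Construction

theorem mainTheorem3 :
    (∃ G : SimpleGraph (Fin 154), G.IsPlanar ∧ G.IsHypotraceable) ∧
      ∀ n : ℕ, 156 ≤ n → ∃ G : SimpleGraph (Fin n), G.IsPlanar ∧ G.IsHypotraceable := by
  refine ⟨Construction.exists_graph Construction.check_small_small_small 3 (by decide),
    fun n hn => ?_⟩
  have e0 : Construction.ladderStart false false false = 134 := by decide
  have e1 : Construction.ladderStart true false false = 137 := by decide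
  have e2 : Construction.ladderStart true true false = 140 := by decide
  have e3 : Construction.ladderStart true true true = 143 := by decide
  rcases (by omega : n % 4 = 0 ∨ n % 4 = 1 ∨ n % 4 = 2 ∨ n % 4 = 3) with h | h | h | h
  · exact Construction.exists_graph Construction.check_large_large_small ((n - 148) / 4) (by omega)
  · exact Construction.exists_graph Construction.check_large_small_small ((n - 145) / 4) (by omega)
  · exact Construction.exists_graph Construction.check_small_small_small ((n - 142) / 4) (by omega)
  · exact Construction.exists_graph Construction.check_large_large_large ((n - 151) / 4) (by omega)
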